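/- **Setting.** Let $\mathbb G$ be a Carnot group of step $2$: a connected, simply connected, finite-dimensional real Lie group whose Lie algebra $\mathfrak g$ of left invariant vector fields has a decomposition $\mathfrak g=V_1\oplus V_2$ with $[V_1,V_1]=V_2\neq\{0\}$ and $[V_2,V_1]=\{0\}$. Fix an inner product on $V_1$, an orthonormal basis $X_1,\dots,X_m$ of $V_1$, and a right Haar measure $\mathrm{vol}$ on $\mathbb G$. Let $d$ be the Carnot–Carathéodory distance: $d(x,y)^2$ is the infimum of $\int_0^1\sum_i|a_i(t)|^2\,dt$ over the Lipschitz curves $\gamma:[0,1]\to\mathbb G$ with $\gamma(0)=x$, $\gamma(1)=y$ and $\gamma'(t)=\sum_i a_i(t)X_i(\gamma(t))$ for a.e. $t$. Let $B_r(x)$ denote its open balls. For $X\in\mathfrak g$ and a Borel set $E\subseteq\mathbb G$, let $X\mathbf 1_E$ be the distribution $\langle X\mathbf 1_E,v\rangle=-\int_E Xv\,d\mathrm{vol}$, $v\in C_c^\infty(\mathbb G)$. The set $E$ has *locally finite perimeter* if $X\mathbf 1_E$ is a (real valued) Radon measure for every $X\in V_1$. In that case $D\mathbf 1_E=(X_1\mathbf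 1_E,\dots,X_m\mathbf 1_E)$ is an $\mathbb R^m$-valued Radon measure; $|D\mathbf 1_E|$ denotes its total variation. The *horizontal normal* of $E$ is $$\nu_E(x)=\lim_{r\downarrow 0}\frac{D\mathbf 1_E(B_r(x))}{|D\mathbf 1_E|(B_r(x))},$$ defined at the points $x\in\operatorname{supp}|D\mathbf 1_E|$ at which this limit exists and has Euclidean norm $1$. A Borel set $H\subseteq\mathbb G$ is a *vertical halfspace* if $X\mathbf 1_H=0$ for all $X\in V_2$, $\{X\in V_1: X\mathbf 1_H=0\}$ is a linear subspace of codimension one of $V_1$, and there is $X\in V_1$ with $X\mathbf 1_H\ge 0$ and $X\mathbf 1_H\ne 0$. **Proposition.** Let $E\subseteq\mathbb G$ be a set of locally finite perimeter with $|D\mathbf 1_E|\neq 0$. Assume that $\nu_E$ is equivalent to a constant, that is, there is $\xi\in\mathbb R^m$ such that, for $|D\mathbf 1_E|$-a.e. $x\in\mathbb G$, $\nu_E(x)$ is defined and equal to $\xi$. Then $E$ is a vertical halfspace. -/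

import Mathlib

open MeasureTheory Set Filter Topology
open scoped Manifold ContDiff ENNReal

noncomputable section

namespace Carnot

/-! ### Stratified Lie groups and left invariant vector fields -/

section LieGroups

variable {F : Type*} [NormedAddCommGroup F] [NormedSpace ℝ F]
  {G : Type*} [TopologicalSpace G] [ChartedSpace F G] [Group G]

/-- `[V, W]`: the linear span of all brackets `[v, w]` with `v ∈ V` and `w ∈ W`. -/
def bracketSpan (V W : Submodule ℝ (GroupLieAlgebra 𝓘(ℝ, F) G)) :
    Submodule ℝ (GroupLieAlgebra 𝓘(ℝ, F) G) :=
  Submodule.span ℝ {z | ∃ v ∈ V, ∃ w ∈ W, z = ⁅v, w⁆}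

/-- `V 1, …, V s` is a stratification of step `s` of the Lie algebra `𝔤` of `G`:
`𝔤 = V 1 ⊕ ⋯ ⊕ V s`, `[V j, V 1] = V (j + 1)` for `1 ≤ j ≤ s`, `V s ≠ 0`, `V (s + 1) = 0`.
The spaces `V j` with `j = 0` or `j > s + 1` play no role. -/
structure IsStratification (s : ℕ) (V : ℕ → Submodule ℝ (GroupLieAlgebra 𝓘(ℝ, F) G)) : Prop where
  one_le_step : 1 ≤ s
  isInternal : DirectSum.IsInternal (fun i : Fin s => V ((i : ℕ) + 1))
  bracket : ∀ j, 1 ≤ j → j ≤ s → bracketSpan (V j) (V 1) = V (j + 1)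
  last_ne_bot : V s ≠ ⊥
  after_last : V (s + 1) = ⊥

/-- `G` (with its structure of a real Lie group, modelled on `F`) and the layers `V` form a Carnot
group of step `s`: a connected, simply connected, finite-dimensional Lie group with a step `s`
stratification of its Lie algebra. -/
structure IsCarnotGroup (s : ℕ) (V : ℕ → Submodule ℝ (GroupLieAlgebra 𝓘(ℝ, F) G)) : Prop where
  lieGroup : LieGroup 𝓘(ℝ, F) ∞ G
  hausdorff : T2Space G
  secondCountable : SecondCountableTopology G
  finiteDimensional : FiniteDimensional ℝ F
  simplyConnected : SimplyConnectedSpace G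
  stratified : IsStratification s V

/-- Smooth compactly supported functions on `G`. -/
def IsTest (v : G → ℝ) : Prop :=
  ContMDiff 𝓘(ℝ, F) 𝓘(ℝ, ℝ) ∞ v ∧ HasCompactSupport v

/-- `Xv`, the derivative of the function `v` along the left invariant vector field `X`. -/
def lieDeriv (X : GroupLieAlgebra 𝓘(ℝ, F) G) (v : G → ℝ) (x : G) : ℝ :=
  mfderiv 𝓘(ℝ, F) 𝓘(ℝ, ℝ) v x (mulInvariantVectorField X x)

end LieGroups

/-! ### The Carnot-Carathéodory distance -/

section Distance

variable {F : Type*} [NormedAddCommGroup F] [NormedSpace ℝ F]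
  {G : Type*} [TopologicalSpace G] [ChartedSpace F G] [Group G] {m : ℕ}

/-- `γ : [0, 1] → G` is a horizontal curve with controls `a`: it is Lipschitz and
`γ'(t) = ∑ i, a i (t) X i (γ t)` for a.e. `t`. A curve in a manifold is Lipschitz on a compact
interval (in charts, equivalently for any Riemannian distance) if and only if its compositions with
smooth real functions are. -/
structure IsHorizontalCurve (X : Fin m → GroupLieAlgebra 𝓘(ℝ, F) G) (γ : ℝ → G)
    (a : ℝ → EuclideanSpace ℝ (Fin m)) : Prop where
  measurable : Measurable a
  lipschitz : ∀ u : G → ℝ, ContMDiff 𝓘(ℝ, F) 𝓘(ℝ, ℝ) ∞ u →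
    ∃ K, LipschitzOnWith K (u ∘ γ) (Icc 0 1)
  deriv : ∀ᵐ t ∂(volume.restrict (Ioo (0 : ℝ) 1)),
    HasMFDerivAt 𝓘(ℝ, ℝ) 𝓘(ℝ, F) γ t
      ((1 : ℝ →L[ℝ] ℝ).smulRight (∑ i, a t i • mulInvariantVectorField (X i) (γ t)))

/-- The Carnot-Carathéodory distance, the square root of the infimum of the energies
`∫₀¹ ∑ i, |a i (t)|² dt` of the horizontal curves from `x` to `y`. -/
def ccDist (X : Fin m → GroupLieAlgebra 𝓘(ℝ, F) G) (x y : G) : ℝ≥0∞ :=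
  (⨅ (γ : ℝ → G) (a : ℝ → EuclideanSpace ℝ (Fin m)) (_ : IsHorizontalCurve X γ a)
    (_ : γ 0 = x) (_ : γ 1 = y), ∫⁻ t in Icc (0 : ℝ) 1, ‖a t‖ₑ ^ 2) ^ (1 / 2 : ℝ)

/-- The open ball `B_r(x)` of the Carnot-Carathéodory distance. -/
def ccBall (X : Fin m → GroupLieAlgebra 𝓘(ℝ, F) G) (x : G) (r : ℝ) : Set G :=
  {y | ccDist X x y < ENNReal.ofReal r}

end Distance

/-! ### Real and vector valued Radon measures -/

section Radon

variable {G : Type*} [TopologicalSpace G] [MeasurableSpace G] {m : ℕ}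

/-- A real valued Radon measure, given as the difference of two nonnegative Radon measures (on the
spaces considered here, Borel measures that are finite on compact sets). -/
structure RadonMeasure (G : Type*) [TopologicalSpace G] [MeasurableSpace G] where
  pos : Measure G
  neg : Measure G
  finite_pos : IsFiniteMeasureOnCompacts pos
  finite_neg : IsFiniteMeasureOnCompacts neg

/-- `μ(B)`, for bounded (that is, relatively compact) Borel sets `B`. -/
def RadonMeasure.apply (μ : RadonMeasure G) (B : Set G) : ℝ :=
  (μ.pos B).toReal - (μ.neg B).toReal

/-- `∫ v dμ`, for compactly supported continuous `v`. -/
def RadonMeasure.integral (μ : RadonMeasure G) (v : G → ℝ) : ℝ :=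
  (∫ x, v x ∂μ.pos) - ∫ x, v x ∂μ.neg

/-- `D(B)` for an `ℝ^m`-valued Radon measure `D = (D 1, …, D m)` and a bounded Borel set `B`. -/
def vectorApply (D : Fin m → RadonMeasure G) (B : Set G) : EuclideanSpace ℝ (Fin m) :=
  WithLp.toLp 2 (fun i => (D i).apply B)

/-- The total variation `|D|` of an `ℝ^m`-valued Radon measure: the smallest nonnegative measure `ν`
with `|D(B)| ≤ ν(B)` for all bounded Borel sets `B`. -/
def totalVariation (D : Fin m → RadonMeasure G) : Measure G :=
  sInf {ν | ∀ B, MeasurableSet B → (∃ K, IsCompact K ∧ B ⊆ K) → ‖vectorApply D B‖ₑ ≤ ν B}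

end Radon

/-! ### Distributional derivatives, perimeter, horizontal normal, vertical halfspaces -/

section Perimeter

variable {F : Type*} [NormedAddCommGroup F] [NormedSpace ℝ F]
  {G : Type*} [TopologicalSpace G] [ChartedSpace F G] [Group G] [MeasurableSpace G] {m : ℕ}

/-- `⟨X 𝟙_E, v⟩ = - ∫ 𝟙_E Xv dvol`, the distributional derivative of the characteristic function
of `E` along `X`, evaluated at a test function `v`. -/
def distDeriv (vol : Measure G) (X : GroupLieAlgebra 𝓘(ℝ, F) G) (E : Set G) (v : G → ℝ) : ℝ :=
  -∫ x, E.indicator (fun _ => (1 : ℝ)) x * lieDeriv X v x ∂vol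

/-- `X 𝟙_E = μ` for a Radon measure `μ`. -/
def DerivEqMeasure (vol : Measure G) (X : GroupLieAlgebra 𝓘(ℝ, F) G) (E : Set G)
    (μ : RadonMeasure G) : Prop :=
  ∀ v : G → ℝ, IsTest (F := F) v → distDeriv vol X E v = μ.integral v

/-- The Borel set `E` has locally finite perimeter: `X 𝟙_E` is a Radon measure for every `X` in the
horizontal layer `V₁`. -/
def LocallyFinitePerimeter (vol : Measure G) (V₁ : Submodule ℝ (GroupLieAlgebra 𝓘(ℝ, F) G))
    (E : Set G) : Prop :=
  MeasurableSet E ∧ ∀ X ∈ V₁, ∃ μ : RadonMeasure G, DerivEqMeasure vol X E μ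

/-- `D 𝟙_E = (X 1 𝟙_E, …, X m 𝟙_E)` is the `ℝ^m`-valued Radon measure `D`. -/
def IsGradient (vol : Measure G) (X : Fin m → GroupLieAlgebra 𝓘(ℝ, F) G) (E : Set G)
    (D : Fin m → RadonMeasure G) : Prop :=
  ∀ i, DerivEqMeasure vol (X i) E (D i)

/-- For `D = D 𝟙_E`: the point `x` belongs to the reduced boundary of `E`, and the horizontal normal
of `E` at `x` is `ν`. That is, `x` lies in the support of `|D|`, the quotients
`D(B_r(x)) / |D|(B_r(x))` converge to `ν` as `r ↓ 0`, and `|ν| = 1`. -/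
structure IsHorizontalNormalAt (X : Fin m → GroupLieAlgebra 𝓘(ℝ, F) G)
    (D : Fin m → RadonMeasure G) (x : G) (ν : EuclideanSpace ℝ (Fin m)) : Prop where
  mem_support : ∀ r : ℝ, 0 < r → 0 < totalVariation D (ccBall X x r)
  tendsto : Tendsto
    (fun r : ℝ => (totalVariation D (ccBall X x r)).toReal⁻¹ • vectorApply D (ccBall X x r))
    (𝓝[>] 0) (𝓝 ν)
  norm_eq_one : ‖ν‖ = 1

/-- `Inv(E)`: the left invariant vector fields `X` with `X 𝟙_E = 0`. -/
def Inv (vol : Measure G) (E : Set G) : Set (GroupLieAlgebra 𝓘(ℝ, F) G) :=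
  {X | ∀ v : G → ℝ, IsTest (F := F) v → distDeriv vol X E v = 0}

/-- `Inv₀(E)`: the homogeneous elements of `Inv(E)`, those in one of the layers. -/
def Inv₀ (vol : Measure G) (s : ℕ) (V : ℕ → Submodule ℝ (GroupLieAlgebra 𝓘(ℝ, F) G))
    (E : Set G) : Set (GroupLieAlgebra 𝓘(ℝ, F) G) :=
  Inv vol E ∩ ⋃ i ∈ Icc 1 s, (V i : Set (GroupLieAlgebra 𝓘(ℝ, F) G))

/-- Vertical halfspaces: the Borel sets `H` such that `Inv₀(H)` contains the layers `V 2, …, V s`,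
`V 1 ∩ Inv₀(H)` is a linear subspace of codimension one of `V 1`, and `X 𝟙_H ≥ 0`, `X 𝟙_H ≠ 0` (as
distributions) for some `X` in `V 1`. -/
structure IsVerticalHalfspace (vol : Measure G) (s : ℕ)
    (V : ℕ → Submodule ℝ (GroupLieAlgebra 𝓘(ℝ, F) G)) (H : Set G) : Prop where
  measurable : MeasurableSet H
  higher_layers : ∀ i, 2 ≤ i → i ≤ s →
    (V i : Set (GroupLieAlgebra 𝓘(ℝ, F) G)) ⊆ Inv₀ vol s V H
  codim_one : ∃ W : Submodule ℝ (GroupLieAlgebra 𝓘(ℝ, F) G),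
    (W : Set (GroupLieAlgebra 𝓘(ℝ, F) G)) = (V 1 : Set (GroupLieAlgebra 𝓘(ℝ, F) G)) ∩ Inv₀ vol s V H
      ∧ Module.finrank ℝ W + 1 = Module.finrank ℝ (V 1)
  monotone : ∃ X ∈ V 1,
    (∀ v : G → ℝ, IsTest (F := F) v → (∀ x, 0 ≤ v x) → 0 ≤ distDeriv vol X H v) ∧
    ∃ v : G → ℝ, IsTest (F := F) v ∧ distDeriv vol X H v ≠ 0

end Perimeter

end Carnot

end

/-! ### Lie brackets as commutators of derivations. -/

noncomputable section

namespace Carnot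

section VectorFields

variable {F : Type*} [NormedAddCommGroup F] [NormedSpace ℝ F]
  {M : Type*} [TopologicalSpace M] [ChartedSpace F M]
  {E : Type*} [NormedAddCommGroup E] [NormedSpace ℝ E]

open VectorField

/-! Write `D` for the vector measure and `|D|` for its total variation. The proof has an analytic
half, which turns the hypothesis on the normal into `D = ξ |D|`, and an algebraic half, which
derives the halfspace from this identity.

Analytic half. The defect `|D| - ⟨D, ξ⟩` is a nonnegative measure, absolutely continuous with
respect to `|D|`. Since the normal equals `ξ` almost everywhere, the ratio of the defect of `B_r(x)`
to `|D|(B_r(x))` tends to `1 - |ξ|² = 0` at `|D|`-a.e. `x`. To conclude that the defect is zero one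
has to differentiate measures along Carnot-Carathéodory balls, without knowing that `|D|` is
doubling. Asymptotic doubling along some radii is enough. In step two, `exp (t [X_i, X_j])` is a
product of four horizontal exponentials of length `√|t|`, so a ball of radius `r` contains a
coordinate ball of radius comparable to `r²` (`exists_extChartAt_mem_ccBall`). Hence, in dimension
`n`, a small piece of the group is covered by at most a constant times `r ^ (-2n)` balls of radius
`r`. A point at which `|D|` grows at every small scale by a factor `3 * 9 ^ n` when the radius is
tripled has balls of measure `O((3 * 9 ^ n)^(-k))` at scale `3^(-k)`; the covering bound `9 ^ (n *
k)` makes the set of such points null (`IsChartOn.measure_eq_zero`). At all other points there are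
arbitrarily small doubling radii, and a Vitali covering finishes the argument
(`IsBallFamily.eq_zero_of_density_eq_zero`, `defect_eq_zero_of_isHorizontalNormalAt`). The equality
case of Cauchy-Schwarz then gives `D = ξ |D|`.

Algebraic half. Now `X 𝟙_E = l(X) |D|` for `X` in `V 1`, with a nonzero linear form `l`. Fields in
`ker l` annihilate `𝟙_E`, so `E` is invariant under their flows, while a field `Y` with `l Y = 1`
has `Y 𝟙_E ≥ 0`. For `X` in `ker l`, flowing by `exp (t X)` changes `Y` into `Y + t [X, Y]`, because
`[X, [X, Y]] = 0`; so a quantity affine in `t` is nonnegative for all real `t`, and its slope, `[X,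
Y] 𝟙_E` tested on a nonnegative function, vanishes (`lie_mem_Inv_of_nonneg`). As `V 1 = ker l ⊕ ℝ Y`
and `V 2 = [V 1, V 1]`, all of `V 2` annihilates `𝟙_E` (`isVerticalHalfspace_of_distDeriv_eq`). -/

lemma fderiv_comp_extChartAt_symm [IsManifold 𝓘(ℝ, F) 1 M] {f : M → E} {x₀ : M} {p : F}
    (hp : p ∈ (extChartAt 𝓘(ℝ, F) x₀).target)
    (hf : MDifferentiableAt 𝓘(ℝ, F) 𝓘(ℝ, E) f ((extChartAt 𝓘(ℝ, F) x₀).symm p)) (u : F) :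
    fderiv ℝ (f ∘ (extChartAt 𝓘(ℝ, F) x₀).symm) p u =
      mfderiv 𝓘(ℝ, F) 𝓘(ℝ, E) f ((extChartAt 𝓘(ℝ, F) x₀).symm p)
        (mfderivWithin 𝓘(ℝ, F) 𝓘(ℝ, F) (extChartAt 𝓘(ℝ, F) x₀).symm (range 𝓘(ℝ, F)) p u) := by
  have h1 : MDifferentiableAt 𝓘(ℝ, F) 𝓘(ℝ, F) (extChartAt 𝓘(ℝ, F) x₀).symm p := by
    have := mdifferentiableWithinAt_extChartAt_symm (I := 𝓘(ℝ, F)) hp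
    rwa [ModelWithCorners.range_eq_univ, mdifferentiableWithinAt_univ] at this
  rw [ModelWithCorners.range_eq_univ, mfderivWithin_univ, ← mfderiv_eq_fderiv,
    mfderiv_comp p hf h1]
  rfl

/-- Moves a derivative along a field on the manifold to one along its pullback to `F`, where the
bracket identity becomes a computation with second derivatives. -/
lemma mfderiv_apply_eq_fderiv_comp_extChartAt_symm [IsManifold 𝓘(ℝ, F) 1 M] {f : M → E} {x₀ : M}
    {p : F} (hp : p ∈ (extChartAt 𝓘(ℝ, F) x₀).target)
    (hf : MDifferentiableAt 𝓘(ℝ, F) 𝓘(ℝ, E) f ((extChartAt 𝓘(ℝ, F) x₀).symm p))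
    (V : Π x : M, TangentSpace 𝓘(ℝ, F) x) :
    mfderiv 𝓘(ℝ, F) 𝓘(ℝ, E) f ((extChartAt 𝓘(ℝ, F) x₀).symm p)
        (V ((extChartAt 𝓘(ℝ, F) x₀).symm p)) =
      fderiv ℝ (f ∘ (extChartAt 𝓘(ℝ, F) x₀).symm) p
        (mpullbackWithin 𝓘(ℝ, F) 𝓘(ℝ, F) (extChartAt 𝓘(ℝ, F) x₀).symm V (range 𝓘(ℝ, F)) p) := by
  refine Eq.trans ?_ (fderiv_comp_extChartAt_symm hp hf _).symm
  rw [mpullbackWithin_apply, (isInvertible_mfderivWithin_extChartAt_symm hp).self_apply_inverse]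

/-- The derivative of the vector valued function `f` along the vector field `V`. -/
def fieldDeriv (V : Π x : M, TangentSpace 𝓘(ℝ, F) x) (f : M → E) (x : M) : E :=
  mfderiv 𝓘(ℝ, F) 𝓘(ℝ, E) f x (V x)

/-- The Lie bracket of two vector fields is the commutator of the derivations they define. -/
lemma fieldDeriv_mlieBracket [CompleteSpace F] [IsManifold 𝓘(ℝ, F) ∞ M]
    {V W : Π x : M, TangentSpace 𝓘(ℝ, F) x} {x₀ : M} {f : M → E}
    (hV : MDifferentiableAt 𝓘(ℝ, F) 𝓘(ℝ, F).tangent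
      (fun x => (V x : TangentBundle 𝓘(ℝ, F) M)) x₀)
    (hW : MDifferentiableAt 𝓘(ℝ, F) 𝓘(ℝ, F).tangent
      (fun x => (W x : TangentBundle 𝓘(ℝ, F) M)) x₀)
    (hf : ContMDiff 𝓘(ℝ, F) 𝓘(ℝ, E) ∞ f)
    (hVf : MDifferentiableAt 𝓘(ℝ, F) 𝓘(ℝ, E) (fieldDeriv V f) x₀)
    (hWf : MDifferentiableAt 𝓘(ℝ, F) 𝓘(ℝ, E) (fieldDeriv W f) x₀) :
    fieldDeriv (mlieBracket 𝓘(ℝ, F) V W) f x₀ =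
      fieldDeriv V (fieldDeriv W f) x₀ - fieldDeriv W (fieldDeriv V f) x₀ := by
  have : IsManifold 𝓘(ℝ, F) 1 M := .of_le (n := ∞) (by simp)
  have : IsManifold 𝓘(ℝ, F) 2 M := .of_le (n := ∞) (WithTop.coe_le_coe.2 (le_top : (2 : ℕ∞) ≤ ⊤))
  have hfd : MDifferentiable 𝓘(ℝ, F) 𝓘(ℝ, E) f := hf.mdifferentiable (by simp)
  set φ := extChartAt 𝓘(ℝ, F) x₀ with hφ
  set p₀ : F := φ x₀ with hp₀
  have hp₀t : p₀ ∈ φ.target := mem_extChartAt_target x₀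
  have hx₀ : φ.symm p₀ = x₀ := extChartAt_to_inv x₀
  have hnt : ∀ᶠ p in 𝓝 p₀, p ∈ φ.target := extChartAt_target_mem_nhds x₀
  set V' : F → F := mpullbackWithin 𝓘(ℝ, F) 𝓘(ℝ, F) φ.symm V (range 𝓘(ℝ, F)) with hV'
  set W' : F → F := mpullbackWithin 𝓘(ℝ, F) 𝓘(ℝ, F) φ.symm W (range 𝓘(ℝ, F)) with hW'
  have hVd : DifferentiableAt ℝ V' p₀ := by
    have h : DifferentiableWithinAt ℝ V' (φ.symm ⁻¹' univ ∩ range 𝓘(ℝ, F)) p₀ :=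
      MDifferentiableWithinAt.differentiableWithinAt_mpullbackWithin_vectorField
        hV.mdifferentiableWithinAt
    rwa [ModelWithCorners.range_eq_univ, preimage_univ, inter_univ,
      differentiableWithinAt_univ] at h
  have hWd : DifferentiableAt ℝ W' p₀ := by
    have h : DifferentiableWithinAt ℝ W' (φ.symm ⁻¹' univ ∩ range 𝓘(ℝ, F)) p₀ :=
      MDifferentiableWithinAt.differentiableWithinAt_mpullbackWithin_vectorField
        hW.mdifferentiableWithinAt
    rwa [ModelWithCorners.range_eq_univ, preimage_univ, inter_univ,
      differentiableWithinAt_univ] at h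
  set f' : F → E := f ∘ φ.symm with hf'
  have hf2 : ContDiffAt ℝ 2 f' p₀ := by
    have h1 : ContMDiffOn 𝓘(ℝ, F) 𝓘(ℝ, F) 2 φ.symm φ.target := contMDiffOn_extChartAt_symm x₀
    have h2 : ContMDiffAt 𝓘(ℝ, F) 𝓘(ℝ, F) 2 φ.symm p₀ := h1.contMDiffAt hnt
    have h3 : ContMDiffAt 𝓘(ℝ, F) 𝓘(ℝ, E) 2 f (φ.symm p₀) :=
      (hf.of_le (WithTop.coe_le_coe.2 (le_top : (2 : ℕ∞) ≤ ⊤))).contMDiffAt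
    exact (h3.comp p₀ h2).contDiffAt
  have hdf : DifferentiableAt ℝ (fderiv ℝ f') p₀ :=
    (hf2.fderiv_right (m := 1) (by norm_num)).differentiableAt (by simp)
  have key : ∀ U : Π x : M, TangentSpace 𝓘(ℝ, F) x,
      (fieldDeriv U f ∘ φ.symm) =ᶠ[𝓝 p₀]
      fun p => fderiv ℝ f' p (mpullbackWithin 𝓘(ℝ, F) 𝓘(ℝ, F) φ.symm U (range 𝓘(ℝ, F)) p) :=
    fun U => hnt.mono fun p hp => mfderiv_apply_eq_fderiv_comp_extChartAt_symm hp (hfd _) U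
  have e1 : fieldDeriv V (fieldDeriv W f) x₀ =
      fderiv ℝ (fun p => fderiv ℝ f' p (W' p)) p₀ (V' p₀) := by
    have := mfderiv_apply_eq_fderiv_comp_extChartAt_symm hp₀t (f := fieldDeriv W f)
      (by rw [← hφ, hx₀]; exact hWf) V
    rw [← hφ, (key W).fderiv_eq, hx₀] at this
    exact this
  have e2 : fieldDeriv W (fieldDeriv V f) x₀ =
      fderiv ℝ (fun p => fderiv ℝ f' p (V' p)) p₀ (W' p₀) := by
    have := mfderiv_apply_eq_fderiv_comp_extChartAt_symm hp₀t (f := fieldDeriv V f)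
      (by rw [← hφ, hx₀]; exact hVf) W
    rw [← hφ, (key V).fderiv_eq, hx₀] at this
    exact this
  have e3 : fieldDeriv (mlieBracket 𝓘(ℝ, F) V W) f x₀ =
      fderiv ℝ f' p₀ (lieBracket ℝ V' W' p₀) := by
    -- In tangent coordinates the chart centred at `x₀` has the identity as derivative at `x₀`, so
    -- the bracket on the manifold and that of the pullbacks are the same vector of `F`.
    have h1 : (mlieBracket 𝓘(ℝ, F) V W x₀ : F) = lieBracket ℝ V' W' p₀ := by
      rw [← mlieBracketWithin_univ, mlieBracketWithin_apply, mfderiv_extChartAt_self]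
      refine (congrArg (fun L : F →L[ℝ] F => L (lieBracketWithin ℝ V' W'
        (φ.symm ⁻¹' univ ∩ range 𝓘(ℝ, F)) p₀)) ContinuousLinearMap.inverse_id).trans ?_
      change lieBracketWithin ℝ V' W' (φ.symm ⁻¹' univ ∩ range 𝓘(ℝ, F)) p₀ = _
      rw [ModelWithCorners.range_eq_univ, preimage_univ, inter_univ, lieBracketWithin_univ]
    let w : F := lieBracket ℝ V' W' p₀
    have h2 : fderiv ℝ f' p₀ w = mfderiv 𝓘(ℝ, F) 𝓘(ℝ, E) f (φ.symm p₀) w := by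
      refine (fderiv_comp_extChartAt_symm hp₀t (hfd _) _).trans ?_
      refine congrArg (mfderiv 𝓘(ℝ, F) 𝓘(ℝ, E) f (φ.symm p₀)) ?_
      exact congrArg (fun L : F →L[ℝ] F => L w)
        mfderivWithin_range_extChartAt_symm
    rw [hx₀] at h2
    refine Eq.trans ?_ h2.symm
    exact congrArg (mfderiv 𝓘(ℝ, F) 𝓘(ℝ, E) f x₀) h1
  rw [e3, e1, e2, fderiv_clm_apply hdf hWd, fderiv_clm_apply hdf hVd, lieBracket]
  -- The second derivatives of `f'` cancel by symmetry; what is left are the derivatives of the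
  -- coefficients, which form the bracket.
  have hsymm : IsSymmSndFDerivAt ℝ f' p₀ := hf2.isSymmSndFDerivAt (by simp)
  simp only [map_sub, add_apply, ContinuousLinearMap.comp_apply,
    ContinuousLinearMap.flip_apply, hsymm.eq (V' p₀) (W' p₀)]
  abel

end VectorFields
end Carnot
end

/-! ### Left invariant fields and one-parameter subgroups. -/

noncomputable section

namespace Carnot

section LieGroupCalculus

variable {F : Type*} [NormedAddCommGroup F] [NormedSpace ℝ F]
  {G : Type*} [TopologicalSpace G] [ChartedSpace F G] [Group G] [LieGroup 𝓘(ℝ, F) ∞ G]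
  {E : Type*} [NormedAddCommGroup E] [NormedSpace ℝ E]

/-- The regularity at which the Lie algebra structure and the bracket of invariant fields are
available. -/
lemma lieGroup_minSmoothness : LieGroup 𝓘(ℝ, F) (minSmoothness ℝ 3) G :=
  LieGroup.of_le (n := ∞) (by
    rw [minSmoothness_of_isRCLikeNormedField]; exact WithTop.coe_le_coe.2 (le_top : (3 : ℕ∞) ≤ ⊤))

attribute [local instance] lieGroup_minSmoothness

/-- The field is the tangent map of the multiplication composed with the smooth section `g ↦ ((g,
0), (1, v))`; hence it is as smooth as the group. -/
theorem contMDiff_infty_mulInvariantVectorField (v : GroupLieAlgebra 𝓘(ℝ, F) G) :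
    ContMDiff 𝓘(ℝ, F) 𝓘(ℝ, F).tangent ∞
      (fun g : G => (mulInvariantVectorField v g : TangentBundle 𝓘(ℝ, F) G)) := by
  let I := 𝓘(ℝ, F)
  let fg : G → TangentBundle I G := fun g ↦ Bundle.TotalSpace.mk' F g 0
  have sfg : CMDiff ∞ fg := Bundle.contMDiff_zeroSection _ _
  let fv : G → TangentBundle I G := fun _ ↦ Bundle.TotalSpace.mk' F 1 v
  have sfv : CMDiff ∞ fv := contMDiff_const
  let F₁ : G → (TangentBundle I G × TangentBundle I G) := fun g ↦ (fg g, fv g)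
  have S₁ : CMDiff ∞ F₁ := sfg.prodMk sfv
  let F₂ : (TangentBundle I G × TangentBundle I G) → TangentBundle (I.prod I) (G × G) :=
    (equivTangentBundleProd I G I G).symm
  have S₂ : CMDiff ∞ F₂ := contMDiff_equivTangentBundleProd_symm
  let F₃ : TangentBundle (I.prod I) (G × G) → TangentBundle I G :=
    tangentMap (I.prod I) I (fun (p : G × G) ↦ p.1 * p.2)
  have S₃ : CMDiff ∞ F₃ := by
    apply ContMDiff.contMDiff_tangentMap (n := ∞) _ (m := ∞) (by simp)
    exact contMDiff_mul I ∞
  let S := (S₃.comp S₂).comp S₁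
  convert! S with g
  · simp [F₁, F₂, F₃, fg, fv]
  · simp only [Function.comp_apply, tangentMap, F₃, F₂, F₁, fg, fv]
    rw [mfderiv_prod_eq_add_apply ((contMDiff_mul I ∞).mdifferentiableAt (by simp))]
    simp only [mulInvariantVectorField, I]
    exact ((congrArg₂ (· + ·) (map_zero _) rfl).trans (zero_add _)).symm

/-- The derivative of a vector valued function along a left invariant vector field. -/
abbrev dirDeriv (X : GroupLieAlgebra 𝓘(ℝ, F) G) (f : G → E) : G → E :=
  fieldDeriv (mulInvariantVectorField X) f

/-- The derivative is the fibre component of the tangent map of `f` along a smooth section. This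
allows the derivations to be iterated. -/
lemma contMDiff_dirDeriv (X : GroupLieAlgebra 𝓘(ℝ, F) G) {f : G → E}
    (hf : ContMDiff 𝓘(ℝ, F) 𝓘(ℝ, E) ∞ f) : ContMDiff 𝓘(ℝ, F) 𝓘(ℝ, E) ∞ (dirDeriv X f) := by
  have h1 : ContMDiff 𝓘(ℝ, F).tangent 𝓘(ℝ, E).tangent ∞ (tangentMap 𝓘(ℝ, F) 𝓘(ℝ, E) f) :=
    hf.contMDiff_tangentMap (by simp)
  have h2 := (contMDiff_snd_tangentBundle_modelSpace E 𝓘(ℝ, E) (n := ∞)).comp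
    (h1.comp (contMDiff_infty_mulInvariantVectorField X))
  exact h2

lemma dirDeriv_lie [CompleteSpace F] (X Y : GroupLieAlgebra 𝓘(ℝ, F) G) {f : G → E}
    (hf : ContMDiff 𝓘(ℝ, F) 𝓘(ℝ, E) ∞ f) (x : G) :
    dirDeriv ⁅X, Y⁆ f x = dirDeriv X (dirDeriv Y f) x - dirDeriv Y (dirDeriv X f) x := by
  have : IsManifold 𝓘(ℝ, F) ∞ G := inferInstance
  rw [← fieldDeriv_mlieBracket (mdifferentiableAt_mulInvariantVectorField X)
    (mdifferentiableAt_mulInvariantVectorField Y) hf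
    ((contMDiff_dirDeriv X hf).mdifferentiableAt (by simp))
    ((contMDiff_dirDeriv Y hf).mdifferentiableAt (by simp)),
    ← mulInvariantVector_mlieBracket, GroupLieAlgebra.bracket_def]

omit [LieGroup 𝓘(ℝ, F) ∞ G] in
lemma dirDeriv_add (X Y : GroupLieAlgebra 𝓘(ℝ, F) G) (f : G → E) :
    dirDeriv (X + Y) f = dirDeriv X f + dirDeriv Y f := by
  ext x
  simp [dirDeriv, fieldDeriv, mulInvariantVectorField_add]
  rfl

omit [LieGroup 𝓘(ℝ, F) ∞ G] in
lemma dirDeriv_smul (c : ℝ) (X : GroupLieAlgebra 𝓘(ℝ, F) G) (f : G → E) :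
    dirDeriv (c • X) f = c • dirDeriv X f := by
  ext x
  simp [dirDeriv, fieldDeriv, mulInvariantVectorField_smul]
  rfl

lemma mfderiv_mul_left_mulInvariantVectorField (X : GroupLieAlgebra 𝓘(ℝ, F) G) (g x : G) :
    mfderiv 𝓘(ℝ, F) 𝓘(ℝ, F) (g * ·) x (mulInvariantVectorField X x) =
      mulInvariantVectorField X (g * x) := by
  have h : ((g * x) * · : G → G) = (g * ·) ∘ (x * ·) := by ext y; simp [mul_assoc]
  have hm : ∀ (a b : G), MDifferentiableAt 𝓘(ℝ, F) 𝓘(ℝ, F) (a * ·) b := fun a b =>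
    (contMDiff_mul_left (I := 𝓘(ℝ, F)) (n := ∞)).mdifferentiableAt (by simp)
  simp only [mulInvariantVectorField]
  rw [h, mfderiv_comp (I' := 𝓘(ℝ, F)) 1 (hm _ _) (hm _ _)]
  -- The tangent spaces at `x * 1` and `x` are both `F`, but the equality of the base points is not
  -- definitional and has to be transported.
  have key : ∀ y : G, y = x → (mfderiv 𝓘(ℝ, F) 𝓘(ℝ, F) (g * ·) y : F →L[ℝ] F) =
    mfderiv 𝓘(ℝ, F) 𝓘(ℝ, F) (g * ·) x := by rintro y rfl; rfl
  exact congrArg (fun L : F →L[ℝ] F => L (mfderiv 𝓘(ℝ, F) 𝓘(ℝ, F) (x * ·) 1 X))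
    (key (x * 1) (mul_one x)).symm

lemma dirDeriv_comp_mul_left (X : GroupLieAlgebra 𝓘(ℝ, F) G) {f : G → E}
    (hf : ContMDiff 𝓘(ℝ, F) 𝓘(ℝ, E) ∞ f) (g x : G) :
    dirDeriv X (fun y => f (g * y)) x = dirDeriv X f (g * x) := by
  have hm : MDifferentiableAt 𝓘(ℝ, F) 𝓘(ℝ, F) (g * ·) x :=
    (contMDiff_mul_left (I := 𝓘(ℝ, F)) (n := ∞)).mdifferentiableAt (by simp)
  have : (fun y => f (g * y)) = f ∘ (g * ·) := rfl
  rw [this, dirDeriv, fieldDeriv, mfderiv_comp x (hf.mdifferentiableAt (by simp)) hm, dirDeriv,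
    fieldDeriv, ← mfderiv_mul_left_mulInvariantVectorField]
  rfl

lemma comp_smulRight_one {H : Type*} [NormedAddCommGroup H] [NormedSpace ℝ H] (L : H →L[ℝ] E)
    (w : H) : L.comp ((1 : ℝ →L[ℝ] ℝ).smulRight w) = (1 : ℝ →L[ℝ] ℝ).smulRight (L w) := by
  ext; simp

omit [Group G] [LieGroup 𝓘(ℝ, F) ∞ G] in
/-- A curve whose velocity is the left invariant field `X`, tested on a smooth function. -/
lemma hasDerivAt_comp_of_hasMFDerivAt {f : G → E} (hf : ContMDiff 𝓘(ℝ, F) 𝓘(ℝ, E) ∞ f)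
    {γ : ℝ → G} {t : ℝ} {V : Π x : G, TangentSpace 𝓘(ℝ, F) x}
    (h : HasMFDerivAt 𝓘(ℝ, ℝ) 𝓘(ℝ, F) γ t ((1 : ℝ →L[ℝ] ℝ).smulRight (V (γ t)))) :
    HasDerivAt (fun s => f (γ s)) (fieldDeriv V f (γ t)) t := by
  have h1 := ((hf.mdifferentiableAt (x := γ t) (by simp)).hasMFDerivAt).comp t h
  let L : F →L[ℝ] E := mfderiv 𝓘(ℝ, F) 𝓘(ℝ, E) f (γ t)
  let w : F := V (γ t)
  have h2 : HasFDerivAt (f ∘ γ) (L.comp ((1 : ℝ →L[ℝ] ℝ).smulRight w)) t := h1.hasFDerivAt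
  rw [comp_smulRight_one] at h2
  exact hasDerivAt_iff_hasFDerivAt.2 h2

/-! ### One-parameter subgroups -/

section ExpCurve

variable [CompleteSpace F] [T2Space G]

omit [CompleteSpace F] [T2Space G] in
lemma comp_mfderiv_mul_left (X : GroupLieAlgebra 𝓘(ℝ, F) G) (x y : G) :
    (mfderiv 𝓘(ℝ, F) 𝓘(ℝ, F) (x * ·) y : F →L[ℝ] F).comp
      ((1 : ℝ →L[ℝ] ℝ).smulRight (mulInvariantVectorField X y : F)) =
    (1 : ℝ →L[ℝ] ℝ).smulRight (mulInvariantVectorField X (x * y) : F) := by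
  refine (comp_smulRight_one (H := F) (E := F) _ _).trans ?_
  exact congrArg (fun w : F => (1 : ℝ →L[ℝ] ℝ).smulRight w)
    (mfderiv_mul_left_mulInvariantVectorField X x y)

omit [CompleteSpace F] [T2Space G] in
lemma hasMFDerivAt_mul_left {X : GroupLieAlgebra 𝓘(ℝ, F) G} {γ : ℝ → G} {t : ℝ}
    (hγ : HasMFDerivAt 𝓘(ℝ, ℝ) 𝓘(ℝ, F) γ t
      ((1 : ℝ →L[ℝ] ℝ).smulRight (mulInvariantVectorField X (γ t)))) (x : G) :
    HasMFDerivAt 𝓘(ℝ, ℝ) 𝓘(ℝ, F) (fun t => x * γ t) t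
      ((1 : ℝ →L[ℝ] ℝ).smulRight (mulInvariantVectorField X (x * γ t))) := by
  have hm : MDifferentiableAt 𝓘(ℝ, F) 𝓘(ℝ, F) (x * ·) (γ t) :=
    (contMDiff_mul_left (I := 𝓘(ℝ, F)) (n := ∞)).mdifferentiableAt (by simp)
  refine (hm.hasMFDerivAt.comp t hγ).congr_mfderiv ?_
  exact comp_mfderiv_mul_left X x (γ t)

omit [CompleteSpace F] [T2Space G] in
lemma isMIntegralCurveOn_mul_left {X : GroupLieAlgebra 𝓘(ℝ, F) G} {γ : ℝ → G} {S : Set ℝ}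
    (hγ : IsMIntegralCurveOn γ (mulInvariantVectorField X) S) (x : G) :
    IsMIntegralCurveOn (fun t => x * γ t) (mulInvariantVectorField X) S := by
  intro t ht
  have hm : MDifferentiableAt 𝓘(ℝ, F) 𝓘(ℝ, F) (x * ·) (γ t) :=
    (contMDiff_mul_left (I := 𝓘(ℝ, F)) (n := ∞)).mdifferentiableAt (by simp)
  refine (hm.hasMFDerivAt.comp_hasMFDerivWithinAt t (hγ t ht)).congr_mfderiv ?_
  exact comp_mfderiv_mul_left X x (γ t)

omit [CompleteSpace F] [T2Space G] in
lemma isMIntegralCurve_mul_left {X : GroupLieAlgebra 𝓘(ℝ, F) G} {γ : ℝ → G}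
    (hγ : IsMIntegralCurve γ (mulInvariantVectorField X)) (x : G) :
    IsMIntegralCurve (fun t => x * γ t) (mulInvariantVectorField X) :=
  isMIntegralCurve_iff_isMIntegralCurveOn.2
    (isMIntegralCurveOn_mul_left (isMIntegralCurve_iff_isMIntegralCurveOn.1 hγ) x)

/-- Completeness: left translates of one local integral curve through `1` are integral curves with
the same lifetime `ε` through every point, and a uniform lifetime yields global curves. -/
lemma exists_isMIntegralCurve_mulInvariantVectorField (X : GroupLieAlgebra 𝓘(ℝ, F) G) :
    ∃ γ : ℝ → G, γ 0 = 1 ∧ IsMIntegralCurve γ (mulInvariantVectorField X) := by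
  have : IsManifold 𝓘(ℝ, F) 1 G := .of_le (n := ∞) (by simp)
  have hX : ContMDiff 𝓘(ℝ, F) 𝓘(ℝ, F).tangent 1
      (fun g : G => (mulInvariantVectorField X g : TangentBundle 𝓘(ℝ, F) G)) :=
    (contMDiff_infty_mulInvariantVectorField X).of_le (by simp)
  obtain ⟨γ, hγ0, hγ⟩ := exists_isMIntegralCurveAt_of_contMDiffAt_boundaryless (t₀ := 0)
    (hX.contMDiffAt (x := 1))
  obtain ⟨ε, hε, hγ⟩ := isMIntegralCurveAt_iff'.1 hγ
  have hball : Metric.ball (0 : ℝ) ε = Ioo (-ε) ε := by simp [Real.ball_eq_Ioo]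
  rw [hball] at hγ
  refine exists_isMIntegralCurve_of_isMIntegralCurveOn hX hε (fun x => ?_) 1
  exact ⟨fun t => x * γ t, by simp [hγ0], isMIntegralCurveOn_mul_left hγ x⟩

/-- The one-parameter subgroup `t ↦ exp (t X)`. -/
def expCurve (X : GroupLieAlgebra 𝓘(ℝ, F) G) : ℝ → G :=
  (exists_isMIntegralCurve_mulInvariantVectorField X).choose

@[simp] lemma expCurve_zero (X : GroupLieAlgebra 𝓘(ℝ, F) G) : expCurve X 0 = 1 :=
  (exists_isMIntegralCurve_mulInvariantVectorField X).choose_spec.1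

lemma isMIntegralCurve_expCurve (X : GroupLieAlgebra 𝓘(ℝ, F) G) :
    IsMIntegralCurve (expCurve X) (mulInvariantVectorField X) :=
  (exists_isMIntegralCurve_mulInvariantVectorField X).choose_spec.2

lemma continuous_expCurve (X : GroupLieAlgebra 𝓘(ℝ, F) G) : Continuous (expCurve X) :=
  (isMIntegralCurve_expCurve X).continuous

lemma hasDerivAt_comp_expCurve (X : GroupLieAlgebra 𝓘(ℝ, F) G) {f : G → E}
    (hf : ContMDiff 𝓘(ℝ, F) 𝓘(ℝ, E) ∞ f) (t : ℝ) :
    HasDerivAt (fun s => f (expCurve X s)) (dirDeriv X f (expCurve X t)) t :=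
  hasDerivAt_comp_of_hasMFDerivAt hf (isMIntegralCurve_expCurve X t)

lemma hasDerivAt_comp_mul_expCurve (X : GroupLieAlgebra 𝓘(ℝ, F) G) {f : G → E}
    (hf : ContMDiff 𝓘(ℝ, F) 𝓘(ℝ, E) ∞ f) (x : G) (t : ℝ) :
    HasDerivAt (fun s => f (x * expCurve X s)) (dirDeriv X f (x * expCurve X t)) t := by
  rw [← dirDeriv_comp_mul_left X hf]
  exact hasDerivAt_comp_expCurve X (hf.comp contMDiff_mul_left) t

/-- Differentiating replaces `f` by another smooth function, its derivative along `X`, so induction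
on the order applies. -/
lemma contDiff_comp_expCurve (X : GroupLieAlgebra 𝓘(ℝ, F) G) {f : G → E}
    (hf : ContMDiff 𝓘(ℝ, F) 𝓘(ℝ, E) ∞ f) : ContDiff ℝ ∞ (fun s => f (expCurve X s)) := by
  rw [contDiff_infty]
  intro n
  induction n generalizing f with
  | zero => exact contDiff_zero.2 (hf.continuous.comp (continuous_expCurve X))
  | succ n ih =>
    have hd : deriv (fun s => f (expCurve X s)) = fun s => dirDeriv X f (expCurve X s) :=
      funext fun t => (hasDerivAt_comp_expCurve X hf t).deriv
    rw [show ((n + 1 : ℕ) : WithTop ℕ∞) = (n : WithTop ℕ∞) + 1 by push_cast; rfl,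
      contDiff_succ_iff_deriv]
    refine ⟨fun t => (hasDerivAt_comp_expCurve X hf t).differentiableAt, by simp, ?_⟩
    rw [hd]
    exact ih (contMDiff_dirDeriv X hf)

end ExpCurve

/-- Near each point, the chart is the restriction of a global smooth function. -/
lemma exists_contMDiff_eventuallyEq_extChartAt {M : Type*} [TopologicalSpace M] [ChartedSpace F M]
    [FiniteDimensional ℝ F] [T2Space M] [IsManifold 𝓘(ℝ, F) ∞ M] (x : M) :
    ∃ u : M → F, ContMDiff 𝓘(ℝ, F) 𝓘(ℝ, F) ∞ u ∧ u =ᶠ[𝓝 x] extChartAt 𝓘(ℝ, F) x := by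
  obtain ⟨f⟩ : Nonempty (SmoothBumpFunction 𝓘(ℝ, F) x) := inferInstance
  refine ⟨fun y => f y • extChartAt 𝓘(ℝ, F) x y, f.contMDiff_smul ?_, ?_⟩
  · exact (contMDiffOn_extChartAt (I := 𝓘(ℝ, F)) (n := ∞) (x := x)).mono (by simp)
  · filter_upwards [f.eventuallyEq_one] with y hy
    simp [hy]

/-- Smoothness can be tested on global smooth functions, because cutting off a chart by a bump
function extends its germ to the whole manifold. -/
lemma contMDiffAt_of_comp_contDiff {M : Type*} [TopologicalSpace M] [ChartedSpace F M]
    [FiniteDimensional ℝ F] [T2Space M] [IsManifold 𝓘(ℝ, F) ∞ M]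
    {H : Type*} [NormedAddCommGroup H] [NormedSpace ℝ H] {γ : H → M} {t : H}
    (hc : ContinuousAt γ t)
    (h : ∀ u : M → F, ContMDiff 𝓘(ℝ, F) 𝓘(ℝ, F) ∞ u → ContDiffAt ℝ ∞ (fun s => u (γ s)) t) :
    ContMDiffAt 𝓘(ℝ, H) 𝓘(ℝ, F) ∞ γ t := by
  obtain ⟨u, hu, hux⟩ := exists_contMDiff_eventuallyEq_extChartAt (F := F) (γ t)
  rw [contMDiffAt_iff_target]
  refine ⟨hc, ((h u hu).congr_of_eventuallyEq ?_).contMDiffAt⟩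
  exact (hc.eventually hux).mono fun s hs => hs.symm

lemma eq_of_forall_contMDiff {M : Type*} [TopologicalSpace M] [ChartedSpace F M]
    [FiniteDimensional ℝ F] [T2Space M] [IsManifold 𝓘(ℝ, F) ∞ M] {x y : M}
    (h : ∀ u : M → ℝ, ContMDiff 𝓘(ℝ, F) 𝓘(ℝ, ℝ) ∞ u → u x = u y) : x = y := by
  by_contra hxy
  obtain ⟨f, -, hf⟩ := (SmoothBumpFunction.nhds_basis_support (I := 𝓘(ℝ, F)) (c := x)
    (isOpen_compl_singleton.mem_nhds (show x ∈ ({y}ᶜ : Set M) from hxy))).mem_iff.1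
    (isOpen_compl_singleton.mem_nhds (show x ∈ ({y}ᶜ : Set M) from hxy))
  have h1 := h f f.contMDiff
  rw [f.eq_one] at h1
  exact hf (show y ∈ Function.support f by rw [Function.mem_support, ← h1]; simp) rfl

section ExpCurve

variable [FiniteDimensional ℝ F] [T2Space G]

lemma contMDiff_expCurve [CompleteSpace F] (X : GroupLieAlgebra 𝓘(ℝ, F) G) :
    ContMDiff 𝓘(ℝ, ℝ) 𝓘(ℝ, F) ∞ (expCurve X) := fun _ =>
  contMDiffAt_of_comp_contDiff (continuous_expCurve X).continuousAt
    fun _ hu => (contDiff_comp_expCurve X hu).contDiffAt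

end ExpCurve

end LieGroupCalculus
end Carnot
end

/-! ### The adjoint action and the commutator formula in step two. -/

noncomputable section

namespace Carnot

section TwoVariables

variable {E : Type*} [NormedAddCommGroup E] [NormedSpace ℝ E]

lemma hasDerivAt_comp_prodMk_of_partial {g : ℝ × ℝ → E} {p q : ℝ → ℝ} {p' q' t : ℝ} {d₁ d₂ : E}
    (hg : DifferentiableAt ℝ g (p t, q t)) (hp : HasDerivAt p p' t) (hq : HasDerivAt q q' t)
    (h₁ : HasDerivAt (fun s => g (s, q t)) d₁ (p t))
    (h₂ : HasDerivAt (fun s => g (p t, s)) d₂ (q t)) :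
    HasDerivAt (fun s => g (p s, q s)) (p' • d₁ + q' • d₂) t := by
  have e₁ : fderiv ℝ g (p t, q t) (1, 0) = d₁ :=
    HasDerivAt.unique (hg.hasFDerivAt.comp_hasDerivAt (p t)
      ((hasDerivAt_id (p t)).prodMk (hasDerivAt_const (p t) (q t)))) h₁
  have e₂ : fderiv ℝ g (p t, q t) (0, 1) = d₂ :=
    HasDerivAt.unique (hg.hasFDerivAt.comp_hasDerivAt (q t)
      ((hasDerivAt_const (q t) (p t)).prodMk (hasDerivAt_id (q t)))) h₂
  have h : HasDerivAt (fun s => g (p s, q s)) _ t :=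
    hg.hasFDerivAt.comp_hasDerivAt t (hp.prodMk hq)
  convert h using 1
  rw [← e₁, ← e₂, ← map_smul, ← map_smul, ← map_add]
  simp

/-- Symmetry of mixed partial derivatives, for functions of two real variables. -/
lemma hasDerivAt_partial_comm {ψ : ℝ × ℝ → E} (hψ : ContDiff ℝ 2 ψ) {f g : ℝ → E} {d : E}
    (hf : ∀ a, HasDerivAt (fun q => ψ (a, q)) (f a) 0)
    (hg : ∀ q, HasDerivAt (fun a => ψ (a, q)) (g q) 0) (hd : HasDerivAt f d 0) :
    HasDerivAt g d 0 := by
  have hψd : Differentiable ℝ ψ := hψ.differentiable (by simp)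
  have hψ2 : Differentiable ℝ (fderiv ℝ ψ) :=
    (hψ.fderiv_right (m := 1) (by norm_num)).differentiable (by simp)
  have ef : f = fun a => fderiv ℝ ψ (a, 0) (0, 1) := funext fun a =>
    (hf a).unique ((hψd (a, 0)).hasFDerivAt.comp_hasDerivAt (0 : ℝ)
      ((hasDerivAt_const (0 : ℝ) a).prodMk (hasDerivAt_id (0 : ℝ))))
  have eg : g = fun q => fderiv ℝ ψ (0, q) (1, 0) := funext fun q =>
    (hg q).unique ((hψd (0, q)).hasFDerivAt.comp_hasDerivAt (0 : ℝ)
      ((hasDerivAt_id (0 : ℝ)).prodMk (hasDerivAt_const (0 : ℝ) q)))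
  have hsymm : IsSymmSndFDerivAt ℝ ψ (0, 0) := hψ.contDiffAt.isSymmSndFDerivAt (by simp)
  have h1 : HasDerivAt f (fderiv ℝ (fderiv ℝ ψ) (0, 0) (1, 0) (0, 1)) 0 := by
    rw [ef]
    have := (hψ2 (0, 0)).hasFDerivAt.comp_hasDerivAt (f := fun a : ℝ => (a, (0 : ℝ))) (0 : ℝ)
      ((hasDerivAt_id (0 : ℝ)).prodMk (hasDerivAt_const (0 : ℝ) (0 : ℝ)))
    simpa using this.clm_apply (hasDerivAt_const (0 : ℝ) ((0 : ℝ), (1 : ℝ)))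
  have h2 : HasDerivAt g (fderiv ℝ (fderiv ℝ ψ) (0, 0) (0, 1) (1, 0)) 0 := by
    rw [eg]
    have := (hψ2 (0, 0)).hasFDerivAt.comp_hasDerivAt (0 : ℝ)
      ((hasDerivAt_const (0 : ℝ) (0 : ℝ)).prodMk (hasDerivAt_id (0 : ℝ)))
    simpa using this.clm_apply (hasDerivAt_const (0 : ℝ) ((1 : ℝ), (0 : ℝ)))
  rwa [hd.unique h1, hsymm.eq]

end TwoVariables

section OneParameter

variable {F : Type*} [NormedAddCommGroup F] [NormedSpace ℝ F] [FiniteDimensional ℝ F]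
  [CompleteSpace F]
  {G : Type*} [TopologicalSpace G] [ChartedSpace F G] [Group G] [LieGroup 𝓘(ℝ, F) ∞ G] [T2Space G]
  {E : Type*} [NormedAddCommGroup E] [NormedSpace ℝ E]

omit [FiniteDimensional ℝ F] [LieGroup 𝓘(ℝ, F) ∞ G] [T2Space G] [CompleteSpace F] in
lemma lie_swap (X Y : GroupLieAlgebra 𝓘(ℝ, F) G) : ⁅X, Y⁆ = -⁅Y, X⁆ := by
  rw [GroupLieAlgebra.bracket_def, VectorField.mlieBracket_swap_apply, GroupLieAlgebra.bracket_def]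

omit [FiniteDimensional ℝ F] in
lemma expCurve_add (X : GroupLieAlgebra 𝓘(ℝ, F) G) (s t : ℝ) :
    expCurve X (s + t) = expCurve X s * expCurve X t := by
  have : IsManifold 𝓘(ℝ, F) 1 G := .of_le (n := ∞) (by simp)
  have h1 : IsMIntegralCurve (fun t => expCurve X (t + s)) (mulInvariantVectorField X) :=
    (isMIntegralCurve_expCurve X).comp_add s
  have h2 : IsMIntegralCurve (fun t => expCurve X s * expCurve X t)
      (mulInvariantVectorField X) := isMIntegralCurve_mul_left (isMIntegralCurve_expCurve X) _
  have := isMIntegralCurve_Ioo_eq_of_contMDiff_boundaryless (t₀ := 0)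
    ((contMDiff_infty_mulInvariantVectorField X).of_le (by simp)) h1 h2 (by simp)
  rw [add_comm]
  exact congrFun this t

omit [FiniteDimensional ℝ F] in
lemma expCurve_neg (X : GroupLieAlgebra 𝓘(ℝ, F) G) (t : ℝ) :
    expCurve X (-t) = (expCurve X t)⁻¹ := by
  rw [eq_inv_iff_mul_eq_one, ← expCurve_add, neg_add_cancel, expCurve_zero]

omit [FiniteDimensional ℝ F] in
/-- The flow of a left invariant vector field commutes with the field. -/
lemma dirDeriv_comp_mul_expCurve (X : GroupLieAlgebra 𝓘(ℝ, F) G) {f : G → E}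
    (hf : ContMDiff 𝓘(ℝ, F) 𝓘(ℝ, E) ∞ f) (t : ℝ) (x : G) :
    dirDeriv X (fun y => f (y * expCurve X t)) x = dirDeriv X f (x * expCurve X t) := by
  have h1 := hasDerivAt_comp_mul_expCurve X
    (hf.comp (contMDiff_mul_right (I := 𝓘(ℝ, F)) (a := expCurve X t))) x 0
  have h2 := (hasDerivAt_comp_mul_expCurve X hf x (0 + t)).comp_add_const 0 t
  simp only [Function.comp_def, mul_assoc, ← expCurve_add] at h1
  have := h1.unique h2
  simpa using this

omit [FiniteDimensional ℝ F] [CompleteSpace F] [T2Space G] in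
/-- Two smooth curves multiplied: the result is a smooth function of both parameters. -/
lemma contDiff_comp_mul_mul {f : G → E} (hf : ContMDiff 𝓘(ℝ, F) 𝓘(ℝ, E) ∞ f)
    {H H' : Type*} [NormedAddCommGroup H] [NormedSpace ℝ H]
    [NormedAddCommGroup H'] [NormedSpace ℝ H'] {c : H → G} {c' : H' → G}
    (hc : ContMDiff 𝓘(ℝ, H) 𝓘(ℝ, F) ∞ c) (hc' : ContMDiff 𝓘(ℝ, H') 𝓘(ℝ, F) ∞ c') :
    ContDiff ℝ ∞ (fun p : H × H' => f (c p.1 * c' p.2)) := by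
  rw [← contMDiff_iff_contDiff]
  exact hf.comp ((hc.comp contDiff_fst.contMDiff).mul (hc'.comp contDiff_snd.contMDiff))

/-- A smooth curve through `1` with velocity `W`, tested on smooth functions, is `t ↦ exp (t W)`. -/
lemma eq_expCurve (W : GroupLieAlgebra 𝓘(ℝ, F) G) {c : ℝ → G}
    (hc : ContMDiff 𝓘(ℝ, ℝ) 𝓘(ℝ, F) ∞ c) (hc0 : c 0 = 1)
    (h : ∀ f : G → ℝ, ContMDiff 𝓘(ℝ, F) 𝓘(ℝ, ℝ) ∞ f → ∀ s,
      HasDerivAt (fun s => f (c s)) (dirDeriv W f (c s)) s) : c = expCurve W := by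
  -- The two factors contribute `W` and `-W` at the same point, since the flow of `W` commutes with
  -- `W`; so no smooth function varies along this product, and smooth functions separate points.
  have key : ∀ s, c s * expCurve W (-s) = 1 := by
    intro s
    refine eq_of_forall_contMDiff (F := F) fun f hf => ?_
    have hd : ∀ t, HasDerivAt (fun t => f (c t * expCurve W (-t))) 0 t := by
      intro t
      have hg := contDiff_comp_mul_mul hf hc (contMDiff_expCurve W)
      have h1 := h (fun y => f (y * expCurve W (-t)))
        (hf.comp (contMDiff_mul_right (I := 𝓘(ℝ, F)) (a := expCurve W (-t)))) t
      rw [dirDeriv_comp_mul_expCurve W hf] at h1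
      have := hasDerivAt_comp_prodMk_of_partial (t := t) (p := fun t => t) (q := fun t => -t)
        ((hg.differentiable (by simp)) _) (hasDerivAt_id t) (hasDerivAt_neg t) h1
        (hasDerivAt_comp_mul_expCurve W hf (c t) (-t))
      simpa using this
    have := is_const_of_deriv_eq_zero (fun t => (hd t).differentiableAt)
      (fun t => (hd t).deriv) s 0
    simpa [hc0] using this
  funext s
  rw [← mul_inv_eq_one, ← expCurve_neg, key]

lemma expCurve_smul (c : ℝ) (X : GroupLieAlgebra 𝓘(ℝ, F) G) (t : ℝ) :
    expCurve (c • X) t = expCurve X (c * t) := by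
  refine (congrFun (eq_expCurve (c • X) (c := fun t => expCurve X (c * t)) ?_ (by simp) ?_) t).symm
  · exact (contMDiff_expCurve X).comp (contDiff_const.mul contDiff_id).contMDiff
  · intro f hf s
    have := (hasDerivAt_comp_expCurve X hf (c * s)).scomp s ((hasDerivAt_id s).const_mul c)
    rw [dirDeriv_smul]
    simpa [Function.comp_def] using this

/-- The derivative along `Y` is a partial derivative of a smooth function of three real variables,
the third being the time along `exp (· Y)`; joint smoothness in the other two follows. -/
lemma contDiff_dirDeriv_comp_mul {f : G → E} (hf : ContMDiff 𝓘(ℝ, F) 𝓘(ℝ, E) ∞ f)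
    (Y : GroupLieAlgebra 𝓘(ℝ, F) G) {c c' : ℝ → G}
    (hc : ContMDiff 𝓘(ℝ, ℝ) 𝓘(ℝ, F) ∞ c) (hc' : ContMDiff 𝓘(ℝ, ℝ) 𝓘(ℝ, F) ∞ c') :
    ContDiff ℝ ∞ (fun p : ℝ × ℝ => dirDeriv Y (fun y => f (y * c' p.2)) (c p.1)) := by
  have h0 : ContMDiff 𝓘(ℝ, ℝ × ℝ) 𝓘(ℝ, F) ∞ (fun p : ℝ × ℝ => c p.1 * expCurve Y p.2) :=
    (hc.comp contDiff_fst.contMDiff).mul ((contMDiff_expCurve Y).comp contDiff_snd.contMDiff)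
  have hΦ := contDiff_comp_mul_mul hf h0 hc'
  have h1 : (fun p : ℝ × ℝ => dirDeriv Y (fun y => f (y * c' p.2)) (c p.1)) =
      fun p => fderiv ℝ (fun p : (ℝ × ℝ) × ℝ => f (c p.1.1 * expCurve Y p.1.2 * c' p.2))
        ((p.1, 0), p.2) ((0, 1), 0) := by
    funext p
    have e1 := hasDerivAt_comp_mul_expCurve Y
      (hf.comp (contMDiff_mul_right (I := 𝓘(ℝ, F)) (a := c' p.2))) (c p.1) 0
    have e2 := ((hΦ.differentiable (by simp)) ((p.1, 0), p.2)).hasFDerivAt.comp_hasDerivAt (0 : ℝ)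
      (((hasDerivAt_const (0 : ℝ) p.1).prodMk (hasDerivAt_id (0 : ℝ))).prodMk
        (hasDerivAt_const (0 : ℝ) p.2))
    have := e1.unique e2
    simpa [Function.comp_def] using this
  rw [h1]
  have h2 := hΦ.fderiv_right (m := ∞) (by simp)
  exact (h2.comp (by fun_prop)).clm_apply contDiff_const

/-- The time `t` occurs twice: in the base point, where differentiation gives `X Y f`, and with
opposite sign in the translation inside `f`, where it gives `Y X f` after exchanging two partial
derivatives. The difference is the bracket. -/
lemma hasDerivAt_dirDeriv_conj_zero (X Y : GroupLieAlgebra 𝓘(ℝ, F) G) {f : G → E}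
    (hf : ContMDiff 𝓘(ℝ, F) 𝓘(ℝ, E) ∞ f) (x : G) :
    HasDerivAt (fun t => dirDeriv Y (fun y => f (y * expCurve X (-t))) (x * expCurve X t))
      (dirDeriv ⁅X, Y⁆ f x) 0 := by
  have hc : ContMDiff 𝓘(ℝ, ℝ) 𝓘(ℝ, F) ∞ (fun t => x * expCurve X t) :=
    contMDiff_mul_left.comp (contMDiff_expCurve X)
  have hg := contDiff_dirDeriv_comp_mul hf Y hc (contMDiff_expCurve X)
  have h1 : HasDerivAt (fun p => dirDeriv Y (fun y => f (y * expCurve X (-0)))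
      (x * expCurve X p)) (dirDeriv X (dirDeriv Y f) x) 0 := by
    simpa using hasDerivAt_comp_mul_expCurve X (contMDiff_dirDeriv Y hf) x 0
  have h2 : HasDerivAt (fun q => dirDeriv Y (fun y => f (y * expCurve X q))
      (x * expCurve X 0)) (dirDeriv Y (dirDeriv X f) x) 0 := by
    have hcY : ContMDiff 𝓘(ℝ, ℝ) 𝓘(ℝ, F) ∞ (fun t => x * expCurve Y t) :=
      contMDiff_mul_left.comp (contMDiff_expCurve Y)
    refine hasDerivAt_partial_comm
      (ψ := fun p : ℝ × ℝ => f (x * expCurve Y p.1 * expCurve X p.2))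
      (f := fun a => dirDeriv X f (x * expCurve Y a))
      ((contDiff_comp_mul_mul hf hcY (contMDiff_expCurve X)).of_le
        (WithTop.coe_le_coe.2 (le_top : (2 : ℕ∞) ≤ ⊤))) ?_ ?_ ?_
    · intro a
      simpa using hasDerivAt_comp_mul_expCurve X hf (x * expCurve Y a) 0
    · intro q
      simpa [Function.comp_def] using hasDerivAt_comp_mul_expCurve Y
        (hf.comp (contMDiff_mul_right (I := 𝓘(ℝ, F)) (a := expCurve X q))) x 0
    · simpa using hasDerivAt_comp_mul_expCurve Y (contMDiff_dirDeriv X hf) x 0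
  have := hasDerivAt_comp_prodMk_of_partial (t := 0) (p := fun t => t) (q := fun t => -t)
    ((hg.differentiable (by simp)) _) (hasDerivAt_id (0 : ℝ)) (hasDerivAt_neg (0 : ℝ)) h1
    (by simpa only [neg_zero] using h2)
  rw [dirDeriv_lie X Y hf]
  simpa [sub_eq_add_neg] using this

/-- The group law of the flow reduces time `t` to time zero, for a translated function and base
point. -/
lemma hasDerivAt_dirDeriv_conj (X Y : GroupLieAlgebra 𝓘(ℝ, F) G) {f : G → E}
    (hf : ContMDiff 𝓘(ℝ, F) 𝓘(ℝ, E) ∞ f) (x : G) (t : ℝ) :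
    HasDerivAt (fun t => dirDeriv Y (fun y => f (y * expCurve X (-t))) (x * expCurve X t))
      (dirDeriv ⁅X, Y⁆ (fun y => f (y * expCurve X (-t))) (x * expCurve X t)) t := by
  have h := hasDerivAt_dirDeriv_conj_zero X Y
    (hf.comp (contMDiff_mul_right (I := 𝓘(ℝ, F)) (a := expCurve X (-t)))) (x * expCurve X t)
  rw [← sub_self t] at h
  have h' := h.comp_sub_const t t
  refine h'.congr_of_eventuallyEq (Eventually.of_forall fun s => ?_)
  simp only [Function.comp_def, mul_assoc, ← expCurve_add]
  ring_nf

lemma dirDeriv_conj_of_lie_eq_zero {X Y : GroupLieAlgebra 𝓘(ℝ, F) G} (h : ⁅X, Y⁆ = 0) {f : G → E}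
    (hf : ContMDiff 𝓘(ℝ, F) 𝓘(ℝ, E) ∞ f) (x : G) (t : ℝ) :
    dirDeriv Y (fun y => f (y * expCurve X (-t))) (x * expCurve X t) = dirDeriv Y f x := by
  have h0 : ∀ g : G → E, dirDeriv (0 : GroupLieAlgebra 𝓘(ℝ, F) G) g = 0 := fun g => by
    simpa using dirDeriv_smul (0 : ℝ) (0 : GroupLieAlgebra 𝓘(ℝ, F) G) g
  have hd := hasDerivAt_dirDeriv_conj X Y hf x
  simp only [h, h0, Pi.zero_apply] at hd
  have := is_const_of_deriv_eq_zero (fun t => (hd t).differentiableAt) (fun t => (hd t).deriv) t 0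
  simpa using this

/-- `Ad (exp (t X)) Y = Y + t [X, Y]` if `[X, [X, Y]] = 0`. -/
lemma dirDeriv_conj_of_lie_lie_eq_zero {X Y : GroupLieAlgebra 𝓘(ℝ, F) G} (h : ⁅X, ⁅X, Y⁆⁆ = 0)
    {f : G → E} (hf : ContMDiff 𝓘(ℝ, F) 𝓘(ℝ, E) ∞ f) (x : G) (t : ℝ) :
    dirDeriv Y (fun y => f (y * expCurve X (-t))) (x * expCurve X t) =
      dirDeriv (Y + t • ⁅X, Y⁆) f x := by
  have hd := hasDerivAt_dirDeriv_conj X Y hf x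
  simp only [dirDeriv_conj_of_lie_eq_zero h hf] at hd
  have hd' : ∀ t, HasDerivAt (fun t => dirDeriv Y (fun y => f (y * expCurve X (-t)))
      (x * expCurve X t) - t • dirDeriv ⁅X, Y⁆ f x) 0 t := fun t => by
    have := (hd t).fun_sub ((hasDerivAt_id' t).smul_const (dirDeriv ⁅X, Y⁆ f x))
    simpa only [one_smul, sub_self] using this
  have := is_const_of_deriv_eq_zero (fun t => (hd' t).differentiableAt)
    (fun t => (hd' t).deriv) t 0
  rw [dirDeriv_add, dirDeriv_smul]
  simpa [sub_eq_iff_eq_add] using this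

/-- The group commutator of two one-parameter subgroups, in step two. -/
lemma expCurve_conj {X Y : GroupLieAlgebra 𝓘(ℝ, F) G} (hX : ⁅X, ⁅X, Y⁆⁆ = 0)
    (hY : ⁅Y, ⁅X, Y⁆⁆ = 0) (t s : ℝ) :
    expCurve X t * expCurve Y s * expCurve X (-t) = expCurve Y s * expCurve ⁅X, Y⁆ (t * s) := by
  -- For fixed `t`, both sides of the formula, as curves in `s`, have velocity `Y + t [X, Y]`, so
  -- both are its one-parameter subgroup. Conjugation gives this by the adjoint formula; the product
  -- on the right, because `[X, Y]` commutes with `Y`.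
  have h1 : (fun s => expCurve X t * expCurve Y s * expCurve X (-t)) =
      expCurve (Y + t • ⁅X, Y⁆) := by
    refine eq_expCurve _ ?_ ?_ ?_
    · exact contMDiff_mul_right.comp (contMDiff_mul_left.comp (contMDiff_expCurve Y))
    · simp [← expCurve_add]
    · intro f hf s
      have e1 := hasDerivAt_comp_mul_expCurve Y
        (hf.comp (contMDiff_mul_right (I := 𝓘(ℝ, F)) (a := expCurve X (-t)))) (expCurve X t) s
      rw [← dirDeriv_conj_of_lie_lie_eq_zero hX hf _ t]
      convert e1 using 2
      all_goals first
        | rfl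
        | rw [mul_assoc, ← expCurve_add, neg_add_cancel, expCurve_zero, mul_one]
  have h2 : (fun s => expCurve Y s * expCurve ⁅X, Y⁆ (t * s)) = expCurve (Y + t • ⁅X, Y⁆) := by
    have hZ : ContMDiff 𝓘(ℝ, ℝ) 𝓘(ℝ, F) ∞ (fun s => expCurve ⁅X, Y⁆ (t * s)) :=
      (contMDiff_expCurve _).comp (contDiff_const.mul contDiff_id).contMDiff
    refine eq_expCurve _ ?_ ?_ ?_
    · exact (contMDiff_expCurve Y).mul hZ
    · simp
    · intro f hf s
      have hg := contDiff_comp_mul_mul hf (contMDiff_expCurve Y) (contMDiff_expCurve ⁅X, Y⁆)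
      have e1 := hasDerivAt_comp_expCurve Y
        (hf.comp (contMDiff_mul_right (I := 𝓘(ℝ, F)) (a := expCurve ⁅X, Y⁆ (t * s)))) s
      have e2 := hasDerivAt_comp_mul_expCurve ⁅X, Y⁆ hf (expCurve Y s) (t * s)
      have hZY : ⁅⁅X, Y⁆, Y⁆ = 0 := by rw [lie_swap, hY, neg_zero]
      have e3 := dirDeriv_conj_of_lie_eq_zero hZY hf (expCurve Y s * expCurve ⁅X, Y⁆ (t * s))
        (-(t * s))
      rw [mul_assoc, ← expCurve_add, add_neg_cancel, expCurve_zero, mul_one, neg_neg] at e3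
      have := hasDerivAt_comp_prodMk_of_partial (t := s) (p := fun t => t) (q := fun s => t * s)
        ((hg.differentiable (by simp)) _) (hasDerivAt_id s)
        (by simpa using (hasDerivAt_id s).const_mul t) e1 e2
      rw [dirDeriv_add, dirDeriv_smul]
      simp only [Function.comp_def] at this
      rw [e3] at this
      simpa using this
  exact (congrFun h1 s).trans (congrFun h2 s).symm

end OneParameter
end Carnot
end

/-! ### Horizontal curves and the balls of the Carnot-Carathéodory distance. -/

noncomputable section

namespace Carnot

section Curves

variable {F : Type*} [NormedAddCommGroup F] [NormedSpace ℝ F]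
  {G : Type*} [TopologicalSpace G] [ChartedSpace F G] [Group G] {m : ℕ}

/-- Horizontal curves parametrized by `[u, v]`. -/
structure IsHorizontalOn (X : Fin m → GroupLieAlgebra 𝓘(ℝ, F) G) (γ : ℝ → G)
    (a : ℝ → EuclideanSpace ℝ (Fin m)) (u v : ℝ) : Prop where
  measurable : Measurable a
  lipschitz : ∀ f : G → ℝ, ContMDiff 𝓘(ℝ, F) 𝓘(ℝ, ℝ) ∞ f →
    ∃ K, LipschitzOnWith K (f ∘ γ) (Icc u v)
  deriv : ∀ᵐ t, t ∈ Ioo u v →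
    HasMFDerivAt 𝓘(ℝ, ℝ) 𝓘(ℝ, F) γ t
      ((1 : ℝ →L[ℝ] ℝ).smulRight (mulInvariantVectorField (∑ i, a t i • X i) (γ t)))

lemma mulInvariantVectorField_sum {ι : Type*} (s : Finset ι) (c : ι → ℝ)
    (X : ι → GroupLieAlgebra 𝓘(ℝ, F) G) (x : G) :
    mulInvariantVectorField (∑ i ∈ s, c i • X i) x =
      ∑ i ∈ s, c i • mulInvariantVectorField (X i) x := by
  simp [mulInvariantVectorField]
  rfl

lemma isHorizontalOn_iff (X : Fin m → GroupLieAlgebra 𝓘(ℝ, F) G) (γ : ℝ → G)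
    (a : ℝ → EuclideanSpace ℝ (Fin m)) :
    IsHorizontalOn X γ a 0 1 ↔ IsHorizontalCurve X γ a := by
  constructor
  · rintro ⟨h1, h2, h3⟩
    refine ⟨h1, h2, ?_⟩
    rw [ae_restrict_iff' measurableSet_Ioo]
    simpa only [mulInvariantVectorField_sum] using h3
  · rintro ⟨h1, h2, h3⟩
    rw [ae_restrict_iff' measurableSet_Ioo] at h3
    refine ⟨h1, h2, ?_⟩
    simpa only [mulInvariantVectorField_sum] using h3

lemma ae_comp_affine {p : ℝ → Prop} (h : ∀ᵐ t, p t) {c : ℝ} (hc : c ≠ 0) (d : ℝ) :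
    ∀ᵐ t, p (c * t + d) := by
  have h1 : ∀ᵐ t, p (t + d) := (quasiMeasurePreserving_add_right volume d).ae h
  rw [ae_iff] at h1 ⊢
  change volume ((c * ·) ⁻¹' {t | ¬p (t + d)}) = 0
  rw [Real.volume_preimage_mul_left hc, h1, mul_zero]

lemma smulRight_one_apply {E : Type*} [NormedAddCommGroup E] [NormedSpace ℝ E] (w : E) (c : ℝ) :
    (1 : ℝ →L[ℝ] ℝ).smulRight w c = c • w := by
  simp

lemma IsHorizontalOn.comp_affine {X : Fin m → GroupLieAlgebra 𝓘(ℝ, F) G} {γ : ℝ → G}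
    {a : ℝ → EuclideanSpace ℝ (Fin m)} {u v : ℝ} (h : IsHorizontalOn X γ a u v) {c d u' v' : ℝ}
    (hc : c ≠ 0) (h1 : MapsTo (fun t => c * t + d) (Icc u' v') (Icc u v))
    (h2 : MapsTo (fun t => c * t + d) (Ioo u' v') (Ioo u v)) :
    IsHorizontalOn X (fun t => γ (c * t + d)) (fun t => c • a (c * t + d)) u' v' where
  measurable := (h.measurable.comp (by fun_prop)).const_smul c
  lipschitz f hf := by
    obtain ⟨K, hK⟩ := h.lipschitz f hf
    refine ⟨K * ‖c‖₊, hK.comp (LipschitzWith.lipschitzOnWith ?_) h1⟩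
    refine LipschitzWith.of_dist_le_mul fun x y => ?_
    rw [Real.dist_eq, Real.dist_eq, coe_nnnorm, Real.norm_eq_abs, ← abs_mul]
    apply le_of_eq; congr 1; ring
  deriv := by
    filter_upwards [ae_comp_affine h.deriv hc d] with t ht htm
    have hγ := ht (h2 htm)
    have hl : HasMFDerivAt 𝓘(ℝ, ℝ) 𝓘(ℝ, ℝ) (fun t => c * t + d) t
        ((1 : ℝ →L[ℝ] ℝ).smulRight c) := by
      have : HasDerivAt (fun t => c * t + d) c t := by
        simpa using ((hasDerivAt_id t).const_mul c).add_const d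
      exact (hasDerivAt_iff_hasFDerivAt.1 this).hasMFDerivAt
    refine (hγ.comp t hl).congr_mfderiv ?_
    have e : ∑ i, (c • a (c * t + d)) i • X i = c • ∑ i, a (c * t + d) i • X i := by
      simp [Finset.smul_sum, smul_smul]
    rw [e, mulInvariantVectorField_smul]
    refine (comp_smulRight_one (H := ℝ) (E := F) _ c).trans ?_
    refine congrArg (fun w : F => (1 : ℝ →L[ℝ] ℝ).smulRight w) ?_
    exact smulRight_one_apply (E := F) _ c

lemma LipschitzOnWith.glue {f : ℝ → ℝ} {u v w : ℝ} {K K' : NNReal}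
    (h : LipschitzOnWith K f (Icc u w)) (h' : LipschitzOnWith K' f (Icc w v)) :
    LipschitzOnWith (max K K') f (Icc u v) := by
  rw [lipschitzOnWith_iff_dist_le_mul] at *
  have key : ∀ x ∈ Icc u v, ∀ y ∈ Icc u v, x ≤ y →
      dist (f x) (f y) ≤ (max K K' : NNReal) * dist x y := by
    intro x hx y hy hxy
    have m1 : (K : ℝ) ≤ (max K K' : NNReal) := by simp
    have m2 : (K' : ℝ) ≤ (max K K' : NNReal) := by simp
    rcases le_total y w with hyw | hyw
    · exact (h x ⟨hx.1, hxy.trans hyw⟩ y ⟨hy.1, hyw⟩).trans (by gcongr)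
    rcases le_total x w with hxw | hxw
    · have e1 := h x ⟨hx.1, hxw⟩ w ⟨hx.1.trans hxw, le_rfl⟩
      have e2 := h' w ⟨le_rfl, hyw.trans hy.2⟩ y ⟨hyw, hy.2⟩
      have e3 := dist_triangle (f x) (f w) (f y)
      have e4 : dist x y = dist x w + dist w y := by
        simp only [Real.dist_eq]
        rw [abs_of_nonpos, abs_of_nonpos, abs_of_nonpos] <;> linarith
      rw [e4, mul_add]
      have e5 : (K : ℝ) * dist x w ≤ (max K K' : NNReal) * dist x w := by gcongr
      have e6 : (K' : ℝ) * dist w y ≤ (max K K' : NNReal) * dist w y := by gcongr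
      linarith
    · exact (h' x ⟨hxw, hx.2⟩ y ⟨hyw, hy.2⟩).trans (by gcongr)
  intro x hx y hy
  rcases le_total x y with hxy | hxy
  · exact key x hx y hy hxy
  · rw [dist_comm, dist_comm x]; exact key y hy x hx hxy

lemma lipschitzOnWith_congr {f g : ℝ → ℝ} {K : NNReal} {s : Set ℝ} (h : LipschitzOnWith K f s)
    (e : EqOn g f s) : LipschitzOnWith K g s := fun x hx y hy => by
  rw [e hx, e hy]; exact h hx hy

lemma IsHorizontalOn.glue {X : Fin m → GroupLieAlgebra 𝓘(ℝ, F) G} {γ γ' : ℝ → G}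
    {a a' : ℝ → EuclideanSpace ℝ (Fin m)} {u v w : ℝ} (h : IsHorizontalOn X γ a u w)
    (h' : IsHorizontalOn X γ' a' w v) (hw : γ w = γ' w) :
    IsHorizontalOn X (fun t => if t ≤ w then γ t else γ' t)
      (fun t => if t ≤ w then a t else a' t) u v where
  measurable := Measurable.ite measurableSet_Iic h.measurable h'.measurable
  lipschitz f hf := by
    obtain ⟨K, hK⟩ := h.lipschitz f hf
    obtain ⟨K', hK'⟩ := h'.lipschitz f hf
    refine ⟨max K K', LipschitzOnWith.glue (w := w) (lipschitzOnWith_congr hK fun t ht => ?_)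
      (lipschitzOnWith_congr hK' fun t ht => ?_)⟩
    · simp [ht.2]
    · rcases ht.1.eq_or_lt with rfl | hlt
      · simp [hw]
      · simp [hlt.not_ge]
  deriv := by
    have key : ∀ (W : GroupLieAlgebra 𝓘(ℝ, F) G) (x y : G), x = y →
        (mulInvariantVectorField W x : F) = mulInvariantVectorField W y := by
      rintro W x _ rfl; rfl
    have hne : ∀ᵐ t : ℝ, t ≠ w := by simp [ae_iff]
    filter_upwards [h.deriv, h'.deriv, hne] with t ht ht' htw htm
    rcases lt_or_gt_of_ne htw with hlt | hlt
    · have := ht ⟨htm.1, hlt⟩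
      have e : (fun t => if t ≤ w then γ t else γ' t) =ᶠ[𝓝 t] γ := by
        filter_upwards [Iio_mem_nhds hlt] with s hs
        exact if_pos (mem_Iio.1 hs).le
      simp only [if_pos hlt.le]
      exact (this.congr_of_eventuallyEq e).congr_mfderiv
        (congrArg (fun w : F => (1 : ℝ →L[ℝ] ℝ).smulRight w) (key _ _ _ (if_pos hlt.le).symm))
    · have := ht' ⟨hlt, htm.2⟩
      have e : (fun t => if t ≤ w then γ t else γ' t) =ᶠ[𝓝 t] γ' := by
        filter_upwards [Ioi_mem_nhds hlt] with s hs
        exact if_neg (mem_Ioi.1 hs).not_ge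
      simp only [if_neg (not_le.2 hlt)]
      exact (this.congr_of_eventuallyEq e).congr_mfderiv
        (congrArg (fun w : F => (1 : ℝ →L[ℝ] ℝ).smulRight w) (key _ _ _ (if_neg hlt.not_ge).symm))

lemma mem_ccBall_iff {X : Fin m → GroupLieAlgebra 𝓘(ℝ, F) G} {x y : G} {r : ℝ} :
    y ∈ ccBall X x r ↔ ∃ γ a, IsHorizontalOn X γ a 0 1 ∧ γ 0 = x ∧ γ 1 = y ∧
      ∫⁻ t in Icc (0 : ℝ) 1, ‖a t‖ₑ ^ 2 < ENNReal.ofReal r ^ 2 := by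
  simp only [ccBall, mem_ofPred_eq, ccDist, one_div]
  rw [ENNReal.rpow_inv_lt_iff (by norm_num)]
  simp only [iInf_lt_iff, isHorizontalOn_iff, exists_prop, ENNReal.rpow_ofNat]

lemma pos_of_mem_ccBall {X : Fin m → GroupLieAlgebra 𝓘(ℝ, F) G} {x y : G} {r : ℝ}
    (h : y ∈ ccBall X x r) : 0 < r :=
  ENNReal.ofReal_pos.1 (bot_lt_of_lt h)

lemma ccBall_mono (X : Fin m → GroupLieAlgebra 𝓘(ℝ, F) G) (x : G) {r s : ℝ} (h : r ≤ s) :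
    ccBall X x r ⊆ ccBall X x s := fun _ hy =>
  lt_of_lt_of_le hy (ENNReal.ofReal_le_ofReal h)

lemma setLIntegral_comp_affine (g : ℝ → ℝ≥0∞) {c : ℝ} (hc : 0 < c) (d u v : ℝ) :
    ∫⁻ t in Icc u v, ENNReal.ofReal c * g (c * t + d) =
      ∫⁻ t in Icc (c * u + d) (c * v + d), g t := by
  have h := lintegral_image_eq_lintegral_abs_deriv_mul (s := Icc u v) (f := fun t => c * t + d)
    (f' := fun _ => c) measurableSet_Icc
    (fun t _ => by simpa using (((hasDerivAt_id t).const_mul c).add_const d).hasDerivWithinAt)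
    (fun x _ y _ hxy => by simpa [hc.ne'] using hxy) g
  rw [image_affine_Icc' hc] at h
  rw [h, abs_of_pos hc]

lemma ccBall_symm {X : Fin m → GroupLieAlgebra 𝓘(ℝ, F) G} {x y : G} {r : ℝ}
    (h : y ∈ ccBall X x r) : x ∈ ccBall X y r := by
  rw [mem_ccBall_iff] at *
  obtain ⟨γ, a, hγ, h0, h1, he⟩ := h
  refine ⟨_, _, hγ.comp_affine (c := -1) (d := 1) (u' := 0) (v' := 1) (by norm_num) ?_ ?_,
    by simp [h1], by simp [h0], ?_⟩
  · intro t ht; simp only [mem_Icc] at *; constructor <;> linarith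
  · intro t ht; simp only [mem_Ioo] at *; constructor <;> linarith
  · convert he using 1
    have h := lintegral_image_eq_lintegral_abs_deriv_mul (s := Icc (0 : ℝ) 1)
      (f := fun t => -1 * t + 1) (f' := fun _ => -1) measurableSet_Icc
      (fun t _ => by simpa using (((hasDerivAt_id t).const_mul (-1)).add_const 1).hasDerivWithinAt)
      (fun x _ y _ hxy => by simpa using hxy) (fun t => ‖a t‖ₑ ^ 2)
    have him : (fun t : ℝ => -1 * t + 1) '' Icc 0 1 = Icc 0 1 := by
      have := image_const_sub_Icc (1 : ℝ) 0 1
      simpa [sub_eq_neg_add] using this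
    rw [him] at h
    rw [h]
    simp

/-- Concatenation, with the first curve run during the fraction `r / (r + s)` of the unit interval
and the second during the rest. Speeding up by a factor `c` multiplies the energy by `c`, so the
total is less than `(r + s) / r * r² + (r + s) / s * s² = (r + s)²`. -/
lemma ccBall_trans {X : Fin m → GroupLieAlgebra 𝓘(ℝ, F) G} {x y z : G} {r s : ℝ}
    (h : y ∈ ccBall X x r) (h' : z ∈ ccBall X y s) : z ∈ ccBall X x (r + s) := by
  have hr := pos_of_mem_ccBall h
  have hs := pos_of_mem_ccBall h'
  rw [mem_ccBall_iff] at *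
  obtain ⟨γ, a, hγ, h0, h1, he⟩ := h
  obtain ⟨γ', a', hγ', h0', h1', he'⟩ := h'
  set c : ℝ := (r + s) / r with hc
  set c' : ℝ := (r + s) / s with hc'
  set w : ℝ := r / (r + s) with hw
  have hcpos : 0 < c := by positivity
  have hcpos' : 0 < c' := by positivity
  have hw0 : 0 < w := by positivity
  have hw1 : w < 1 := by rw [hw, div_lt_one] <;> linarith
  have hcw : c * w + 0 = 1 := by rw [hc, hw]; field_simp; ring
  have hcw' : c' * w + -(r / s) = 0 := by rw [hc', hw]; field_simp; ring
  have hc1' : c' * 1 + -(r / s) = 1 := by rw [hc']; field_simp; ring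
  have H := hγ.comp_affine (c := c) (d := 0) (u' := 0) (v' := w) hcpos.ne' ?_ ?_
  have H' := hγ'.comp_affine (c := c') (d := -(r / s)) (u' := w) (v' := 1) hcpos'.ne' ?_ ?_
  · refine ⟨_, _, H.glue H' ?_, ?_, ?_, ?_⟩
    · rw [hcw, hcw', h1, h0']
    · simp [hw0.le, h0]
    · rw [if_neg hw1.not_ge, hc1', h1']
    · have hsplit : Icc (0 : ℝ) 1 = Icc 0 w ∪ Ioc w 1 := (Icc_union_Ioc_eq_Icc hw0.le hw1.le).symm
      have E : ∀ (b : ℝ → EuclideanSpace ℝ (Fin m)) (k d : ℝ) (S : Set ℝ), 0 < k →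
          ∫⁻ t in S, ‖k • b (k * t + d)‖ₑ ^ 2 =
            ENNReal.ofReal k * ∫⁻ t in S, ENNReal.ofReal k * ‖b (k * t + d)‖ₑ ^ 2 := by
        intro b k d S hk
        rw [← lintegral_const_mul' _ _ ENNReal.ofReal_ne_top]
        congr 1 with t
        rw [enorm_smul, mul_pow, Real.enorm_eq_ofReal hk.le]
        ring
      rw [hsplit, lintegral_union measurableSet_Ioc
        (Set.disjoint_left.2 fun t ht ht' => (ht.2.trans_lt ht'.1).false)]
      have e1 : ∫⁻ t in Icc 0 w, ‖if t ≤ w then c • a (c * t + 0) else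
          c' • a' (c' * t + -(r / s))‖ₑ ^ 2 =
        ENNReal.ofReal c * ∫⁻ t in Icc (0 : ℝ) 1, ‖a t‖ₑ ^ 2 := by
        rw [setLIntegral_congr_fun (g := fun t => ‖c • a (c * t + 0)‖ₑ ^ 2) measurableSet_Icc
          (fun t ht => by simp [ht.2]), E _ _ _ _ hcpos,
          setLIntegral_comp_affine (fun t => ‖a t‖ₑ ^ 2) hcpos, hcw]
        simp
      have e2 : ∫⁻ t in Ioc w 1, ‖if t ≤ w then c • a (c * t + 0) else
          c' • a' (c' * t + -(r / s))‖ₑ ^ 2 =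
            ENNReal.ofReal c' * ∫⁻ t in Icc (0 : ℝ) 1, ‖a' t‖ₑ ^ 2 := by
        rw [setLIntegral_congr_fun (g := fun t => ‖c' • a' (c' * t + -(r / s))‖ₑ ^ 2)
          measurableSet_Ioc (fun t ht => by simp [not_le.2 ht.1]), E _ _ _ _ hcpos',
          setLIntegral_congr Ioc_ae_eq_Icc,
          setLIntegral_comp_affine (fun t => ‖a' t‖ₑ ^ 2) hcpos', hcw', hc1']
      rw [e1, e2]
      calc _ < ENNReal.ofReal c * ENNReal.ofReal r ^ 2 +
            ENNReal.ofReal c' * ENNReal.ofReal s ^ 2 := by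
            refine ENNReal.add_lt_add ?_ ?_
            · exact (ENNReal.mul_lt_mul_iff_right (by simpa using hcpos) (by simp)).2 he
            · exact (ENNReal.mul_lt_mul_iff_right (by simpa using hcpos') (by simp)).2 he'
        _ = ENNReal.ofReal (r + s) ^ 2 := by
            rw [← ENNReal.ofReal_pow hr.le, ← ENNReal.ofReal_pow hs.le,
              ← ENNReal.ofReal_mul hcpos.le, ← ENNReal.ofReal_mul hcpos'.le,
              ← ENNReal.ofReal_add (by positivity) (by positivity),
              ← ENNReal.ofReal_pow (by positivity)]
            congr 1
            rw [hc, hc']; field_simp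
  · intro t ht
    rw [← hcw', ← hc1']
    exact ⟨add_le_add_left (mul_le_mul_of_nonneg_left ht.1 hcpos'.le) _,
      add_le_add_left (mul_le_mul_of_nonneg_left ht.2 hcpos'.le) _⟩
  · intro t ht
    refine ⟨hcw'.symm.trans_lt ?_, lt_of_lt_of_eq ?_ hc1'⟩
    · exact add_lt_add_left (mul_lt_mul_of_pos_left ht.1 hcpos') _
    · exact add_lt_add_left (mul_lt_mul_of_pos_left ht.2 hcpos') _
  · intro t ht
    refine ⟨add_nonneg (mul_nonneg hcpos.le ht.1) le_rfl, le_of_le_of_eq ?_ hcw⟩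
    exact add_le_add_left (mul_le_mul_of_nonneg_left ht.2 hcpos.le) _
  · intro t ht
    refine ⟨by simpa using mul_pos hcpos ht.1, lt_of_lt_of_eq ?_ hcw⟩
    exact add_lt_add_left (mul_lt_mul_of_pos_left ht.2 hcpos) _

section LeftInvariance

variable [LieGroup 𝓘(ℝ, F) ∞ G]

lemma IsHorizontalOn.mul_left {X : Fin m → GroupLieAlgebra 𝓘(ℝ, F) G} {γ : ℝ → G}
    {a : ℝ → EuclideanSpace ℝ (Fin m)} {u v : ℝ} (h : IsHorizontalOn X γ a u v) (g : G) :
    IsHorizontalOn X (fun t => g * γ t) a u v where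
  measurable := h.measurable
  lipschitz f hf := h.lipschitz (fun x => f (g * x)) (hf.comp contMDiff_mul_left)
  deriv := by
    filter_upwards [h.deriv] with t ht htm
    exact hasMFDerivAt_mul_left (ht htm) g

lemma mul_left_mem_ccBall {X : Fin m → GroupLieAlgebra 𝓘(ℝ, F) G} {x y : G} {r : ℝ}
    (h : y ∈ ccBall X x r) (g : G) : g * y ∈ ccBall X (g * x) r := by
  rw [mem_ccBall_iff] at *
  obtain ⟨γ, a, hγ, h0, h1, he⟩ := h
  exact ⟨_, a, hγ.mul_left g, by simp [h0], by simp [h1], he⟩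

lemma mul_mem_ccBall_iff {X : Fin m → GroupLieAlgebra 𝓘(ℝ, F) G} {x y : G} {r : ℝ} :
    x * y ∈ ccBall X x r ↔ y ∈ ccBall X 1 r :=
  ⟨fun h => by simpa using mul_left_mem_ccBall h x⁻¹,
    fun h => by simpa using mul_left_mem_ccBall h x⟩

lemma mul_mem_ccBall_one {X : Fin m → GroupLieAlgebra 𝓘(ℝ, F) G} {x y : G} {r s : ℝ}
    (hx : x ∈ ccBall X 1 r) (hy : y ∈ ccBall X 1 s) : x * y ∈ ccBall X 1 (r + s) :=
  ccBall_trans hx (mul_mem_ccBall_iff.2 hy)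

variable [T2Space G] [CompleteSpace F]

lemma expCurve_one_mem_ccBall (X : Fin m → GroupLieAlgebra 𝓘(ℝ, F) G)
    (c : EuclideanSpace ℝ (Fin m)) {r : ℝ} (hr : ‖c‖ < r) :
    expCurve (∑ i, c i • X i) 1 ∈ ccBall X 1 r := by
  rw [mem_ccBall_iff]
  refine ⟨expCurve (∑ i, c i • X i), fun _ => c, ⟨measurable_const, fun f hf => ?_, ?_⟩,
    expCurve_zero _, rfl, ?_⟩
  · have h1 := (contDiff_comp_expCurve (∑ i, c i • X i) hf).of_le (n := ∞) (m := 1) (by simp)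
    exact (h1.locallyLipschitz.locallyLipschitzOn (s := Icc 0 1)).exists_lipschitzOnWith_of_compact
      isCompact_Icc
  · exact Eventually.of_forall fun t _ => isMIntegralCurve_expCurve _ t
  · simp only [setLIntegral_const, Real.volume_Icc, sub_zero, ENNReal.ofReal_one, mul_one]
    have : ‖c‖ₑ < ENNReal.ofReal r := by
      rw [← ofReal_norm]
      exact (ENNReal.ofReal_lt_ofReal_iff (lt_of_le_of_lt (norm_nonneg c) hr)).2 hr
    exact ENNReal.pow_lt_pow_left two_ne_zero this

end LeftInvariance

end Curves
end Carnot
end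

/-! ### A quantitative Chow theorem in step two. -/

noncomputable section

namespace Carnot

/-- A strictly differentiable map with surjective derivative maps small balls onto sets containing
balls of comparable radius. -/
lemma exists_closedBall_subset_image {E F : Type*} [NormedAddCommGroup E] [NormedSpace ℝ E]
    [NormedAddCommGroup F] [NormedSpace ℝ F] [CompleteSpace E] [CompleteSpace F] {f : E → F}
    {f' : E →L[ℝ] F} {a : E} (hf : HasStrictFDerivAt f f' a) (h : f'.range = ⊤) :
    ∃ κ > 0, ∃ ε₀ > 0, ∀ ε, 0 < ε → ε ≤ ε₀ →
      Metric.closedBall (f a) (κ * ε) ⊆ f '' Metric.closedBall a ε := by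
  let f'symm := f'.nonlinearRightInverseOfSurjective h
  have hpos : 0 < f'symm.nnnorm := f'.nonlinearRightInverseOfSurjective_nnnorm_pos h
  -- Approximating up to half the reciprocal norm of the right inverse leaves the other half as the
  -- expansion ratio.
  obtain ⟨s, hs, hfs⟩ := hf.approximates_deriv_on_nhds (c := f'symm.nnnorm⁻¹ / 2)
    (Or.inr (half_pos (inv_pos.2 hpos)))
  obtain ⟨ε₀, hε₀, hball⟩ := Metric.nhds_basis_closedBall.mem_iff.1 hs
  refine ⟨(f'symm.nnnorm : ℝ)⁻¹ / 2, by positivity, ε₀, hε₀, fun ε hε hle => ?_⟩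
  have h1 := hfs.surjOn_closedBall_of_nonlinearRightInverse f'symm hε.le
    ((Metric.closedBall_subset_closedBall hle).trans hball)
  have e : ((f'symm.nnnorm : ℝ)⁻¹ - (f'symm.nnnorm⁻¹ / 2 : NNReal)) * ε =
      (f'symm.nnnorm : ℝ)⁻¹ / 2 * ε := by push_cast; ring
  rwa [e] at h1

section StepTwo

variable {F : Type*} [NormedAddCommGroup F] [NormedSpace ℝ F] [FiniteDimensional ℝ F]
  [CompleteSpace F]
  {G : Type*} [TopologicalSpace G] [ChartedSpace F G] [Group G] [LieGroup 𝓘(ℝ, F) ∞ G] [T2Space G]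
  {m : ℕ}

lemma expCurve_mem_ccBall (X : Fin m → GroupLieAlgebra 𝓘(ℝ, F) G) (i : Fin m) {t r : ℝ}
    (h : |t| < r) : expCurve (X i) t ∈ ccBall X 1 r := by
  have h1 := expCurve_one_mem_ccBall X (EuclideanSpace.single i t) (r := r) (by simpa using h)
  have h2 : ∑ k, (EuclideanSpace.single i t : EuclideanSpace ℝ (Fin m)) k • X k = t • X i := by
    rw [Finset.sum_eq_single i]
    · simp
    · intro k _ hk; simp [hk]
    · simp
  rwa [h2, expCurve_smul, mul_one] at h1

lemma one_mem_ccBall (X : Fin m → GroupLieAlgebra 𝓘(ℝ, F) G) {r : ℝ} (hr : 0 < r) :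
    (1 : G) ∈ ccBall X 1 r := by
  have h1 := expCurve_one_mem_ccBall X (0 : EuclideanSpace ℝ (Fin m)) (r := r) (by simpa using hr)
  have h2 : ∑ k, (0 : EuclideanSpace ℝ (Fin m)) k • X k = (0 : ℝ) • 0 := by simp
  rwa [h2, expCurve_smul, zero_mul, expCurve_zero] at h1

/-- Source of the quadratic scaling: `t` is a product `p q` with `|p| = |q| = √|t|`, and the
commutator formula writes the element as four horizontal exponentials, each of length less than `r`.
-/
lemma expCurve_lie_mem_ccBall {X : Fin m → GroupLieAlgebra 𝓘(ℝ, F) G}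
    (hX : ∀ i j k, ⁅X k, ⁅X i, X j⁆⁆ = 0) (i j : Fin m) {t r : ℝ} (hr : 0 < r)
    (h : |t| < r ^ 2) : expCurve ⁅X i, X j⁆ t ∈ ccBall X 1 (4 * r) := by
  obtain ⟨p, q, hp, hq, rfl⟩ : ∃ p q : ℝ, |p| < r ∧ |q| < r ∧ t = p * q := by
    have hs : √|t| < r := (Real.sqrt_lt' hr).2 h
    have hs0 : abs (√|t|) < r := by rwa [abs_of_nonneg (Real.sqrt_nonneg _)]
    rcases le_total 0 t with ht | ht
    · exact ⟨√|t|, √|t|, hs0, hs0, by rw [Real.mul_self_sqrt (abs_nonneg t), abs_of_nonneg ht]⟩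
    · refine ⟨√|t|, -√|t|, hs0, by rwa [abs_neg], ?_⟩
      rw [mul_neg, Real.mul_self_sqrt (abs_nonneg t), abs_of_nonpos ht, neg_neg]
  have hc := expCurve_conj (hX i j i) (hX i j j) p q
  have e : expCurve ⁅X i, X j⁆ (p * q) =
      expCurve (X j) (-q) * (expCurve (X i) p * expCurve (X j) q * expCurve (X i) (-p)) := by
    rw [hc, ← mul_assoc, ← expCurve_add, neg_add_cancel, expCurve_zero, one_mul]
  rw [e]
  have := mul_mem_ccBall_one (expCurve_mem_ccBall X j (t := -q) (by rwa [abs_neg]))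
    (mul_mem_ccBall_one (mul_mem_ccBall_one (expCurve_mem_ccBall X i hp)
      (expCurve_mem_ccBall X j hq)) (expCurve_mem_ccBall X i (t := -p) (by rwa [abs_neg])))
  rwa [show r + (r + r + r) = 4 * r by ring] at this

variable {κ : Type*} [Fintype κ]

/-- Coordinates of the second kind. -/
def expProd (Y : κ → GroupLieAlgebra 𝓘(ℝ, F) G) (l : List κ) (w : κ → ℝ) : G :=
  (l.map fun k => expCurve (Y k) (w k)).prod

omit [FiniteDimensional ℝ F] [Fintype κ] in
@[simp] lemma expProd_cons (Y : κ → GroupLieAlgebra 𝓘(ℝ, F) G) (k : κ) (l : List κ) (w : κ → ℝ) :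
    expProd Y (k :: l) w = expCurve (Y k) (w k) * expProd Y l w := by
  simp [expProd]

lemma contMDiff_expProd (Y : κ → GroupLieAlgebra 𝓘(ℝ, F) G) (l : List κ) :
    ContMDiff 𝓘(ℝ, κ → ℝ) 𝓘(ℝ, F) ∞ (expProd Y l) := by
  induction l with
  | nil => exact contMDiff_const
  | cons k l ih =>
    have : expProd Y (k :: l) = fun w => expCurve (Y k) (w k) * expProd Y l w := by
      ext w; simp
    rw [this]
    exact ((contMDiff_expCurve (Y k)).comp (contDiff_apply ℝ ℝ k).contMDiff).mul ih

omit [FiniteDimensional ℝ F] [Fintype κ] in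
lemma expProd_single [DecidableEq κ] (Y : κ → GroupLieAlgebra 𝓘(ℝ, F) G) {l : List κ}
    (hl : l.Nodup) (k : κ) (t : ℝ) :
    expProd Y l (Pi.single k t) = if k ∈ l then expCurve (Y k) t else 1 := by
  induction l with
  | nil => simp [expProd]
  | cons j l ih =>
    rw [List.nodup_cons] at hl
    rw [expProd_cons, ih hl.2]
    rcases eq_or_ne k j with rfl | hkj
    · simp [hl.1]
    · simp [hkj]

omit [Fintype κ] in
-- The summand `1` added to the length pays for the identity ending the product, since balls need a
-- positive radius to contain their centre.
lemma expProd_mem_ccBall {X : Fin m → GroupLieAlgebra 𝓘(ℝ, F) G}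
    {Y : κ → GroupLieAlgebra 𝓘(ℝ, F) G} {w : κ → ℝ} {r : ℝ} (hr : 0 < r)
    (h : ∀ k, expCurve (Y k) (w k) ∈ ccBall X 1 r) (l : List κ) :
    expProd Y l w ∈ ccBall X 1 ((l.length + 1) * r) := by
  induction l with
  | nil =>
    simpa [expProd] using one_mem_ccBall X hr
  | cons k l ih =>
    have h1 := mul_mem_ccBall_one (h k) ih
    have e : r + (l.length + 1) * r = ((k :: l).length + 1) * r := by
      push_cast [List.length_cons]; ring
    rwa [expProd_cons, ← e]

omit [FiniteDimensional ℝ F] [CompleteSpace F] [LieGroup 𝓘(ℝ, F) ∞ G] [T2Space G] in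
lemma mulInvariantVectorField_one (X : GroupLieAlgebra 𝓘(ℝ, F) G) :
    mulInvariantVectorField X (1 : G) = X := by
  have h : ((1 : G) * ·) = (id : G → G) := by ext; simp
  rw [mulInvariantVectorField, h, mfderiv_id]
  rfl

/-- At the origin the product of exponentials has partial derivatives `Y k`. Its derivative is onto
because these span, although they need not be independent, and the quantitative open mapping result
applies. -/
lemma exists_extChartAt_subset_image (Y : κ → GroupLieAlgebra 𝓘(ℝ, F) G)
    (hY : Submodule.span ℝ (range Y) = ⊤) :
    ∃ c > 0, ∃ ε₀ > 0, ∀ ε, 0 < ε → ε ≤ ε₀ → ∀ g ∈ (extChartAt 𝓘(ℝ, F) (1 : G)).source,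
      ‖extChartAt 𝓘(ℝ, F) (1 : G) g - extChartAt 𝓘(ℝ, F) (1 : G) 1‖ ≤ c * ε →
      ∃ w : κ → ℝ, ‖w‖ ≤ ε ∧ expProd Y Finset.univ.toList w = g := by
  classical
  set φ := extChartAt 𝓘(ℝ, F) (1 : G)
  obtain ⟨u, hu, huφ⟩ := exists_contMDiff_eventuallyEq_extChartAt (F := F) (1 : G)
  set Ψ := expProd Y Finset.univ.toList with hΨ
  have hΨ0 : Ψ 0 = 1 := by
    rw [hΨ]
    simp [expProd]
  have hf : ContDiff ℝ ∞ (fun w => u (Ψ w)) :=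
    contMDiff_iff_contDiff.1 (hu.comp (contMDiff_expProd Y _))
  have hd : HasStrictFDerivAt (fun w => u (Ψ w)) (fderiv ℝ (fun w => u (Ψ w)) 0) 0 :=
    hf.contDiffAt.hasStrictFDerivAt (by simp)
  -- On the `k`-th axis all other factors are `1` and the product is a single one-parameter
  -- subgroup.
  have hpart : ∀ k, fderiv ℝ (fun w => u (Ψ w)) 0 (Pi.single k 1) = Y k := by
    intro k
    have h1 := hasDerivAt_comp_expCurve (Y k) hu 0
    have h2 : HasDerivAt (fun t : ℝ => (Pi.single k t : κ → ℝ)) (Pi.single k 1) 0 :=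
      hasDerivAt_single k 0
    have h3 := (hd.hasFDerivAt.comp_hasDerivAt_of_eq (0 : ℝ) h2 (by simp))
    have e : (fun w => u (Ψ w)) ∘ (fun t : ℝ => (Pi.single k t : κ → ℝ)) =
        fun t => u (expCurve (Y k) t) := by
      ext t
      simp [hΨ, expProd_single Y (Finset.nodup_toList _)]
    rw [e] at h3
    rw [h3.unique h1, expCurve_zero, dirDeriv, fieldDeriv, huφ.mfderiv_eq,
      mulInvariantVectorField_one,
      mfderiv_extChartAt_self]
    rfl
  have hsurj : (fderiv ℝ (fun w => u (Ψ w)) 0).range = ⊤ := by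
    let Y' : κ → F := Y
    have hY' : Submodule.span ℝ (range Y') = ⊤ := hY
    rw [eq_top_iff, ← hY', Submodule.span_le]
    rintro _ ⟨k, rfl⟩
    exact ⟨Pi.single k 1, hpart k⟩
  obtain ⟨c, hc, ε₀, hε₀, H⟩ := exists_closedBall_subset_image hd hsurj
  have hnear : ∀ᶠ w in 𝓝 (0 : κ → ℝ), u (Ψ w) = φ (Ψ w) ∧ Ψ w ∈ φ.source := by
    have hcont : Tendsto Ψ (𝓝 0) (𝓝 1) := by
      rw [← hΨ0]
      exact (contMDiff_expProd Y _).continuous.tendsto 0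
    exact hcont.eventually (huφ.and (extChartAt_source_mem_nhds (I := 𝓘(ℝ, F)) (1 : G)))
  obtain ⟨ε₁, hε₁, hball⟩ := Metric.nhds_basis_closedBall.mem_iff.1 hnear
  refine ⟨c, hc, min ε₀ ε₁, lt_min hε₀ hε₁, fun ε hε hle g hg hgc => ?_⟩
  have hmem : φ g ∈ Metric.closedBall (u (Ψ 0)) (c * ε) := by
    rw [hΨ0, huφ.self_of_nhds, mem_closedBall_iff_norm]
    exact hgc
  obtain ⟨w, hw, hwg⟩ := H ε hε (hle.trans (min_le_left _ _)) hmem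
  have hw' : ‖w‖ ≤ ε := by simpa using hw
  obtain ⟨e1, e2⟩ := hball (show w ∈ Metric.closedBall 0 ε₁ by
    simpa using hw'.trans (hle.trans (min_le_right _ _)))
  refine ⟨w, hw', φ.injOn e2 hg ?_⟩
  rw [← e1]
  exact hwg

/-- A quantitative Chow theorem in step two: near the identity, balls of the Carnot-Carathéodory
distance of radius `r` contain coordinate balls of radius comparable to `r ^ 2`. -/
lemma exists_extChartAt_mem_ccBall {X : Fin m → GroupLieAlgebra 𝓘(ℝ, F) G}
    (hX : ∀ i j k, ⁅X k, ⁅X i, X j⁆⁆ = 0)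
    (hspan : Submodule.span ℝ
      (range (Sum.elim X fun p : Fin m × Fin m => ⁅X p.1, X p.2⁆)) = ⊤) :
    ∃ c > 0, ∃ ρ > 0, ∀ r, 0 < r → r ≤ ρ → ∀ g ∈ (extChartAt 𝓘(ℝ, F) (1 : G)).source,
      ‖extChartAt 𝓘(ℝ, F) (1 : G) g - extChartAt 𝓘(ℝ, F) (1 : G) 1‖ ≤ c * r ^ 2 →
      g ∈ ccBall X 1 r := by
  obtain ⟨c, hc, ε₀, hε₀, H⟩ := exists_extChartAt_subset_image _ hspan
  set l : List (Fin m ⊕ Fin m × Fin m) := Finset.univ.toList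
  set N : ℝ := l.length + 1
  have hN : 0 < N := by positivity
  refine ⟨c / (2 * (4 * N) ^ 2), by positivity, min (4 * N) (min (4 * N * ε₀) (4 * N)),
    by positivity, fun r hr hle g hg hgc => ?_⟩
  -- There are `N - 1` factors, each in a ball of radius `4 s`, and `N * (4 * s) = r`. A bracket
  -- coordinate must be less than `s²` in absolute value; as `s ≤ 1`, this also bounds the
  -- horizontal coordinates. The coordinates are taken up to `s² / 2` to make the inequality strict.
  set s : ℝ := r / (4 * N) with hs
  have hs0 : 0 < s := by positivity
  have hs1 : s ≤ 1 := by
    rw [hs, div_le_one (by positivity)]; exact hle.trans (min_le_left _ _)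
  have hsε : s ≤ ε₀ := by
    rw [hs, div_le_iff₀ (by positivity), mul_comm]
    exact hle.trans ((min_le_right _ _).trans (min_le_left _ _))
  have hs2 : s ^ 2 ≤ s := by nlinarith
  obtain ⟨w, hw, rfl⟩ := H (s ^ 2 / 2) (by positivity) (by linarith) g hg
    (hgc.trans (le_of_eq (by rw [hs]; field_simp)))
  have hwk : ∀ k, |w k| < s ^ 2 := fun k =>
    (norm_le_pi_norm w k).trans_lt (hw.trans_lt (by linarith [pow_pos hs0 2]))
  have hmem := expProd_mem_ccBall (X := X) (r := 4 * s) (w := w)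
    (Y := Sum.elim X fun p : Fin m × Fin m => ⁅X p.1, X p.2⁆) (by positivity) (fun k => ?_) l
  · have e : ((l.length : ℝ) + 1) * (4 * s) = r := by
      change N * (4 * s) = r
      rw [hs]; field_simp
    rwa [e] at hmem
  · rcases k with i | p
    · exact expCurve_mem_ccBall X i (by linarith [hwk (Sum.inl i)])
    · exact expCurve_lie_mem_ccBall hX p.1 p.2 hs0 (hwk (Sum.inr p))

end StepTwo
end Carnot
end

/-! ### Local geometry: charts against balls, openness, relative compactness. -/

noncomputable section

namespace Carnot

section LocalGeometry

variable {F : Type*} [NormedAddCommGroup F] [NormedSpace ℝ F] [FiniteDimensional ℝ F]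
  {G : Type*} [TopologicalSpace G] [ChartedSpace F G] [Group G] [LieGroup 𝓘(ℝ, F) ∞ G] [T2Space G]
  {m : ℕ}

omit [FiniteDimensional ℝ F] [T2Space G] in
-- Read in the chart, `(x, y) ↦ x⁻¹ y` is smooth, hence locally Lipschitz, and constant on the
-- diagonal: compare its values at `(x, y)` and `(x, x)`. It transfers estimates at the identity to
-- all nearby pairs by left invariance.
lemma exists_lipschitz_inv_mul_chart :
    ∃ K : NNReal, ∃ U ∈ 𝓝 (1 : G), ∀ x ∈ U, ∀ y ∈ U,
      ‖extChartAt 𝓘(ℝ, F) (1 : G) (x⁻¹ * y) - extChartAt 𝓘(ℝ, F) (1 : G) 1‖ ≤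
        K * ‖extChartAt 𝓘(ℝ, F) (1 : G) x - extChartAt 𝓘(ℝ, F) (1 : G) y‖ := by
  set φ := extChartAt 𝓘(ℝ, F) (1 : G) with hφ
  have hsymm : ContMDiffAt 𝓘(ℝ, F) 𝓘(ℝ, F) ∞ φ.symm (φ 1) :=
    (contMDiffOn_extChartAt_symm (I := 𝓘(ℝ, F)) (n := ∞) (1 : G)).contMDiffAt
      (extChartAt_target_mem_nhds (I := 𝓘(ℝ, F)) (1 : G))
  have hφ1 : φ.symm (φ 1) = 1 := extChartAt_to_inv (I := 𝓘(ℝ, F)) (1 : G)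
  have hh : ContDiffAt ℝ ∞ (fun p : F × F => φ ((φ.symm p.1)⁻¹ * φ.symm p.2)) (φ 1, φ 1) := by
    rw [← contMDiffAt_iff_contDiffAt]
    have h1 : ContMDiffAt 𝓘(ℝ, F × F) 𝓘(ℝ, F) ∞ (fun p : F × F => φ.symm p.1) (φ 1, φ 1) :=
      ContMDiffAt.comp (φ 1, φ 1) hsymm contDiff_fst.contMDiff.contMDiffAt
    have h2 : ContMDiffAt 𝓘(ℝ, F × F) 𝓘(ℝ, F) ∞ (fun p : F × F => φ.symm p.2) (φ 1, φ 1) :=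
      ContMDiffAt.comp (φ 1, φ 1) hsymm contDiff_snd.contMDiff.contMDiffAt
    have h3 : ContMDiffAt 𝓘(ℝ, F) 𝓘(ℝ, F) ∞ φ (1 : G) := contMDiffAt_extChartAt
    refine ContMDiffAt.comp_of_eq (y := (1 : G)) h3 (h1.inv.mul h2) ?_
    simp [hφ1]
  obtain ⟨K, t, ht, hK⟩ := (hh.of_le (m := 1) (by simp)).exists_lipschitzOnWith
  have hcont : ContinuousAt φ (1 : G) := continuousAt_extChartAt (I := 𝓘(ℝ, F)) (1 : G)
  rw [nhds_prod_eq, mem_prod_same_iff] at ht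
  obtain ⟨V, hV, hVt⟩ := ht
  refine ⟨K, φ.source ∩ φ ⁻¹' V, inter_mem (extChartAt_source_mem_nhds (I := 𝓘(ℝ, F)) (1 : G))
    (hcont hV), fun x hx y hy => ?_⟩
  have := hK.norm_sub_le (hVt (mk_mem_prod hx.2 hy.2)) (hVt (mk_mem_prod hx.2 hx.2))
  simp only [φ.left_inv hx.1, φ.left_inv hy.1, inv_mul_cancel] at this
  refine this.trans (le_of_eq ?_)
  rw [Prod.mk_sub_mk, sub_self, Prod.norm_mk, norm_zero, max_eq_right (norm_nonneg _),
    norm_sub_rev]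

/-- Around each point there are coordinates in which points at distance at most `c r ^ 2` are
within Carnot-Carathéodory distance `r` of each other. -/
lemma exists_local_chart {X : Fin m → GroupLieAlgebra 𝓘(ℝ, F) G}
    (hX : ∀ i j k, ⁅X k, ⁅X i, X j⁆⁆ = 0)
    (hspan : Submodule.span ℝ
      (range (Sum.elim X fun p : Fin m × Fin m => ⁅X p.1, X p.2⁆)) = ⊤) (x₀ : G) :
    ∃ ψ : G → F, ∃ U ∈ 𝓝 x₀, ContinuousAt ψ x₀ ∧ ∃ c > 0, ∃ ρ > 0, ∃ R, ∀ x ∈ U, ‖ψ x‖ ≤ R ∧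
      ∀ y ∈ U, ∀ r, 0 < r → r ≤ ρ → ‖ψ x - ψ y‖ ≤ c * r ^ 2 → y ∈ ccBall X x r := by
  have : CompleteSpace F := FiniteDimensional.complete ℝ F
  have : IsTopologicalGroup G := topologicalGroup_of_lieGroup 𝓘(ℝ, F) ∞
  set φ := extChartAt 𝓘(ℝ, F) (1 : G) with hφ
  obtain ⟨c, hc, ρ, hρ, H⟩ := exists_extChartAt_mem_ccBall hX hspan
  obtain ⟨K, U, hU, hK⟩ := exists_lipschitz_inv_mul_chart (F := F) (G := G)
  have hcont : ContinuousAt φ (1 : G) := continuousAt_extChartAt (I := 𝓘(ℝ, F)) (1 : G)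
  have hsrc : {p : G × G | p.1⁻¹ * p.2 ∈ φ.source} ∈ 𝓝 ((1 : G), (1 : G)) := by
    have : Tendsto (fun p : G × G => p.1⁻¹ * p.2) (𝓝 (1, 1)) (𝓝 1) := by
      have : Continuous (fun p : G × G => p.1⁻¹ * p.2) := by fun_prop
      simpa using this.tendsto (1, 1)
    exact this (extChartAt_source_mem_nhds (I := 𝓘(ℝ, F)) (1 : G))
  rw [nhds_prod_eq, mem_prod_same_iff] at hsrc
  obtain ⟨W, hW, hWs⟩ := hsrc
  have hb : φ ⁻¹' Metric.ball (φ 1) 1 ∈ 𝓝 (1 : G) := hcont (Metric.ball_mem_nhds _ one_pos)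
  have ht : Tendsto (fun x => x₀⁻¹ * x) (𝓝 x₀) (𝓝 1) := by
    have : Continuous (fun x => x₀⁻¹ * x) := by fun_prop
    simpa using this.tendsto x₀
  -- The constant `c / (K + 1)` absorbs the Lipschitz constant `K` of `x⁻¹ y`; adding `1` keeps the
  -- denominator positive.
  refine ⟨fun x => φ (x₀⁻¹ * x), (fun x => x₀⁻¹ * x) ⁻¹' (U ∩ W ∩ φ ⁻¹' Metric.ball (φ 1) 1),
    ht (inter_mem (inter_mem hU hW) hb), ?_, c / (K + 1), by positivity, ρ, hρ, ‖φ 1‖ + 1,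
    fun x hx => ⟨?_, fun y hy r hr hrρ hxy => ?_⟩⟩
  · exact ContinuousAt.comp_of_eq (y := (1 : G)) hcont (by fun_prop) (by simp)
  · have := mem_ball_iff_norm.1 hx.2
    have := norm_le_norm_add_norm_sub' (φ (x₀⁻¹ * x)) (φ 1)
    linarith
  · have e1 := hK _ hx.1.1 _ hy.1.1
    have e2 := H r hr hrρ _ (hWs (mk_mem_prod hx.1.2 hy.1.2))
    have e3 : (x₀⁻¹ * x)⁻¹ * (x₀⁻¹ * y) = x⁻¹ * y := by group
    simp only [e3, ← hφ] at e1 e2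
    have := mul_mem_ccBall_iff (x := x).2 (e2 (e1.trans ?_))
    · simpa using this
    · calc (K : ℝ) * ‖φ (x₀⁻¹ * x) - φ (x₀⁻¹ * y)‖ ≤ (K + 1) * (c / (K + 1) * r ^ 2) := by
            gcongr; linarith
        _ = c * r ^ 2 := by field_simp

lemma ccBall_mem_nhds {X : Fin m → GroupLieAlgebra 𝓘(ℝ, F) G}
    (hX : ∀ i j k, ⁅X k, ⁅X i, X j⁆⁆ = 0)
    (hspan : Submodule.span ℝ
      (range (Sum.elim X fun p : Fin m × Fin m => ⁅X p.1, X p.2⁆)) = ⊤) (x : G) {r : ℝ}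
    (hr : 0 < r) : ccBall X x r ∈ 𝓝 x := by
  obtain ⟨ψ, U, hU, hψ, c, hc, ρ, hρ, R, H⟩ := exists_local_chart hX hspan x
  have hs : 0 < min r ρ := lt_min hr hρ
  have hb := hψ (Metric.ball_mem_nhds (ψ x) (ε := c * (min r ρ) ^ 2) (by positivity))
  filter_upwards [hU, hb] with y hy hyb
  refine ccBall_mono X x (min_le_left r ρ)
    ((H x (mem_of_mem_nhds hU)).2 y hy _ hs (min_le_right _ _) ?_)
  rw [norm_sub_rev]
  exact (mem_ball_iff_norm.1 hyb).le

lemma isOpen_ccBall {X : Fin m → GroupLieAlgebra 𝓘(ℝ, F) G}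
    (hX : ∀ i j k, ⁅X k, ⁅X i, X j⁆⁆ = 0)
    (hspan : Submodule.span ℝ
      (range (Sum.elim X fun p : Fin m × Fin m => ⁅X p.1, X p.2⁆)) = ⊤) (x : G) (r : ℝ) :
    IsOpen (ccBall X x r) := by
  rw [isOpen_iff_mem_nhds]
  intro y hy
  obtain ⟨s, hs0, hys, hsr⟩ : ∃ s : ℝ, 0 < s ∧ y ∈ ccBall X x s ∧ s < r := by
    have h1 : max (ccDist X x y) 0 < ENNReal.ofReal r :=
      max_lt hy (ENNReal.ofReal_pos.2 (pos_of_mem_ccBall hy))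
    obtain ⟨q, hq0, hq1, hq2⟩ := ENNReal.lt_iff_exists_real_btwn.1 h1
    have hq : 0 < ENNReal.ofReal q := bot_lt_of_lt hq1
    refine ⟨q, ENNReal.ofReal_pos.1 hq, lt_of_le_of_lt (le_max_left _ _) hq1, ?_⟩
    by_contra hle
    exact hq2.not_ge (ENNReal.ofReal_le_ofReal (not_lt.1 hle))
  filter_upwards [ccBall_mem_nhds hX hspan y (sub_pos.2 hsr)] with z hz
  have := ccBall_trans hys hz
  rwa [add_sub_cancel] at this

omit [FiniteDimensional ℝ F] [T2Space G] [LieGroup 𝓘(ℝ, F) ∞ G] in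
lemma dirDeriv_sum {E : Type*} [NormedAddCommGroup E] [NormedSpace ℝ E] {ι : Type*} (s : Finset ι)
    (c : ι → ℝ) (X : ι → GroupLieAlgebra 𝓘(ℝ, F) G) (f : G → E) (x : G) :
    dirDeriv (∑ i ∈ s, c i • X i) f x = ∑ i ∈ s, c i • dirDeriv (X i) f x := by
  classical
  induction s using Finset.induction_on with
  | empty =>
    have := congrFun (dirDeriv_smul (0 : ℝ) (0 : GroupLieAlgebra 𝓘(ℝ, F) G) f) x
    simpa using this
  | insert i s hi ih =>
    rw [Finset.sum_insert hi, dirDeriv_add, dirDeriv_smul, Finset.sum_insert hi, ← ih]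
    rfl

omit [FiniteDimensional ℝ F] [T2Space G] [LieGroup 𝓘(ℝ, F) ∞ G] in
-- Along a horizontal curve `f` is absolutely continuous with derivative at most `m M |a|`;
-- integrate, and control `∫ |a|` by the energy.
lemma abs_sub_le_of_mem_ccBall (X : Fin m → GroupLieAlgebra 𝓘(ℝ, F) G) {f : G → ℝ}
    (hf : ContMDiff 𝓘(ℝ, F) 𝓘(ℝ, ℝ) ∞ f) {M : ℝ} (hM0 : 0 ≤ M)
    (hM : ∀ i x, |dirDeriv (X i) f x| ≤ M) {x y : G} {r : ℝ} (h : y ∈ ccBall X x r) :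
    |f y - f x| ≤ 2 * m * M * r := by
  have hr := pos_of_mem_ccBall h
  obtain ⟨γ, a, hγ, rfl, rfl, he⟩ := mem_ccBall_iff.1 h
  obtain ⟨K, hK⟩ := hγ.lipschitz f hf
  have hac : AbsolutelyContinuousOnInterval (f ∘ γ) 0 1 :=
    LipschitzOnWith.absolutelyContinuousOnInterval (by rwa [uIcc_of_le zero_le_one])
  have hint := hac.integral_deriv_eq_sub
  have hderiv : ∀ᵐ t, t ∈ Ioo (0 : ℝ) 1 → ‖deriv (f ∘ γ) t‖ₑ ≤
      ENNReal.ofReal (m * M) * (ENNReal.ofReal r + (ENNReal.ofReal r)⁻¹ * ‖a t‖ₑ ^ 2) := by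
    filter_upwards [hγ.deriv] with t ht htm
    have hd : deriv (f ∘ γ) t = _ := (hasDerivAt_comp_of_hasMFDerivAt hf (ht htm)).deriv
    have h1 : |deriv (f ∘ γ) t| ≤ m * M * ‖a t‖ := by
      rw [hd]
      change |dirDeriv (∑ i, a t i • X i) f (γ t)| ≤ _
      rw [dirDeriv_sum]
      refine (Finset.abs_sum_le_sum_abs _ _).trans ?_
      calc ∑ i, |a t i • dirDeriv (X i) f (γ t)| ≤ ∑ _i : Fin m, M * ‖a t‖ := by
            refine Finset.sum_le_sum fun i _ => ?_
            rw [smul_eq_mul, abs_mul, mul_comm]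
            gcongr
            · exact hM i _
            · exact PiLp.norm_apply_le (a t) i
        _ = m * M * ‖a t‖ := by simp; ring
    -- A pointwise substitute for Cauchy-Schwarz in the integral; it accounts for the factor `2` in
    -- the bound.
    have h2 : ‖a t‖ ≤ r + r⁻¹ * ‖a t‖ ^ 2 := by
      have h0 := norm_nonneg (a t)
      have : r * ‖a t‖ ≤ r * r + ‖a t‖ ^ 2 := by nlinarith [sq_nonneg (r - ‖a t‖)]
      rw [← mul_le_mul_iff_right₀ hr]
      refine this.trans (le_of_eq ?_)
      field_simp
    have h3 : |deriv (f ∘ γ) t| ≤ m * M * (r + r⁻¹ * ‖a t‖ ^ 2) :=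
      h1.trans (by gcongr)
    rw [← ofReal_norm, ← ENNReal.ofReal_inv_of_pos hr, ← ofReal_norm (a t),
      ← ENNReal.ofReal_pow (norm_nonneg _), ← ENNReal.ofReal_mul (by positivity),
      ← ENNReal.ofReal_add hr.le (by positivity), ← ENNReal.ofReal_mul (by positivity)]
    exact ENNReal.ofReal_le_ofReal h3
  have hle : ‖f (γ 1) - f (γ 0)‖ₑ ≤ ENNReal.ofReal (2 * m * M * r) := by
    have hint' : ∫ t in Ioc (0 : ℝ) 1, deriv (f ∘ γ) t = f (γ 1) - f (γ 0) := by
      rw [← intervalIntegral.integral_of_le zero_le_one, hint]; rfl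
    have hRm : Measurable fun t => ENNReal.ofReal (m * M) *
        (ENNReal.ofReal r + (ENNReal.ofReal r)⁻¹ * ‖a t‖ₑ ^ 2) := by
      have := hγ.measurable
      fun_prop
    calc ‖f (γ 1) - f (γ 0)‖ₑ ≤ ∫⁻ t in Ioc (0 : ℝ) 1, ‖deriv (f ∘ γ) t‖ₑ := by
          rw [← hint']; exact enorm_integral_le_lintegral_enorm _
      _ = ∫⁻ t in Ioo (0 : ℝ) 1, ‖deriv (f ∘ γ) t‖ₑ := setLIntegral_congr Ioo_ae_eq_Ioc.symm
      _ ≤ ∫⁻ t in Ioo (0 : ℝ) 1, ENNReal.ofReal (m * M) *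
            (ENNReal.ofReal r + (ENNReal.ofReal r)⁻¹ * ‖a t‖ₑ ^ 2) :=
          setLIntegral_mono_ae hRm.aemeasurable hderiv
      _ ≤ ∫⁻ t in Icc (0 : ℝ) 1, ENNReal.ofReal (m * M) *
            (ENNReal.ofReal r + (ENNReal.ofReal r)⁻¹ * ‖a t‖ₑ ^ 2) :=
          lintegral_mono_set Ioo_subset_Icc_self
      _ = ENNReal.ofReal (m * M) * (ENNReal.ofReal r +
            (ENNReal.ofReal r)⁻¹ * ∫⁻ t in Icc (0 : ℝ) 1, ‖a t‖ₑ ^ 2) := by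
          rw [lintegral_const_mul' _ _ ENNReal.ofReal_ne_top, lintegral_add_left measurable_const,
            lintegral_const_mul' _ _ (ENNReal.inv_ne_top.2 (ENNReal.ofReal_pos.2 hr).ne')]
          simp
      _ ≤ ENNReal.ofReal (m * M) * (ENNReal.ofReal r +
            (ENNReal.ofReal r)⁻¹ * ENNReal.ofReal r ^ 2) := by gcongr
      _ = ENNReal.ofReal (2 * m * M * r) := by
          rw [← ENNReal.ofReal_inv_of_pos hr, ← ENNReal.ofReal_pow hr.le,
            ← ENNReal.ofReal_mul (by positivity), ← ENNReal.ofReal_add hr.le (by positivity),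
            ← ENNReal.ofReal_mul (by positivity)]
          congr 1
          field_simp
          ring
  rw [← ofReal_norm, ENNReal.ofReal_le_ofReal_iff (by positivity)] at hle
  exact hle

omit [FiniteDimensional ℝ F] [T2Space G] [LieGroup 𝓘(ℝ, F) ∞ G] in
lemma hasCompactSupport_dirDeriv {E : Type*} [NormedAddCommGroup E] [NormedSpace ℝ E]
    (X : GroupLieAlgebra 𝓘(ℝ, F) G) {f : G → E} (hf : HasCompactSupport f) :
    HasCompactSupport (dirDeriv X f) := by
  refine hf.mono' fun x hx => ?_
  by_contra hxs
  refine hx ?_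
  have : f =ᶠ[𝓝 x] fun _ => 0 := notMem_tsupport_iff_eventuallyEq.1 hxs
  rw [dirDeriv, fieldDeriv, this.mfderiv_eq, mfderiv_const]
  rfl

/-- A bump function equal to `1` at the identity has bounded horizontal derivatives, so over a small
distance it cannot fall to `0`: the ball stays in its compact support. -/
lemma exists_ccBall_subset_isCompact (X : Fin m → GroupLieAlgebra 𝓘(ℝ, F) G) :
    ∃ K : Set G, IsCompact K ∧ ∃ r > 0, ccBall X 1 r ⊆ K := by
  obtain ⟨f⟩ : Nonempty (SmoothBumpFunction 𝓘(ℝ, F) (1 : G)) := inferInstance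
  have hf : ContMDiff 𝓘(ℝ, F) 𝓘(ℝ, ℝ) ∞ f := f.contMDiff
  have hsupp : ∀ i, HasCompactSupport (dirDeriv (X i) f) := fun i =>
    hasCompactSupport_dirDeriv (X i) f.hasCompactSupport
  have hbdd : ∀ i, ∃ C, ∀ x, ‖dirDeriv (X i) f x‖ ≤ C := fun i =>
    (hsupp i).exists_bound_of_continuous (contMDiff_dirDeriv (X i) hf).continuous
  choose C hC using hbdd
  set M : ℝ := ∑ i, |C i| with hM
  have hM0 : 0 ≤ M := Finset.sum_nonneg fun i _ => abs_nonneg _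
  have hCM : ∀ i, C i ≤ M := fun i => (le_abs_self _).trans
    (Finset.single_le_sum (f := fun i => |C i|) (fun j _ => abs_nonneg _) (Finset.mem_univ i))
  refine ⟨tsupport f, f.hasCompactSupport, 1 / (2 * (2 * m * M + 1)), by positivity, fun y hy => ?_⟩
  have h1 := abs_sub_le_of_mem_ccBall X hf hM0 (fun i x => (hC i x).trans (hCM i)) hy
  rw [f.eq_one] at h1
  have h2 : 2 * m * M * (1 / (2 * (2 * m * M + 1))) < |0 - 1| := by
    rw [zero_sub, abs_neg, abs_one]
    rw [mul_one_div, div_lt_one (by positivity)]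
    have : 0 ≤ 2 * m * M := by positivity
    linarith
  refine subset_tsupport _ fun h0 => ?_
  rw [h0] at h1
  exact h2.not_ge h1

end LocalGeometry
end Carnot
end

/-! ### Polar decomposition of vector valued Radon measures. -/

noncomputable section

namespace Carnot

section TotalVariation

variable {G : Type*} [TopologicalSpace G] [MeasurableSpace G] {m : ℕ}

attribute [instance] RadonMeasure.finite_pos RadonMeasure.finite_neg

/-- The sum of the positive and negative parts of all components of a vector valued measure. -/
def dominating (D : Fin m → RadonMeasure G) : Measure G :=
  ∑ i, ((D i).pos + (D i).neg)

lemma pos_le_dominating (D : Fin m → RadonMeasure G) (i : Fin m) : (D i).pos ≤ dominating D :=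
  (Measure.le_add_right le_rfl).trans
    (Finset.single_le_sum (f := fun i => (D i).pos + (D i).neg) (fun _ _ => Measure.zero_le _)
      (Finset.mem_univ i))

lemma neg_le_dominating (D : Fin m → RadonMeasure G) (i : Fin m) : (D i).neg ≤ dominating D :=
  (Measure.le_add_left le_rfl).trans
    (Finset.single_le_sum (f := fun i => (D i).pos + (D i).neg) (fun _ _ => Measure.zero_le _)
      (Finset.mem_univ i))

instance (D : Fin m → RadonMeasure G) : IsFiniteMeasureOnCompacts (dominating D) where
  lt_top_of_isCompact K hK := by
    simp only [dominating, Measure.coe_finsetSum, Finset.sum_apply, Measure.coe_add, Pi.add_apply]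
    exact ENNReal.sum_lt_top.2 fun i _ =>
      ENNReal.add_lt_top.2 ⟨hK.measure_lt_top, hK.measure_lt_top⟩

/-- The density of a vector valued measure with respect to the dominating measure. -/
def density (D : Fin m → RadonMeasure G) (x : G) : EuclideanSpace ℝ (Fin m) :=
  WithLp.toLp 2 fun i => ((D i).pos.rnDeriv (dominating D) x).toReal -
    ((D i).neg.rnDeriv (dominating D) x).toReal

lemma measurable_density (D : Fin m → RadonMeasure G) : Measurable (density D) := by
  unfold density
  refine (WithLp.measurable_toLp 2 _).comp (measurable_pi_lambda _ fun i => ?_)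
  exact ((Measure.measurable_rnDeriv _ _).ennreal_toReal).sub
    ((Measure.measurable_rnDeriv _ _).ennreal_toReal)

/-- Two measures that are comparable on relatively compact sets are comparable. -/
lemma measure_le_of_forall_subset_isCompact [SigmaCompactSpace G] [T2Space G] [BorelSpace G]
    {μ ν : Measure G}
    (h : ∀ B, MeasurableSet B → (∃ K, IsCompact K ∧ B ⊆ K) → μ B ≤ ν B) : μ ≤ ν := by
  refine Measure.le_iff.2 fun s hs => ?_
  have hU : s = ⋃ n, s ∩ compactCovering G n := by
    rw [← inter_iUnion, iUnion_compactCovering, inter_univ]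
  have hmono : Monotone fun n => s ∩ compactCovering G n := fun i j hij =>
    inter_subset_inter_right _ (compactCovering_subset G hij)
  rw [hU, hmono.measure_iUnion]
  refine iSup_le fun n => (h _ (hs.inter (isCompact_compactCovering G n).measurableSet)
    ⟨_, isCompact_compactCovering G n, inter_subset_right⟩).trans ?_
  exact measure_mono (subset_iUnion (fun n => s ∩ compactCovering G n) n)

omit [TopologicalSpace G] in
-- Split a set according to which of the two densities is larger.
lemma withDensity_sup_le {μ ν : Measure G} {f g : G → ℝ≥0∞} (hf : Measurable f)
    (hg : Measurable g) (hfν : μ.withDensity f ≤ ν) (hgν : μ.withDensity g ≤ ν) :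
    μ.withDensity (f ⊔ g) ≤ ν := by
  refine Measure.le_iff.2 fun s hs => ?_
  have ht : MeasurableSet {x | g x ≤ f x} := measurableSet_le hg hf
  rw [withDensity_apply _ hs, ← lintegral_inter_add_sdiff _ s ht, ← measure_inter_add_sdiff s ht]
  refine add_le_add ?_ ?_
  · rw [setLIntegral_congr_fun (f := f ⊔ g) (g := f) (hs.inter ht) (fun x hx => sup_eq_left.2 hx.2),
      ← withDensity_apply _ (hs.inter ht)]
    exact hfν _
  · rw [setLIntegral_congr_fun (f := f ⊔ g) (g := g) (hs.diff ht)
      (fun x hx => sup_eq_right.2 (le_of_not_ge hx.2)), ← withDensity_apply _ (hs.diff ht)]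
    exact hgν _

omit [TopologicalSpace G] in
-- Partial suprema obey the bound by the binary case, and increase to the full supremum: monotone
-- convergence.
lemma withDensity_iSup_le {μ ν : Measure G} {f : ℕ → G → ℝ≥0∞} (hf : ∀ n, Measurable (f n))
    (h : ∀ n, μ.withDensity (f n) ≤ ν) : μ.withDensity (fun x => ⨆ n, f n x) ≤ ν := by
  have hm : ∀ n, Measurable (partialSups f n) := by
    intro n
    induction n with
    | zero => simpa using hf 0
    | succ n ih => rw [partialSups_add_one]; exact ih.sup (hf _)
  have hle : ∀ n, μ.withDensity (partialSups f n) ≤ ν := by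
    intro n
    induction n with
    | zero => simpa using h 0
    | succ n ih => rw [partialSups_add_one]; exact withDensity_sup_le (hm n) (hf _) ih (h _)
  refine Measure.le_iff.2 fun s hs => ?_
  have e : (fun x => ⨆ n, f n x) = fun x => ⨆ n, partialSups f n x := by
    funext x
    have := congrFun (iSup_partialSups_eq f) x
    simp only [iSup_apply] at this
    exact this.symm
  rw [withDensity_apply _ hs, e, lintegral_iSup hm (partialSups f).monotone]
  refine iSup_le fun n => ?_
  rw [← withDensity_apply _ hs]
  exact hle n s

/-- Normalise a dense sequence. With the norm a countable supremum of linear functionals, minimality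
of `|D|` reduces to scalar measures. -/
lemma exists_seq_iSup_inner (H : Type*) [NormedAddCommGroup H] [InnerProductSpace ℝ H]
    [TopologicalSpace.SeparableSpace H] :
    ∃ c : ℕ → H, (∀ n, ‖c n‖ ≤ 1) ∧
      ∀ v, ‖v‖ₑ = ⨆ n, ENNReal.ofReal (inner ℝ (c n) v) := by
  let d := TopologicalSpace.denseSeq H
  have hc1 : ∀ n, ‖(‖d n‖⁻¹ • d n : H)‖ ≤ 1 := fun n => by
    rw [norm_smul, norm_inv, norm_norm]
    exact inv_mul_le_one
  -- A zero term of the dense sequence is sent to `0`, by the convention `0⁻¹ = 0`, and does no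
  -- harm.
  refine ⟨fun n => ‖d n‖⁻¹ • d n, hc1, fun v => le_antisymm ?_ (iSup_le fun n => ?_)⟩
  · refine ENNReal.le_of_forall_pos_le_add fun ε hε _ => ?_
    obtain ⟨n, hn⟩ := (TopologicalSpace.denseRange_denseSeq H).exists_dist_lt v
      (show (0 : ℝ) < ε / 2 by positivity)
    have hn' : ‖v - d n‖ < ε / 2 := by rwa [← dist_eq_norm]
    have key : ‖v‖ ≤ inner ℝ (‖d n‖⁻¹ • d n : H) v + ε := by
      have h1 : inner ℝ (‖d n‖⁻¹ • d n : H) (d n) = ‖d n‖ := by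
        rw [real_inner_smul_left, real_inner_self_eq_norm_sq]
        rcases eq_or_ne ‖d n‖ 0 with h0 | h0
        · rw [h0]; simp
        · field_simp
      have h2 : |inner ℝ (‖d n‖⁻¹ • d n : H) (v - d n)| ≤ 1 * ‖v - d n‖ :=
        (abs_real_inner_le_norm _ _).trans (by gcongr; exact hc1 n)
      rw [inner_sub_right, h1] at h2
      have h3 := abs_le.1 h2
      have h4 := norm_le_norm_add_norm_sub' v (d n)
      linarith [h3.1]
    rw [← ofReal_norm]
    calc ENNReal.ofReal ‖v‖ ≤ ENNReal.ofReal (inner ℝ (‖d n‖⁻¹ • d n : H) v + ε) :=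
          ENNReal.ofReal_le_ofReal key
      _ ≤ ENNReal.ofReal (inner ℝ (‖d n‖⁻¹ • d n : H) v) + ENNReal.ofReal ε :=
          ENNReal.ofReal_add_le
      _ ≤ _ := by
          rw [ENNReal.ofReal_coe_nnreal]
          gcongr
          exact le_iSup (fun n => ENNReal.ofReal (inner ℝ (‖d n‖⁻¹ • d n : H) v)) n
  · rw [← ofReal_norm]
    refine ENNReal.ofReal_le_ofReal ((real_inner_le_norm _ _).trans ?_)
    simpa using mul_le_mul_of_nonneg_right (hc1 n) (norm_nonneg v)

variable [T2Space G] [BorelSpace G] [SecondCountableTopology G] [LocallyCompactSpace G]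

omit [T2Space G] [BorelSpace G] [SecondCountableTopology G] [LocallyCompactSpace G] in
lemma integrableOn_density (D : Fin m → RadonMeasure G) {B K : Set G} (hK : IsCompact K)
    (hB : B ⊆ K) (i : Fin m) :
    IntegrableOn (fun x => density D x i) B (dominating D) := by
  refine Integrable.sub ?_ ?_
  · exact Measure.integrableOn_toReal_rnDeriv
      ((measure_mono hB).trans_lt hK.measure_lt_top).ne
  · exact Measure.integrableOn_toReal_rnDeriv
      ((measure_mono hB).trans_lt hK.measure_lt_top).ne

omit [T2Space G] [BorelSpace G] in
lemma vectorApply_eq_integral (D : Fin m → RadonMeasure G) {B K : Set G} (hK : IsCompact K)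
    (hB : B ⊆ K) : vectorApply D B = ∫ x in B, density D x ∂(dominating D) := by
  ext i
  rw [eval_integral_piLp (fun i => integrableOn_density D hK hB i)]
  have h1 : B ⊆ K := hB
  simp only [density]
  rw [integral_sub, Measure.setIntegral_toReal_rnDeriv
      (Measure.absolutelyContinuous_of_le (pos_le_dominating D i)),
    Measure.setIntegral_toReal_rnDeriv
      (Measure.absolutelyContinuous_of_le (neg_le_dominating D i))]
  · rfl
  · exact Measure.integrableOn_toReal_rnDeriv
      ((measure_mono hB).trans_lt hK.measure_lt_top).ne
  · exact Measure.integrableOn_toReal_rnDeriv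
      ((measure_mono hB).trans_lt hK.measure_lt_top).ne

omit [T2Space G] [BorelSpace G] in
lemma inner_vectorApply (D : Fin m → RadonMeasure G) {B K : Set G} (hK : IsCompact K)
    (hB : B ⊆ K) (c : EuclideanSpace ℝ (Fin m)) :
    inner ℝ c (vectorApply D B) = ∫ x in B, inner ℝ c (density D x) ∂(dominating D) := by
  rw [vectorApply_eq_integral D hK hB, integral_inner]
  exact Integrable.of_eval_piLp fun i => integrableOn_density D hK hB i

/-- Polar decomposition: the total variation has density `|density D|`. -/
lemma totalVariation_eq (D : Fin m → RadonMeasure G) :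
    totalVariation D = (dominating D).withDensity fun x => ‖density D x‖ₑ := by
  refine IsGLB.sInf_eq (IsLeast.isGLB ⟨?_, ?_⟩)
  · rintro B hB ⟨K, hK, hBK⟩
    rw [withDensity_apply _ hB, vectorApply_eq_integral D hK hBK]
    exact enorm_integral_le_lintegral_enorm _
  · intro ν hν
    obtain ⟨c, hc1, hc⟩ := exists_seq_iSup_inner (EuclideanSpace ℝ (Fin m))
    simp only [hc]
    have hcm : ∀ n, Measurable fun x => inner ℝ (c n) (density D x) := fun n =>
      measurable_const.inner (measurable_density D)
    refine withDensity_iSup_le (fun n => (hcm n).ennreal_ofReal) fun n => ?_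
    refine measure_le_of_forall_subset_isCompact ?_
    rintro B hB ⟨K, hK, hBK⟩
    have ht : MeasurableSet {x | 0 ≤ inner ℝ (c n) (density D x)} :=
      measurableSet_le measurable_const (hcm n)
    -- Outside `B'` the positive part of the functional vanishes. On `B'` its integral is `⟨c n,
    -- D(B')⟩`, at most `|D(B')|`, which the competitor `ν` dominates.
    set B' := B ∩ {x | 0 ≤ inner ℝ (c n) (density D x)} with hB'
    have hB'm : MeasurableSet B' := hB.inter ht
    have hB'K : B' ⊆ K := inter_subset_left.trans hBK
    have hint : IntegrableOn (fun x => inner ℝ (c n) (density D x)) B' (dominating D) :=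
      Integrable.const_inner (c n)
        (Integrable.of_eval_piLp fun i => integrableOn_density D hK hB'K i)
    have e : ∫⁻ x in B \ {x | 0 ≤ inner ℝ (c n) (density D x)},
        ENNReal.ofReal (inner ℝ (c n) (density D x)) ∂(dominating D) = 0 := by
      rw [setLIntegral_congr_fun (g := fun _ => 0) (hB.diff ht)
        (fun x hx => ENNReal.ofReal_of_nonpos (le_of_not_ge hx.2))]
      simp
    rw [withDensity_apply _ hB, ← lintegral_inter_add_sdiff _ B ht, e, add_zero, ← hB',
      ← ofReal_integral_eq_lintegral_ofReal hint
        ((ae_restrict_iff' hB'm).2 (Eventually.of_forall fun x hx => hx.2)),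
      ← inner_vectorApply D hK hB'K]
    calc ENNReal.ofReal (inner ℝ (c n) (vectorApply D B'))
        ≤ ENNReal.ofReal ‖vectorApply D B'‖ := by
          refine ENNReal.ofReal_le_ofReal ((real_inner_le_norm _ _).trans ?_)
          simpa using mul_le_mul_of_nonneg_right (hc1 n) (norm_nonneg (vectorApply D B'))
      _ = ‖vectorApply D B'‖ₑ := ofReal_norm _
      _ ≤ ν B' := hν B' hB'm ⟨K, hK, hB'K⟩
      _ ≤ ν B := measure_mono inter_subset_left

instance (D : Fin m → RadonMeasure G) : IsFiniteMeasureOnCompacts (totalVariation D) where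
  lt_top_of_isCompact K hK := by
    rw [totalVariation_eq, withDensity_apply _ hK.measurableSet]
    exact (Integrable.of_eval_piLp fun i => integrableOn_density D hK subset_rfl i).2

/-- The defect `|D| - ⟨D, ξ⟩`, a nonnegative measure if `|ξ| ≤ 1`. -/
def defect (D : Fin m → RadonMeasure G) (ξ : EuclideanSpace ℝ (Fin m)) : Measure G :=
  (dominating D).withDensity fun x => ENNReal.ofReal (‖density D x‖ - inner ℝ ξ (density D x))

lemma defect_apply (D : Fin m → RadonMeasure G) {ξ : EuclideanSpace ℝ (Fin m)} (hξ : ‖ξ‖ = 1)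
    {B K : Set G} (hBm : MeasurableSet B) (hK : IsCompact K) (hB : B ⊆ K) :
    defect D ξ B = ENNReal.ofReal ((totalVariation D B).toReal - inner ℝ ξ (vectorApply D B)) := by
  have hd : Integrable (density D) ((dominating D).restrict B) :=
    Integrable.of_eval_piLp fun i => integrableOn_density D hK hB i
  have h1 : (totalVariation D B).toReal = ∫ x in B, ‖density D x‖ ∂(dominating D) := by
    rw [integral_norm_eq_lintegral_enorm hd.1, totalVariation_eq, withDensity_apply _ hBm]
  rw [h1, inner_vectorApply D hK hB, ← integral_sub hd.norm (hd.const_inner ξ), defect,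
    withDensity_apply _ hBm, ofReal_integral_eq_lintegral_ofReal
      (f := fun x => ‖density D x‖ - inner ℝ ξ (density D x)) (hd.norm.sub (hd.const_inner ξ))]
  refine Eventually.of_forall fun x => sub_nonneg.2 ((real_inner_le_norm _ _).trans ?_)
  rw [hξ, one_mul]

lemma defect_absolutelyContinuous (D : Fin m → RadonMeasure G) (ξ : EuclideanSpace ℝ (Fin m)) :
    defect D ξ ≪ totalVariation D := by
  rw [defect, totalVariation_eq]
  refine Measure.AbsolutelyContinuous.mk fun s hs h => ?_
  have hm : Measurable fun x => ‖density D x‖ₑ := (measurable_density D).enorm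
  rw [withDensity_apply _ hs, lintegral_eq_zero_iff hm] at h
  rw [withDensity_apply _ hs]
  refine (lintegral_congr_ae ?_).trans lintegral_zero
  filter_upwards [h] with x hx
  have : density D x = 0 := by simpa using hx
  simp [this]

omit [T2Space G] [BorelSpace G] [SecondCountableTopology G] [LocallyCompactSpace G] in
-- A zero defect means equality almost everywhere in `⟨ξ, density⟩ ≤ |density|`; the equality case
-- of Cauchy-Schwarz gives the direction.
lemma density_eq_of_defect_eq_zero (D : Fin m → RadonMeasure G) {ξ : EuclideanSpace ℝ (Fin m)}
    (hξ : ‖ξ‖ = 1) (h : defect D ξ = 0) :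
    ∀ᵐ x ∂(dominating D), density D x = ‖density D x‖ • ξ := by
  have hm : Measurable fun x =>
      ENNReal.ofReal (‖density D x‖ - inner ℝ ξ (density D x)) :=
    ((measurable_density D).norm.sub (measurable_const.inner (measurable_density D))).ennreal_ofReal
  rw [defect, withDensity_eq_zero_iff hm.aemeasurable] at h
  filter_upwards [h] with x hx
  have h1 : ‖density D x‖ ≤ inner ℝ ξ (density D x) := by
    simpa [sub_nonpos] using hx
  have h2 : inner ℝ ξ (density D x) = ‖ξ‖ * ‖density D x‖ := by
    refine le_antisymm (real_inner_le_norm _ _) ?_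
    rwa [hξ, one_mul]
  have := inner_eq_norm_mul_iff_real.1 h2
  rw [hξ, one_smul] at this
  exact this.symm

omit [T2Space G] in
lemma RadonMeasure.integral_eq_density (D : Fin m → RadonMeasure G) {v : G → ℝ}
    (hv : Continuous v) (hc : HasCompactSupport v) (i : Fin m) :
    (D i).integral v = ∫ x, density D x i * v x ∂(dominating D) := by
  have hp := Measure.absolutelyContinuous_of_le (pos_le_dominating D i)
  have hn := Measure.absolutelyContinuous_of_le (neg_le_dominating D i)
  rw [RadonMeasure.integral, ← integral_rnDeriv_smul hp, ← integral_rnDeriv_smul hn,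
    ← integral_sub]
  · simp only [density, smul_eq_mul, sub_mul]
  · exact (integrable_rnDeriv_smul_iff hp).2 (hv.integrable_of_hasCompactSupport hc)
  · exact (integrable_rnDeriv_smul_iff hn).2 (hv.integrable_of_hasCompactSupport hc)

lemma integral_eq_of_defect_eq_zero (D : Fin m → RadonMeasure G) {ξ : EuclideanSpace ℝ (Fin m)}
    (hξ : ‖ξ‖ = 1) (h : defect D ξ = 0) {v : G → ℝ} (hv : Continuous v)
    (hc : HasCompactSupport v) (i : Fin m) :
    (D i).integral v = ξ i * ∫ x, v x ∂(totalVariation D) := by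
  rw [RadonMeasure.integral_eq_density D hv hc, totalVariation_eq,
    integral_withDensity_eq_integral_toReal_smul (measurable_density D).enorm
      (Eventually.of_forall fun x => enorm_lt_top), ← integral_const_mul]
  refine integral_congr_ae ?_
  filter_upwards [density_eq_of_defect_eq_zero D hξ h] with x hx
  have := congrArg (fun w : EuclideanSpace ℝ (Fin m) => w i) hx
  simp only [PiLp.smul_apply, smul_eq_mul] at this
  rw [this, toReal_enorm, smul_eq_mul]
  ring

end TotalVariation
end Carnot
end

/-! ### Differentiation of measures along balls, without doubling. -/

noncomputable section

namespace Carnot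

section Differentiation

/-- Volume comparison: the balls of radius `ε` about the points are disjoint and lie in the ball of
radius `R + ε`. -/
lemma card_mul_pow_le_of_separated {F : Type*} [NormedAddCommGroup F] [NormedSpace ℝ F]
    [FiniteDimensional ℝ F] {ι : Type*} (t : Finset ι) (p : ι → F) {R ε : ℝ} (hR : 0 ≤ R)
    (hε : 0 < ε) (hp : ∀ i ∈ t, ‖p i‖ ≤ R)
    (hsep : ∀ i ∈ t, ∀ j ∈ t, i ≠ j → 2 * ε < ‖p i - p j‖) :
    t.card * ε ^ Module.finrank ℝ F ≤ (R + ε) ^ Module.finrank ℝ F := by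
  let _ : MeasurableSpace F := borel F
  have : BorelSpace F := ⟨rfl⟩
  let μ : Measure F := (Module.finBasis ℝ F).addHaar
  set n := Module.finrank ℝ F
  have h1 : μ (⋃ i ∈ t, Metric.ball (p i) ε) = ∑ i ∈ t, μ (Metric.ball (p i) ε) := by
    refine measure_biUnion_finset (fun i hi j hj hij => ?_)
      fun i _ => Metric.isOpen_ball.measurableSet
    refine Metric.ball_disjoint_ball ?_
    rw [dist_eq_norm]
    linarith [hsep i hi j hj hij]
  have h2 : (⋃ i ∈ t, Metric.ball (p i) ε) ⊆ Metric.ball 0 (R + ε) := by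
    refine iUnion₂_subset fun i hi => Metric.ball_subset_ball' ?_
    rw [dist_zero_right]
    linarith [hp i hi]
  have h3 := measure_mono (μ := μ) h2
  have h4 : ∀ i ∈ t, μ (Metric.ball (p i) ε) =
      ENNReal.ofReal (ε ^ n) * μ (Metric.ball 0 1) := fun i _ =>
    Measure.addHaar_ball_of_pos μ (p i) hε
  rw [h1, Finset.sum_congr rfl h4,
    Measure.addHaar_ball_of_pos μ 0 (add_pos_of_nonneg_of_pos hR hε), Finset.sum_const,
    nsmul_eq_mul,
    ← mul_assoc, ENNReal.mul_le_mul_iff_left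
      (Metric.measure_ball_pos μ 0 one_pos).ne' measure_ball_lt_top.ne,
    ← ENNReal.ofReal_natCast, ← ENNReal.ofReal_mul (by positivity)] at h3
  exact (ENNReal.ofReal_le_ofReal_iff (by positivity)).1 h3

variable {G : Type*} [TopologicalSpace G]

/-- A family of sets with the properties of the open balls of a distance. -/
structure IsBallFamily (B : G → ℝ → Set G) : Prop where
  isOpen : ∀ x r, IsOpen (B x r)
  mem_self : ∀ x r, 0 < r → x ∈ B x r
  mono : ∀ x r s, r ≤ s → B x r ⊆ B x s
  symm : ∀ x y r, y ∈ B x r → x ∈ B y r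
  trans : ∀ x y z r s, y ∈ B x r → z ∈ B y s → z ∈ B x (r + s)

variable [MeasurableSpace G] {B : G → ℝ → Set G}

omit [TopologicalSpace G] in
lemma pow_mul_measure_le_of_forall_mul_measure_le {τ : Measure G} {Λ : ℝ≥0∞} {x : G} {r₀ : ℝ}
    (hr₀ : 0 < r₀) (h : ∀ r, 0 < r → r ≤ r₀ → Λ * τ (B x r) ≤ τ (B x (3 * r))) (k : ℕ) :
    Λ ^ k * τ (B x (r₀ / 3 ^ k)) ≤ τ (B x r₀) := by
  induction k with
  | zero => simp
  | succ k ih =>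
    have h1 := h (r₀ / 3 ^ (k + 1)) (by positivity)
      (div_le_self hr₀.le (one_le_pow₀ (by norm_num)))
    rw [show 3 * (r₀ / 3 ^ (k + 1)) = r₀ / 3 ^ k by field_simp; ring] at h1
    calc Λ ^ (k + 1) * τ (B x (r₀ / 3 ^ (k + 1)))
        = Λ ^ k * (Λ * τ (B x (r₀ / 3 ^ (k + 1)))) := by rw [pow_succ, mul_assoc]
      _ ≤ Λ ^ k * τ (B x (r₀ / 3 ^ k)) := by gcongr
      _ ≤ _ := ih

omit [MeasurableSpace G] in
lemma IsBallFamily.mem_of_nonempty_inter (hB : IsBallFamily B) {x y : G} {r s : ℝ}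
    (h : (B x r ∩ B y s).Nonempty) : x ∈ B y (s + r) := by
  obtain ⟨z, hzx, hzy⟩ := h
  exact hB.trans y z x s r hzy (hB.symm x z r hzx)

/-- The balls of the family contain the chart balls of radius `c r ^ 2`, near a point. -/
structure IsChartOn {F : Type*} [NormedAddCommGroup F] (B : G → ℝ → Set G) (ψ : G → F)
    (U : Set G) (c ρ R : ℝ) : Prop where
  c_pos : 0 < c
  ρ_pos : 0 < ρ
  R_nonneg : 0 ≤ R
  norm_le : ∀ x ∈ U, ‖ψ x‖ ≤ R
  mem_ball : ∀ x ∈ U, ∀ y ∈ U, ∀ r, 0 < r → r ≤ ρ → ‖ψ x - ψ y‖ ≤ c * r ^ 2 → y ∈ B x r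

omit [MeasurableSpace G] in
-- Centres of disjoint balls of radius `s` are more than `c s²` apart in the chart; otherwise one
-- ball would contain the centre of another.
lemma IsChartOn.card_mul_pow_le {F : Type*} [NormedAddCommGroup F] [NormedSpace ℝ F]
    [FiniteDimensional ℝ F] {ψ : G → F} {U : Set G} {c ρ R : ℝ} (h : IsChartOn B ψ U c ρ R)
    (hB : IsBallFamily B) {s : ℝ} (hs : 0 < s) (hsρ : s ≤ ρ) (t : Finset G) (htU : ↑t ⊆ U)
    (hd : (t : Set G).PairwiseDisjoint fun a => B a s) :
    t.card * (c * s ^ 2 / 2) ^ Module.finrank ℝ F ≤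
      (R + c * s ^ 2 / 2) ^ Module.finrank ℝ F := by
  have hc := h.c_pos
  refine card_mul_pow_le_of_separated t ψ h.R_nonneg (by positivity)
    (fun x hx => h.norm_le x (htU hx)) fun x hx y hy hxy => ?_
  by_contra! hle
  have h1 : y ∈ B x s := h.mem_ball x (htU hx) y (htU hy) s hs hsρ (by linarith)
  exact disjoint_left.1 (hd hx hy hxy) h1 (hB.mem_self y s hs)

omit [MeasurableSpace G] in
-- Doubling the radii of a disjoint subfamily meeting every ball gives a cover; the bound on
-- disjoint families makes it finite.
lemma exists_finset_cover (hB : IsBallFamily B) (A : Set G) {s : ℝ} (hs : 0 < s) {N : ℕ}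
    (hN : ∀ t : Finset G, ↑t ⊆ A → (t : Set G).PairwiseDisjoint (fun a => B a s) → t.card ≤ N) :
    ∃ t : Finset G, ↑t ⊆ A ∧ t.card ≤ N ∧ A ⊆ ⋃ b ∈ t, B b (2 * s) := by
  obtain ⟨u, huA, hud, hu⟩ := Vitali.exists_disjoint_subfamily_covering_enlargement
    (fun a => B a s) A (fun _ => s) 2 one_lt_two (fun _ _ => hs.le) s (fun _ _ => le_rfl)
    (fun a _ => ⟨a, hB.mem_self a s hs⟩)
  have hfin : u.Finite := by
    by_contra hinf
    obtain ⟨t, htu, ht⟩ := Set.Infinite.exists_subset_card_eq hinf (N + 1)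
    have := hN t (htu.trans huA) (hud.subset htu)
    omega
  refine ⟨hfin.toFinset, by simpa using huA, hN _ (by simpa using huA) (by simpa using hud),
    fun a ha => ?_⟩
  obtain ⟨b, hb, hab, -⟩ := hu a ha
  simp only [mem_iUnion]
  refine ⟨b, by simpa using hb, ?_⟩
  rw [two_mul]
  exact hB.mem_of_nonempty_inter hab

/-- At scale `s = r₀ / 3 ^ k` the set is covered by at most `q ^ n * 9 ^ (n * k)` balls, where `9 =
3²` reflects the quadratic size of chart balls. Iterating the growth hypothesis, each has measure at
most `M / (3 * 9 ^ n) ^ k`. The sum is `q ^ n * M / 3 ^ k`, which tends to zero; the spare factor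
`3` in the hypothesis is what wins. -/
lemma IsChartOn.measure_eq_zero {F : Type*} [NormedAddCommGroup F] [NormedSpace ℝ F]
    [FiniteDimensional ℝ F] {ψ : G → F} {U : Set G} {c ρ R : ℝ} (h : IsChartOn B ψ U c ρ R)
    (hB : IsBallFamily B) {τ : Measure G} {M : ℝ≥0∞} (hM : M ≠ ⊤) {r₀ : ℝ} (hr₀ : 0 < r₀)
    (hr₀ρ : r₀ ≤ ρ) (hτ : ∀ x ∈ U, τ (B x r₀) ≤ M) {A : Set G} (hAU : A ⊆ U)
    (hA : ∀ x ∈ A, ∀ r, 0 < r → r ≤ r₀ →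
      (3 * 9 ^ Module.finrank ℝ F : ℝ≥0∞) * τ (B x r) ≤ τ (B x (3 * r))) :
    τ A = 0 := by
  set n := Module.finrank ℝ F
  have hc := h.c_pos
  have hR := h.R_nonneg
  -- The packing ratio at radius `s / 2` is `1 + 8 R / (c s²) = 1 + 8 R / (c r₀²) * 9 ^ k`, at most
  -- `q * 9 ^ k`.
  set q : ℝ := 1 + 8 * R / (c * r₀ ^ 2) with hq
  have hq0 : 0 ≤ q := by positivity
  have key : ∀ k : ℕ, (k : ℝ≥0∞) * τ A ≤ ENNReal.ofReal (q ^ n) * M := by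
    intro k
    set s : ℝ := r₀ / 3 ^ k with hs
    have hs0 : 0 < s := by positivity
    have hsr : s ≤ r₀ := div_le_self hr₀.le (one_le_pow₀ (by norm_num))
    have hcard : ∀ t : Finset G, ↑t ⊆ A → (t : Set G).PairwiseDisjoint (fun a => B a (s / 2)) →
        (t.card : ℝ) ≤ q ^ n * 9 ^ (n * k) := by
      intro t ht hd
      have h1 := h.card_mul_pow_le hB (half_pos hs0) ((half_le_self hs0.le).trans (hsr.trans hr₀ρ))
        t (ht.trans hAU) hd
      rw [← le_div_iff₀ (by positivity), ← div_pow] at h1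
      refine h1.trans ?_
      rw [mul_comm n k, pow_mul, ← mul_pow]
      refine pow_le_pow_left₀ (by positivity) ?_ n
      have h9 : (9 : ℝ) ^ k = (3 ^ k) ^ 2 := by rw [← pow_mul, mul_comm, pow_mul]; norm_num
      have h2 : (R + c * (s / 2) ^ 2 / 2) / (c * (s / 2) ^ 2 / 2) =
          1 + 8 * R / (c * r₀ ^ 2) * 9 ^ k := by
        rw [hs, h9]; field_simp; ring
      rw [h2, hq, add_mul, one_mul]
      gcongr
      exact one_le_pow₀ (by norm_num)
    obtain ⟨t, htA, htN, hcov⟩ := exists_finset_cover hB A (half_pos hs0)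
      (N := ⌊q ^ n * 9 ^ (n * k)⌋₊) fun t ht hd => Nat.le_floor (hcard t ht hd)
    rw [Nat.le_floor_iff (by positivity)] at htN
    rw [mul_div_cancel₀ s two_ne_zero] at hcov
    have h9 : (9 ^ n : ℝ≥0∞) ^ k = ENNReal.ofReal (9 ^ (n * k)) := by
      rw [← pow_mul, ENNReal.ofReal_pow (by norm_num)]; norm_num
    have h1 : (3 * 9 ^ n : ℝ≥0∞) ^ k * τ A ≤ ENNReal.ofReal (q ^ n * 9 ^ (n * k)) * M := by
      calc (3 * 9 ^ n : ℝ≥0∞) ^ k * τ A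
          ≤ (3 * 9 ^ n : ℝ≥0∞) ^ k * ∑ b ∈ t, τ (B b s) := by
            gcongr
            exact (measure_mono hcov).trans (measure_biUnion_finset_le _ _)
        _ = ∑ b ∈ t, (3 * 9 ^ n : ℝ≥0∞) ^ k * τ (B b s) := by rw [Finset.mul_sum]
        _ ≤ ∑ _b ∈ t, M := Finset.sum_le_sum fun b hb =>
            (pow_mul_measure_le_of_forall_mul_measure_le hr₀ (hA b (htA hb)) k).trans
              (hτ b (hAU (htA hb)))
        _ = t.card * M := by rw [Finset.sum_const, nsmul_eq_mul]
        _ ≤ _ := by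
            gcongr
            rw [← ENNReal.ofReal_natCast]
            exact ENNReal.ofReal_le_ofReal htN
    rw [mul_pow, h9, ENNReal.ofReal_mul (by positivity), mul_right_comm,
      mul_right_comm (_ : ℝ≥0∞) _ M,
      ENNReal.mul_le_mul_iff_left (by simp) ENNReal.ofReal_ne_top] at h1
    -- After cancelling `9 ^ (n * k)` the factor on the left is `3 ^ k`; the weaker factor `k` is
    -- enough, being unbounded.
    refine le_trans ?_ h1
    gcongr
    exact_mod_cast (Nat.lt_pow_self (by norm_num : 1 < 3)).le
  by_contra h0
  obtain ⟨k, hk⟩ := ENNReal.exists_nat_mul_gt h0 (ENNReal.mul_ne_top ENNReal.ofReal_ne_top hM)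
  exact hk.not_ge (key k)

/-- Around each point choose a doubling radius `s` so small that `ρ` of the ball of radius `3 s` is
at most `ε` times its `τ` measure. A Vitali family of disjoint balls of radius `s`, tripled, covers
`S`; doubling brings the `τ` measure back to the disjoint balls inside `K`. -/
lemma IsBallFamily.measure_eq_zero [BorelSpace G] [SecondCountableTopology G]
    (hB : IsBallFamily B) {τ ρ : Measure G} {Λ : ℝ≥0∞} (hΛ : Λ ≠ ⊤) {S K : Set G} {r₀ : ℝ}
    (hr₀ : 0 < r₀) (hK : τ K ≠ ⊤) (hSK : ∀ x ∈ S, B x r₀ ⊆ K)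
    (hdoub : ∀ x ∈ S, ∀ r > 0, ∃ s, 0 < s ∧ s ≤ r ∧ τ (B x (3 * s)) ≤ Λ * τ (B x s))
    (hdiff : ∀ x ∈ S, ∀ ε : ℝ≥0∞, ε ≠ 0 → ∃ r > 0, ∀ s, 0 < s → s ≤ r →
      ρ (B x s) ≤ ε * τ (B x s)) :
    ρ S = 0 := by
  have key : ∀ ε : ℝ≥0∞, ε ≠ 0 → ρ S ≤ ε * (Λ * τ K) := by
    intro ε hε
    have h1 : ∀ x ∈ S, ∃ s, 0 < s ∧ s ≤ r₀ ∧ ρ (B x (3 * s)) ≤ ε * (Λ * τ (B x s)) := by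
      intro x hx
      obtain ⟨r, hr, hr'⟩ := hdiff x hx ε hε
      obtain ⟨s, hs, hsr, hs'⟩ := hdoub x hx (min r₀ (r / 3)) (by positivity)
      refine ⟨s, hs, hsr.trans (min_le_left _ _), (hr' (3 * s) (by positivity) ?_).trans ?_⟩
      · linarith [hsr.trans (min_le_right _ _)]
      · gcongr
    choose! s hs hsr hρ using h1
    obtain ⟨u, huS, hud, hu⟩ := Vitali.exists_disjoint_subfamily_covering_enlargement
      (fun a => B a (s a)) S s 2 one_lt_two (fun a ha => (hs a ha).le) r₀ hsr
      (fun a ha => ⟨a, hB.mem_self a _ (hs a ha)⟩)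
    have huc : u.Countable := hud.countable_of_isOpen (fun a _ => hB.isOpen _ _)
      (fun a ha => ⟨a, hB.mem_self a _ (hs a (huS ha))⟩)
    have hcov : S ⊆ ⋃ b ∈ u, B b (3 * s b) := by
      intro a ha
      obtain ⟨b, hb, hab, hab'⟩ := hu a ha
      exact mem_biUnion hb (hB.mono b _ _ (by linarith) (hB.mem_of_nonempty_inter hab))
    have : Countable u := huc.to_subtype
    calc ρ S ≤ ρ (⋃ b ∈ u, B b (3 * s b)) := measure_mono hcov
      _ ≤ ∑' b : u, ρ (B b (3 * s b)) := measure_biUnion_le _ huc _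
      _ ≤ ∑' b : u, ε * (Λ * τ (B b (s b))) := ENNReal.tsum_le_tsum fun b => hρ b (huS b.2)
      _ = ε * (Λ * ∑' b : u, τ (B b (s b))) := by
        rw [ENNReal.tsum_mul_left, ENNReal.tsum_mul_left]
      _ ≤ ε * (Λ * τ K) := by
        gcongr
        refine (tsum_meas_le_meas_iUnion_of_disjoint τ
          (fun b => (hB.isOpen _ _).measurableSet) ?_).trans
          (measure_mono (iUnion_subset fun b =>
            (hB.mono _ _ _ (hsr b (huS b.2))).trans (hSK b (huS b.2))))
        exact fun a b hab => hud a.2 b.2 (Subtype.coe_injective.ne hab)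
  by_contra h0
  obtain ⟨k, hk⟩ := ENNReal.exists_nat_mul_gt h0 (ENNReal.mul_ne_top hΛ hK)
  have hk0 : (k : ℝ≥0∞) ≠ 0 := by rintro h; simp [h] at hk
  refine hk.not_ge ?_
  calc (k : ℝ≥0∞) * ρ S ≤ k * ((k : ℝ≥0∞)⁻¹ * (Λ * τ K)) := by
        gcongr; exact key _ (by simp)
    _ = Λ * τ K := by
        rw [← mul_assoc, ENNReal.mul_inv_cancel hk0 (ENNReal.natCast_ne_top k), one_mul]

/-- A measure whose density with respect to `τ`, computed along the balls of the family, vanishes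
`τ`-almost everywhere is zero. The measure `τ` is not assumed to be doubling. -/
theorem IsBallFamily.eq_zero_of_density_eq_zero {F : Type*} [NormedAddCommGroup F]
    [NormedSpace ℝ F] [FiniteDimensional ℝ F] [BorelSpace G] [SecondCountableTopology G]
    (hB : IsBallFamily B) {τ ρ : Measure G} [IsFiniteMeasureOnCompacts τ]
    (hchart : ∀ x₀, ∃ ψ : G → F, ∃ U ∈ 𝓝 x₀, ∃ c r R, IsChartOn B ψ U c r R)
    (hcpt : ∀ x₀, ∃ U ∈ 𝓝 x₀, ∃ K, IsCompact K ∧ ∃ r > 0, ∀ x ∈ U, B x r ⊆ K)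
    (hac : ρ ≪ τ)
    (hdiff : ∀ᵐ x ∂τ, ∀ ε : ℝ≥0∞, ε ≠ 0 → ∃ r > 0, ∀ s, 0 < s → s ≤ r →
      ρ (B x s) ≤ ε * τ (B x s)) :
    ρ = 0 := by
  rw [← Measure.measure_univ_eq_zero]
  refine measure_null_of_locally_null _ fun x₀ _ => ?_
  obtain ⟨ψ, U₁, hU₁, c, r₁, R, hψ⟩ := hchart x₀
  obtain ⟨U₂, hU₂, K, hK, r₂, hr₂, hUK⟩ := hcpt x₀
  refine ⟨U₁ ∩ U₂, by rw [nhdsWithin_univ]; exact inter_mem hU₁ hU₂, ?_⟩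
  set Λ : ℝ≥0∞ := 3 * 9 ^ Module.finrank ℝ F with hΛ
  have hΛt : Λ ≠ ⊤ := by
    rw [hΛ]; exact ENNReal.mul_ne_top (by norm_num) (ENNReal.pow_ne_top (by norm_num))
  set D : Set G := {x | ∀ ε : ℝ≥0∞, ε ≠ 0 → ∃ r > 0, ∀ s, 0 < s → s ≤ r →
      ρ (B x s) ≤ ε * τ (B x s)} with hD
  let d : ℕ → ℝ := fun j => min (min r₁ r₂) (1 / (j + 1))
  have hd : ∀ j, 0 < d j := fun j => lt_min (lt_min hψ.ρ_pos hr₂) Nat.one_div_pos_of_nat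
  -- The points where doubling fails at every scale below `d j`. Each such set is null by the
  -- counting argument; a point outside all of them has arbitrarily small doubling radii, as the `d
  -- j` are at most `1 / (j + 1)`.
  let bad : ℕ → Set G := fun j => {x ∈ U₁ ∩ U₂ | ∀ r, 0 < r → r ≤ d j →
    Λ * τ (B x r) ≤ τ (B x (3 * r))}
  have hbad : ∀ j, ρ (bad j) = 0 := by
    intro j
    have hψ' : IsChartOn B ψ (U₁ ∩ U₂) c r₁ R := ⟨hψ.1, hψ.2, hψ.3, fun x hx => hψ.4 x hx.1,
      fun x hx y hy => hψ.5 x hx.1 y hy.1⟩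
    refine hac (hψ'.measure_eq_zero hB hK.measure_lt_top.ne (hd j)
      ((min_le_left _ _).trans (min_le_left _ _)) (fun x hx => measure_mono ?_)
      (fun x hx => hx.1) fun x hx => hx.2)
    exact (hB.mono _ _ _ ((min_le_left _ _).trans (min_le_right _ _))).trans (hUK x hx.2)
  have hgood : ρ ((U₁ ∩ U₂) ∩ D ∩ (⋃ j, bad j)ᶜ) = 0 := by
    refine hB.measure_eq_zero hΛt hr₂ hK.measure_lt_top.ne (fun x hx => hUK x hx.1.1.2)
      (fun x hx r hr => ?_) (fun x hx => hx.1.2)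
    obtain ⟨j, hj⟩ := exists_nat_one_div_lt hr
    have h1 : x ∉ bad j := fun h => hx.2 (mem_iUnion.2 ⟨j, h⟩)
    have h2 : ¬∀ r, 0 < r → r ≤ d j → Λ * τ (B x r) ≤ τ (B x (3 * r)) := fun h => h1 ⟨hx.1.1, h⟩
    push Not at h2
    obtain ⟨s, hs, hsd, hs'⟩ := h2
    exact ⟨s, hs, hsd.trans ((min_le_right _ _).trans hj.le), hs'.le⟩
  refine measure_mono_null (t := (Dᶜ ∪ ⋃ j, bad j) ∪ ((U₁ ∩ U₂) ∩ D ∩ (⋃ j, bad j)ᶜ))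
    (fun x hx => ?_)
    (measure_union_null (measure_union_null (hac hdiff) (measure_iUnion_null hbad)) hgood)
  by_cases h1 : x ∈ D
  · by_cases h2 : x ∈ ⋃ j, bad j
    · exact Or.inl (Or.inr h2)
    · exact Or.inr ⟨⟨hx, h1⟩, h2⟩
  · exact Or.inl (Or.inl h1)

end Differentiation
end Carnot
end

/-! ### Distributional derivatives of indicators along left invariant fields. -/

noncomputable section

namespace Carnot

section DistributionalDerivatives

variable {F : Type*} [NormedAddCommGroup F] [NormedSpace ℝ F]
  {G : Type*} [TopologicalSpace G] [ChartedSpace F G] [Group G] [LieGroup 𝓘(ℝ, F) ∞ G]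

lemma IsTest.dirDeriv {v : G → ℝ} (hv : IsTest (F := F) v) (X : GroupLieAlgebra 𝓘(ℝ, F) G) :
    IsTest (F := F) (dirDeriv X v) :=
  ⟨contMDiff_dirDeriv X hv.1, hasCompactSupport_dirDeriv X hv.2⟩

lemma IsTest.comp_mul_right {v : G → ℝ} (hv : IsTest (F := F) v) (g : G) :
    IsTest (F := F) fun x => v (x * g) := by
  have : IsTopologicalGroup G := topologicalGroup_of_lieGroup 𝓘(ℝ, F) ∞
  exact ⟨hv.1.comp contMDiff_mul_right, hv.2.comp_homeomorph (Homeomorph.mulRight g)⟩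

omit [Group G] [LieGroup 𝓘(ℝ, F) ∞ G] in
lemma IsTest.add {v w : G → ℝ} (hv : IsTest (F := F) v) (hw : IsTest (F := F) w) :
    IsTest (F := F) (v + w) :=
  ⟨hv.1.add hw.1, hv.2.add hw.2⟩

omit [Group G] [LieGroup 𝓘(ℝ, F) ∞ G] in
lemma IsTest.const_smul {v : G → ℝ} (hv : IsTest (F := F) v) (c : ℝ) :
    IsTest (F := F) (c • v) :=
  ⟨(contDiff_const_smul c).contMDiff.comp hv.1, hv.2.smul_left (f := fun _ => c)⟩

omit [LieGroup 𝓘(ℝ, F) ∞ G] in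
lemma dirDeriv_add_right (X : GroupLieAlgebra 𝓘(ℝ, F) G) {v w : G → ℝ}
    (hv : ContMDiff 𝓘(ℝ, F) 𝓘(ℝ, ℝ) ∞ v) (hw : ContMDiff 𝓘(ℝ, F) 𝓘(ℝ, ℝ) ∞ w) :
    dirDeriv X (v + w) = dirDeriv X v + dirDeriv X w := by
  ext x
  have := mfderiv_add (hv.mdifferentiableAt (x := x) (by simp))
    (hw.mdifferentiableAt (x := x) (by simp))
  exact congrArg (fun L : F →L[ℝ] ℝ => L (mulInvariantVectorField X x)) this

variable [T2Space G] [MeasurableSpace G] [BorelSpace G] {vol : Measure G}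
  [IsFiniteMeasureOnCompacts vol] {E : Set G}

omit [Group G] [LieGroup 𝓘(ℝ, F) ∞ G] [T2Space G] in
lemma IsTest.integrable {v : G → ℝ} (hv : IsTest (F := F) v) (μ : Measure G)
    [IsFiniteMeasureOnCompacts μ] : Integrable v μ :=
  hv.1.continuous.integrable_of_hasCompactSupport hv.2

omit [LieGroup 𝓘(ℝ, F) ∞ G] [T2Space G] [IsFiniteMeasureOnCompacts vol] in
omit [BorelSpace G] in
lemma distDeriv_eq (hE : MeasurableSet E) (X : GroupLieAlgebra 𝓘(ℝ, F) G) (v : G → ℝ) :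
    distDeriv vol X E v = -∫ x in E, dirDeriv X v x ∂vol := by
  rw [distDeriv, ← integral_indicator hE]
  congr 1
  refine integral_congr_ae (Eventually.of_forall fun x => ?_)
  by_cases hx : x ∈ E
  · simp only [indicator_of_mem hx, one_mul]; rfl
  · simp [indicator_of_notMem hx]

omit [T2Space G] in
lemma distDeriv_sum (hE : MeasurableSet E) {ι : Type*} (s : Finset ι) (c : ι → ℝ)
    (X : ι → GroupLieAlgebra 𝓘(ℝ, F) G) {v : G → ℝ} (hv : IsTest (F := F) v) :
    distDeriv vol (∑ i ∈ s, c i • X i) E v = ∑ i ∈ s, c i * distDeriv vol (X i) E v := by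
  simp only [distDeriv_eq hE, dirDeriv_sum, smul_eq_mul]
  rw [integral_finsetSum _ fun i _ =>
    (((hv.dirDeriv (X i)).integrable vol).integrableOn.const_mul _)]
  simp [integral_const_mul, Finset.sum_neg_distrib]

omit [T2Space G] in
lemma distDeriv_add (hE : MeasurableSet E) (X Y : GroupLieAlgebra 𝓘(ℝ, F) G) {v : G → ℝ}
    (hv : IsTest (F := F) v) :
    distDeriv vol (X + Y) E v = distDeriv vol X E v + distDeriv vol Y E v := by
  simp only [distDeriv_eq hE, dirDeriv_add, Pi.add_apply]
  rw [integral_add ((hv.dirDeriv X).integrable vol).integrableOn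
    ((hv.dirDeriv Y).integrable vol).integrableOn, neg_add]

omit [LieGroup 𝓘(ℝ, F) ∞ G] [T2Space G] [IsFiniteMeasureOnCompacts vol] [BorelSpace G] in
lemma distDeriv_smul (hE : MeasurableSet E) (c : ℝ) (X : GroupLieAlgebra 𝓘(ℝ, F) G) (v : G → ℝ) :
    distDeriv vol (c • X) E v = c * distDeriv vol X E v := by
  simp only [distDeriv_eq hE, dirDeriv_smul, Pi.smul_apply, smul_eq_mul]
  rw [integral_const_mul, mul_neg]

omit [T2Space G] in
lemma distDeriv_add_right (hE : MeasurableSet E) (X : GroupLieAlgebra 𝓘(ℝ, F) G) {v w : G → ℝ}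
    (hv : IsTest (F := F) v) (hw : IsTest (F := F) w) :
    distDeriv vol X E (v + w) = distDeriv vol X E v + distDeriv vol X E w := by
  simp only [distDeriv_eq hE, dirDeriv_add_right X hv.1 hw.1, Pi.add_apply]
  rw [integral_add ((hv.dirDeriv X).integrable vol).integrableOn
    ((hw.dirDeriv X).integrable vol).integrableOn, neg_add]

omit [T2Space G] in
lemma distDeriv_lie [CompleteSpace F] (hE : MeasurableSet E) (X Y : GroupLieAlgebra 𝓘(ℝ, F) G)
    {v : G → ℝ} (hv : IsTest (F := F) v) :
    distDeriv vol ⁅X, Y⁆ E v =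
      distDeriv vol X E (dirDeriv Y v) - distDeriv vol Y E (dirDeriv X v) := by
  simp only [distDeriv_eq hE, dirDeriv_lie X Y hv.1]
  rw [integral_sub (((hv.dirDeriv Y).dirDeriv X).integrable vol).integrableOn
    (((hv.dirDeriv X).dirDeriv Y).integrable vol).integrableOn]
  ring

/-- The left invariant vector fields in `Inv(E)` form a linear space. -/
def invSubmodule (vol : Measure G) [IsFiniteMeasureOnCompacts vol] (hE : MeasurableSet E) :
    Submodule ℝ (GroupLieAlgebra 𝓘(ℝ, F) G) where
  carrier := Inv vol E
  add_mem' {X Y} hX hY v hv := by rw [distDeriv_add hE X Y hv, hX v hv, hY v hv, add_zero]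
  zero_mem' v _ := by
    rw [← zero_smul ℝ (0 : GroupLieAlgebra 𝓘(ℝ, F) G), distDeriv_smul hE, zero_mul]
  smul_mem' c X hX v hv := by rw [distDeriv_smul hE, hX v hv, mul_zero]

omit [T2Space G] in
lemma lie_mem_Inv [CompleteSpace F] (hE : MeasurableSet E) {X Y : GroupLieAlgebra 𝓘(ℝ, F) G}
    (hX : X ∈ Inv vol E) (hY : Y ∈ Inv vol E) : ⁅X, Y⁆ ∈ Inv vol E := fun v hv => by
  rw [distDeriv_lie hE X Y hv, hX _ (hv.dirDeriv Y), hY _ (hv.dirDeriv X), sub_zero]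

variable [FiniteDimensional ℝ F] [CompleteSpace F]

omit [FiniteDimensional ℝ F] [MeasurableSpace G] [BorelSpace G] in
-- One compact set supports all the translates over a bounded time interval, which supplies the
-- integrable bound for differentiating under the integral.
lemma exists_isCompact_mul_expCurve {v : G → ℝ} (hv : HasCompactSupport v)
    (X : GroupLieAlgebra 𝓘(ℝ, F) G) (a b : ℝ) :
    ∃ K : Set G, IsCompact K ∧ ∀ x, ∀ t ∈ Icc a b, x ∉ K → v (x * expCurve X t) = 0 := by
  have : IsTopologicalGroup G := topologicalGroup_of_lieGroup 𝓘(ℝ, F) ∞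
  refine ⟨(fun p : G × ℝ => p.1 * expCurve X (-p.2)) '' (tsupport v ×ˢ Icc a b),
    (hv.prod isCompact_Icc).image ?_, fun x t ht hx => ?_⟩
  · exact continuous_fst.mul ((continuous_expCurve X).comp continuous_snd.neg)
  · by_contra h
    refine hx ⟨(x * expCurve X t, t), ⟨subset_tsupport _ h, ht⟩, ?_⟩
    simp [mul_assoc, ← expCurve_add]

omit [FiniteDimensional ℝ F] in
lemma hasDerivAt_integral_comp_mul_expCurve (E : Set G) (X : GroupLieAlgebra 𝓘(ℝ, F) G)
    {v : G → ℝ} (hv : IsTest (F := F) v) (t₀ : ℝ) :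
    HasDerivAt (fun t => ∫ x in E, v (x * expCurve X t) ∂vol)
      (∫ x in E, dirDeriv X v (x * expCurve X t₀) ∂vol) t₀ := by
  have : IsTopologicalGroup G := topologicalGroup_of_lieGroup 𝓘(ℝ, F) ∞
  obtain ⟨C, hC⟩ := (hv.dirDeriv X).2.exists_bound_of_continuous (hv.dirDeriv X).1.continuous
  obtain ⟨K, hK, hvK⟩ := exists_isCompact_mul_expCurve (hv.dirDeriv X).2 X (t₀ - 1) (t₀ + 1)
  have hint : ∀ t, Integrable (fun x => v (x * expCurve X t)) (vol.restrict E) := fun t =>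
    ((hv.comp_mul_right _).integrable vol).integrableOn
  refine (hasDerivAt_integral_of_dominated_loc_of_deriv_le (μ := vol.restrict E)
    (F' := fun t x => dirDeriv X v (x * expCurve X t)) (bound := K.indicator fun _ => C)
    (Icc_mem_nhds (sub_one_lt t₀) (lt_add_one t₀)) (Eventually.of_forall fun t => (hint t).1)
    (hint t₀) (((hv.dirDeriv X).comp_mul_right _).integrable vol).integrableOn.1
    (Eventually.of_forall fun x t ht => ?_) ?_ (Eventually.of_forall fun x t _ => ?_)).2
  · by_cases hx : x ∈ K
    · rw [indicator_of_mem hx]; exact hC _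
    · rw [indicator_of_notMem hx, hvK x t ht hx, norm_zero]
  · rw [integrable_indicator_iff hK.measurableSet]
    refine integrableOn_const (ne_of_lt ?_)
    exact (Measure.restrict_apply_le _ _).trans_lt hK.measure_lt_top
  · exact hasDerivAt_comp_mul_expCurve X hv.1 x t

omit [FiniteDimensional ℝ F] in
/-- `E` is invariant under the flow of a field in `Inv(E)`. -/
lemma integral_comp_mul_expCurve_of_mem_Inv (hE : MeasurableSet E)
    {X : GroupLieAlgebra 𝓘(ℝ, F) G} (hX : X ∈ Inv vol E) {v : G → ℝ} (hv : IsTest (F := F) v)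
    (t : ℝ) : ∫ x in E, v (x * expCurve X t) ∂vol = ∫ x in E, v x ∂vol := by
  -- The derivative at time `t` is the pairing of `X 𝟙_E` with a translated test function, again a
  -- test function, hence zero.
  have h0 : ∀ t, ∫ x in E, dirDeriv X v (x * expCurve X t) ∂vol = 0 := fun t => by
    have := hX _ (hv.comp_mul_right (expCurve X t))
    rw [distDeriv_eq hE, neg_eq_zero] at this
    simpa only [dirDeriv_comp_mul_expCurve X hv.1] using this
  have hd := hasDerivAt_integral_comp_mul_expCurve (vol := vol) E X hv
  simp only [h0] at hd
  have := is_const_of_deriv_eq_zero (fun t => (hd t).differentiableAt) (fun t => (hd t).deriv) t 0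
  simpa using this

omit [T2Space G] [MeasurableSpace G] [BorelSpace G] [CompleteSpace F] in
lemma exists_isTest_one_le [T2Space G] {K : Set G} (hK : IsCompact K) :
    ∃ φ : G → ℝ, IsTest (F := F) φ ∧ (∀ x, 0 ≤ φ x) ∧ ∀ x ∈ K, 1 ≤ φ x := by
  have : IsManifold 𝓘(ℝ, F) ∞ G := inferInstance
  let f : ∀ x : G, SmoothBumpFunction 𝓘(ℝ, F) x := fun x => Classical.choice inferInstance
  obtain ⟨t, -, ht⟩ := hK.elim_nhds_subcover (fun x => {y | f x y = 1})
    fun x _ => (f x).eventuallyEq_one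
  refine ⟨∑ x ∈ t, f x, ?_, fun x => ?_, fun x hx => ?_⟩
  · clear ht
    classical
    induction t using Finset.induction_on with
    | empty => exact ⟨contMDiff_const, HasCompactSupport.zero⟩
    | insert a s ha ih =>
      rw [Finset.sum_insert ha]
      exact IsTest.add ⟨(f a).contMDiff, (f a).hasCompactSupport⟩ ih
  · rw [Finset.sum_apply]
    exact Finset.sum_nonneg fun y _ => (f y).nonneg
  · obtain ⟨y, hy, hyx⟩ := mem_iUnion₂.1 (ht hx)
    rw [Finset.sum_apply, ← show f y x = 1 from hyx]
    exact Finset.single_le_sum (f := fun y => f y x) (fun y _ => (f y).nonneg) hy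

omit [CompleteSpace F] in
-- Any test function becomes nonnegative after adding a multiple of a nonnegative test function that
-- is at least `1` on its support.
lemma mem_Inv_of_forall_nonneg (hE : MeasurableSet E) {Z : GroupLieAlgebra 𝓘(ℝ, F) G}
    (h : ∀ v : G → ℝ, IsTest (F := F) v → (∀ x, 0 ≤ v x) → distDeriv vol Z E v = 0) :
    Z ∈ Inv vol E := by
  intro v hv
  obtain ⟨C, hC⟩ := hv.2.exists_bound_of_continuous hv.1.continuous
  obtain ⟨φ, hφ, hφ0, hφ1⟩ := exists_isTest_one_le (F := F) hv.2.isCompact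
  have hψ := hφ.const_smul |C|
  have h1 := h _ hψ fun x => mul_nonneg (abs_nonneg C) (hφ0 x)
  have h2 := h _ (hv.add hψ) fun x => ?_
  · rwa [distDeriv_add_right hE Z hv hψ, h1, add_zero] at h2
  · by_cases hx : x ∈ tsupport v
    · have e1 : -|C| ≤ v x := by
        have := (hC x).trans (le_abs_self C)
        rw [Real.norm_eq_abs] at this
        exact (abs_le.1 this).1
      have e2 : |C| ≤ |C| * φ x := le_mul_of_one_le_right (abs_nonneg _) (hφ1 x hx)
      change 0 ≤ v x + |C| * φ x
      linarith
    · change 0 ≤ v x + |C| * φ x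
      rw [image_eq_zero_of_notMem_tsupport hx, zero_add]
      exact mul_nonneg (abs_nonneg _) (hφ0 x)

/-- If `E` is invariant along `X` and monotone along `Y`, and `[X, [X, Y]] = 0`, then `E` is
invariant along `[X, Y]`. -/
lemma lie_mem_Inv_of_nonneg (hE : MeasurableSet E) {X Y : GroupLieAlgebra 𝓘(ℝ, F) G}
    (hX : X ∈ Inv vol E) (hXY : ⁅X, ⁅X, Y⁆⁆ = 0)
    (hY : ∀ v : G → ℝ, IsTest (F := F) v → (∀ x, 0 ≤ v x) → 0 ≤ distDeriv vol Y E v) :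
    ⁅X, Y⁆ ∈ Inv vol E := by
  refine mem_Inv_of_forall_nonneg hE fun v hv hv0 => ?_
  -- Translating the test function replaces `Y` by `Y - t [X, Y]`, and the remaining translation is
  -- absorbed by the invariance of `E` along `X`.
  have key : ∀ t, distDeriv vol Y E (fun x => v (x * expCurve X t)) =
      distDeriv vol Y E v - t * distDeriv vol ⁅X, Y⁆ E v := by
    intro t
    have h1 : ∀ x, dirDeriv Y (fun y => v (y * expCurve X t)) x =
        dirDeriv (Y + (-t) • ⁅X, Y⁆) v (x * expCurve X t) := fun x => by
      have := dirDeriv_conj_of_lie_lie_eq_zero hXY hv.1 (x * expCurve X t) (-t)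
      rw [neg_neg, mul_assoc, ← expCurve_add, add_neg_cancel, expCurve_zero, mul_one] at this
      exact this
    rw [distDeriv_eq hE]
    simp only [h1]
    rw [integral_comp_mul_expCurve_of_mem_Inv hE hX (hv.dirDeriv _), ← distDeriv_eq hE,
      distDeriv_add hE _ _ hv, distDeriv_smul hE]
    ring
  have hpos : ∀ t : ℝ, 0 ≤ distDeriv vol Y E v - t * distDeriv vol ⁅X, Y⁆ E v := fun t => by
    rw [← key]
    exact hY _ (hv.comp_mul_right _) fun x => hv0 _
  by_contra h0
  -- With a nonzero slope, this `t` makes the affine function equal to `-1`.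
  have := hpos ((distDeriv vol Y E v + 1) / distDeriv vol ⁅X, Y⁆ E v)
  rw [div_mul_cancel₀ _ h0] at this
  linarith

end DistributionalDerivatives
end Carnot
end

/-! ### Bilinearity of the bracket and step two stratifications. -/

noncomputable section

namespace Carnot

section Bilinear

variable {F : Type*} [NormedAddCommGroup F] [NormedSpace ℝ F] [CompleteSpace F]
  {G : Type*} [TopologicalSpace G] [ChartedSpace F G] [Group G] [LieGroup 𝓘(ℝ, F) ∞ G]

/-- The bracket, as a linear map in the first variable. -/
def lieLeft (Y : GroupLieAlgebra 𝓘(ℝ, F) G) :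
    GroupLieAlgebra 𝓘(ℝ, F) G →ₗ[ℝ] GroupLieAlgebra 𝓘(ℝ, F) G where
  toFun X := ⁅X, Y⁆
  map_add' X X' := by
    have := lieGroup_minSmoothness (F := F) (G := G)
    exact add_lie X X' Y
  map_smul' c X := by
    have := lieGroup_minSmoothness (F := F) (G := G)
    exact smul_lie c X Y

lemma lieLeft_apply (X Y : GroupLieAlgebra 𝓘(ℝ, F) G) : lieLeft Y X = ⁅X, Y⁆ := rfl

lemma lie_add_smul_left (X X' Y : GroupLieAlgebra 𝓘(ℝ, F) G) (c : ℝ) :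
    ⁅X + c • X', Y⁆ = ⁅X, Y⁆ + c • ⁅X', Y⁆ := by
  simp only [← lieLeft_apply, map_add, map_smul]

lemma lie_add_smul_right (X Y Y' : GroupLieAlgebra 𝓘(ℝ, F) G) (c : ℝ) :
    ⁅X, Y + c • Y'⁆ = ⁅X, Y⁆ + c • ⁅X, Y'⁆ := by
  rw [lie_swap X, lie_add_smul_left, lie_swap X Y, lie_swap X Y']
  module

lemma lie_self_eq_zero (X : GroupLieAlgebra 𝓘(ℝ, F) G) : ⁅X, X⁆ = 0 := by
  have := lieGroup_minSmoothness (F := F) (G := G)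
  exact lie_self X

/-- `[V, W]` is spanned by the brackets of generators of `V` and `W`. -/
lemma bracketSpan_span_le (S T : Set (GroupLieAlgebra 𝓘(ℝ, F) G))
    {P : Submodule ℝ (GroupLieAlgebra 𝓘(ℝ, F) G)} (h : ∀ v ∈ S, ∀ w ∈ T, ⁅v, w⁆ ∈ P) :
    bracketSpan (Submodule.span ℝ S) (Submodule.span ℝ T) ≤ P := by
  refine Submodule.span_le.2 ?_
  rintro _ ⟨v, hv, w, hw, rfl⟩
  have h1 : ∀ v ∈ S, Submodule.span ℝ T ≤ P.comap (lieLeft v) := fun v hv =>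
    Submodule.span_le.2 fun w hw => by
      change ⁅w, v⁆ ∈ P
      rw [lie_swap]
      exact P.neg_mem (h v hv w hw)
  have h2 : Submodule.span ℝ S ≤ P.comap (lieLeft w) := Submodule.span_le.2 fun v hv => by
    change ⁅v, w⁆ ∈ P
    rw [lie_swap]
    exact P.neg_mem (h1 v hv hw)
  exact h2 hv

variable {V : ℕ → Submodule ℝ (GroupLieAlgebra 𝓘(ℝ, F) G)}

omit [CompleteSpace F] [LieGroup 𝓘(ℝ, F) ∞ G] in
lemma IsStratification.lie_lie_eq_zero (hV : IsStratification 2 V)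
    {X Y Z : GroupLieAlgebra 𝓘(ℝ, F) G} (hX : X ∈ V 1) (hY : Y ∈ V 1) (hZ : Z ∈ V 1) :
    ⁅Z, ⁅X, Y⁆⁆ = 0 := by
  have h1 : ⁅X, Y⁆ ∈ V 2 := by
    rw [← hV.bracket 1 le_rfl one_le_two]
    exact Submodule.subset_span ⟨X, hX, Y, hY, rfl⟩
  have h2 : ⁅⁅X, Y⁆, Z⁆ ∈ V 3 := by
    rw [← hV.bracket 2 one_le_two le_rfl]
    exact Submodule.subset_span ⟨_, h1, Z, hZ, rfl⟩
  rw [hV.after_last, Submodule.mem_bot] at h2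
  rw [lie_swap, h2, neg_zero]

omit [CompleteSpace F] [LieGroup 𝓘(ℝ, F) ∞ G] in
lemma span_range_coe_basis {m : ℕ} {W : Submodule ℝ (GroupLieAlgebra 𝓘(ℝ, F) G)}
    (b : Module.Basis (Fin m) ℝ W) :
    Submodule.span ℝ (range fun i => (b i : GroupLieAlgebra 𝓘(ℝ, F) G)) = W := by
  have := congrArg (Submodule.map W.subtype) b.span_eq
  rw [Submodule.map_span, ← range_comp, Submodule.map_top, Submodule.range_subtype] at this
  exact this

lemma IsStratification.span_eq_top (hV : IsStratification 2 V) {m : ℕ}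
    (b : Module.Basis (Fin m) ℝ (V 1)) :
    Submodule.span ℝ (range (Sum.elim (fun i => (b i : GroupLieAlgebra 𝓘(ℝ, F) G))
      fun p : Fin m × Fin m =>
        ⁅(b p.1 : GroupLieAlgebra 𝓘(ℝ, F) G), (b p.2 : GroupLieAlgebra 𝓘(ℝ, F) G)⁆)) = ⊤ := by
  rw [eq_top_iff, ← hV.isInternal.submodule_iSup_eq_top, iSup_le_iff]
  intro i
  fin_cases i
  · change V 1 ≤ _
    refine (span_range_coe_basis b).ge.trans (Submodule.span_mono ?_)
    rintro _ ⟨i, rfl⟩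
    exact ⟨Sum.inl i, rfl⟩
  · change V 2 ≤ _
    have h : bracketSpan (V 1) (V 1) = V 2 := hV.bracket 1 le_rfl one_le_two
    have h' := congrArg₂ bracketSpan (span_range_coe_basis b) (span_range_coe_basis b)
    refine (h'.trans h).ge.trans (bracketSpan_span_le _ _ ?_)
    rintro _ ⟨i, rfl⟩ _ ⟨j, rfl⟩
    exact Submodule.subset_span ⟨Sum.inr (i, j), rfl⟩

end Bilinear

/-! ### From a constant normal to a vertical halfspace. -/

section ConstantNormal

variable {F : Type*} [NormedAddCommGroup F] [NormedSpace ℝ F] [FiniteDimensional ℝ F]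
  {G : Type*} [TopologicalSpace G] [ChartedSpace F G] [Group G] [LieGroup 𝓘(ℝ, F) ∞ G] [T2Space G]
  {m : ℕ}

lemma isBallFamily_ccBall {X : Fin m → GroupLieAlgebra 𝓘(ℝ, F) G}
    (hX : ∀ i j k, ⁅X k, ⁅X i, X j⁆⁆ = 0)
    (hspan : Submodule.span ℝ
      (range (Sum.elim X fun p : Fin m × Fin m => ⁅X p.1, X p.2⁆)) = ⊤) :
    IsBallFamily (ccBall X) where
  isOpen := isOpen_ccBall hX hspan
  mem_self x _ hr := mem_of_mem_nhds (ccBall_mem_nhds hX hspan x hr)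
  mono x _ _ h := ccBall_mono X x h
  symm _ _ _ h := ccBall_symm h
  trans _ _ _ _ _ h h' := ccBall_trans h h'

variable [LocallyCompactSpace G]

lemma exists_nhds_ccBall_subset_isCompact (X : Fin m → GroupLieAlgebra 𝓘(ℝ, F) G) (x₀ : G) :
    ∃ U ∈ 𝓝 x₀, ∃ K, IsCompact K ∧ ∃ r > 0, ∀ x ∈ U, ccBall X x r ⊆ K := by
  have : IsTopologicalGroup G := topologicalGroup_of_lieGroup 𝓘(ℝ, F) ∞
  obtain ⟨K, hK, r, hr, hKr⟩ := exists_ccBall_subset_isCompact X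
  obtain ⟨U, hU, hx₀⟩ := exists_compact_mem_nhds x₀
  refine ⟨U, hx₀, (fun p : G × G => p.1 * p.2) '' (U ×ˢ K),
    (hU.prod hK).image continuous_mul, r, hr, fun x hx y hy => ?_⟩
  have hy' : x⁻¹ * y ∈ ccBall X 1 r := by
    rw [← mul_mem_ccBall_iff (x := x), mul_inv_cancel_left]
    exact hy
  exact ⟨(x, x⁻¹ * y), ⟨hx, hKr hy'⟩, mul_inv_cancel_left x y⟩

variable [SecondCountableTopology G] [MeasurableSpace G] [BorelSpace G]

/-- If the horizontal normal is constant then so is the density of `D` with respect to `|D|`. -/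
theorem defect_eq_zero_of_isHorizontalNormalAt {X : Fin m → GroupLieAlgebra 𝓘(ℝ, F) G}
    (hX : ∀ i j k, ⁅X k, ⁅X i, X j⁆⁆ = 0)
    (hspan : Submodule.span ℝ
      (range (Sum.elim X fun p : Fin m × Fin m => ⁅X p.1, X p.2⁆)) = ⊤)
    (D : Fin m → RadonMeasure G) {ξ : EuclideanSpace ℝ (Fin m)}
    (hν : ∀ᵐ x ∂(totalVariation D), IsHorizontalNormalAt X D x ξ) :
    defect D ξ = 0 := by
  have hB := isBallFamily_ccBall hX hspan
  refine hB.eq_zero_of_density_eq_zero (F := F) (τ := totalVariation D) (fun x₀ => ?_)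
    (exists_nhds_ccBall_subset_isCompact X) (defect_absolutelyContinuous D ξ) ?_
  · obtain ⟨ψ, U, hU, -, c, hc, ρ, hρ, R, H⟩ := exists_local_chart hX hspan x₀
    exact ⟨ψ, U, hU, c, ρ, |R|, hc, hρ, abs_nonneg R,
      fun x hx => (H x hx).1.trans (le_abs_self R), fun x hx => (H x hx).2⟩
  filter_upwards [hν] with x hx ε hε
  obtain ⟨U, hU, K, hK, r₁, hr₁, hUK⟩ := exists_nhds_ccBall_subset_isCompact X x
  -- The given `ε` may be infinite; truncating at `1` yields a positive real number.
  set δ : ℝ := (min ε 1).toReal with hδ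
  have hδt : min ε 1 ≠ ⊤ := ne_top_of_le_ne_top ENNReal.one_ne_top (min_le_right _ _)
  have hδ0 : 0 < δ := ENNReal.toReal_pos (by simp [hε]) hδt
  -- This quantity is the ratio of the defect of the ball to its total variation; its limit is `1 -
  -- |ξ|² = 0`.
  have h1 : Tendsto (fun r : ℝ => 1 - inner ℝ ξ ((totalVariation D (ccBall X x r)).toReal⁻¹ •
      vectorApply D (ccBall X x r))) (𝓝[>] 0) (𝓝 0) := by
    have := (tendsto_const_nhds (x := ξ)).inner (𝕜 := ℝ) hx.tendsto
    rw [real_inner_self_eq_norm_sq, hx.norm_eq_one] at this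
    simpa using this.const_sub 1
  have h2 : ∀ᶠ r : ℝ in 𝓝[>] 0, 1 - inner ℝ ξ ((totalVariation D (ccBall X x r)).toReal⁻¹ •
      vectorApply D (ccBall X x r)) < δ := h1.eventually_lt_const hδ0
  obtain ⟨r₂, hr₂, hr₂'⟩ := mem_nhdsGT_iff_exists_Ioc_subset.1 h2
  refine ⟨min r₁ r₂, lt_min hr₁ hr₂, fun s hs hsr => ?_⟩
  have hsK : ccBall X x s ⊆ K :=
    (ccBall_mono X x (hsr.trans (min_le_left _ _))).trans (hUK x (mem_of_mem_nhds hU))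
  have hfin : totalVariation D (ccBall X x s) ≠ ⊤ :=
    ne_top_of_le_ne_top hK.measure_lt_top.ne (measure_mono hsK)
  set T : ℝ := (totalVariation D (ccBall X x s)).toReal with hT
  have hT0 : 0 < T := ENNReal.toReal_pos (hx.mem_support s hs).ne' hfin
  have h3 : 1 - inner ℝ ξ (T⁻¹ • vectorApply D (ccBall X x s)) < δ :=
    hr₂' ⟨hs, hsr.trans (min_le_right _ _)⟩
  rw [inner_smul_right] at h3
  rw [defect_apply D hx.norm_eq_one (hB.isOpen x s).measurableSet hK hsK, ← hT]
  calc ENNReal.ofReal (T - inner ℝ ξ (vectorApply D (ccBall X x s)))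
      ≤ ENNReal.ofReal (δ * T) := by
        refine ENNReal.ofReal_le_ofReal ?_
        have := mul_le_mul_of_nonneg_right h3.le hT0.le
        rwa [sub_mul, one_mul, mul_right_comm, inv_mul_cancel₀ hT0.ne', one_mul] at this
    _ = min ε 1 * totalVariation D (ccBall X x s) := by
        rw [ENNReal.ofReal_mul hδ0.le, hδ, ENNReal.ofReal_toReal hδt, hT,
          ENNReal.ofReal_toReal hfin]
    _ ≤ ε * totalVariation D (ccBall X x s) := by gcongr; exact min_le_left _ _

omit [LocallyCompactSpace G] [SecondCountableTopology G] in
lemma exists_isTest_integral_pos [SigmaCompactSpace G] (τ : Measure G)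
    [IsFiniteMeasureOnCompacts τ] (hτ : τ ≠ 0) :
    ∃ v : G → ℝ, IsTest (F := F) v ∧ 0 < ∫ x, v x ∂τ := by
  obtain ⟨K, hK, hK0⟩ : ∃ K : Set G, IsCompact K ∧ τ K ≠ 0 := by
    by_contra! h
    refine hτ (Measure.measure_univ_eq_zero.1 ?_)
    rw [← iUnion_compactCovering]
    exact measure_iUnion_null fun n => h _ (isCompact_compactCovering G n)
  obtain ⟨φ, hφ, hφ0, hφ1⟩ := exists_isTest_one_le (F := F) hK
  refine ⟨φ, hφ, (ENNReal.toReal_pos hK0 hK.measure_lt_top.ne).trans_le ?_⟩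
  calc (τ K).toReal = ∫ x in K, (1 : ℝ) ∂τ := by simp [Measure.real]
    _ ≤ ∫ x in K, φ x ∂τ := setIntegral_mono_on (integrableOn_const hK.measure_lt_top.ne)
        (hφ.integrable τ).integrableOn hK.measurableSet hφ1
    _ ≤ ∫ x, φ x ∂τ := setIntegral_le_integral (hφ.integrable τ) (Eventually.of_forall hφ0)

/-- In step two, a set whose horizontal derivatives are multiples of one nonnegative Radon measure
is a vertical halfspace. -/
theorem isVerticalHalfspace_of_distDeriv_eq {V : ℕ → Submodule ℝ (GroupLieAlgebra 𝓘(ℝ, F) G)}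
    (hV : IsStratification 2 V) {vol : Measure G} [IsFiniteMeasureOnCompacts vol] {E : Set G}
    (hE : MeasurableSet E) {τ : Measure G} [IsFiniteMeasureOnCompacts τ] (hτ : τ ≠ 0)
    [FiniteDimensional ℝ (V 1)] (l : V 1 →ₗ[ℝ] ℝ) (hl : l ≠ 0)
    (h : ∀ X : V 1, ∀ v : G → ℝ, IsTest (F := F) v →
      distDeriv vol (X : GroupLieAlgebra 𝓘(ℝ, F) G) E v = l X * ∫ x, v x ∂τ) :
    IsVerticalHalfspace vol 2 V E := by
  have : CompleteSpace F := FiniteDimensional.complete ℝ F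
  obtain ⟨φ, hφ, hφ0⟩ := exists_isTest_integral_pos (F := F) τ hτ
  have hInv : ∀ X : V 1, (X : GroupLieAlgebra 𝓘(ℝ, F) G) ∈ Inv vol E ↔ l X = 0 := by
    refine fun X => ⟨fun hX => ?_, fun hX v hv => by rw [h X v hv, hX, zero_mul]⟩
    have := hX φ hφ
    rw [h X φ hφ] at this
    exact (mul_eq_zero.1 this).resolve_right hφ0.ne'
  obtain ⟨Y, hY⟩ : ∃ Y : V 1, l Y = 1 := by
    obtain ⟨Y, hY⟩ := DFunLike.ne_iff.1 hl
    exact ⟨(l Y)⁻¹ • Y, by rw [map_smul, smul_eq_mul]; exact inv_mul_cancel₀ hY⟩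
  have hYpos : ∀ v : G → ℝ, IsTest (F := F) v → (∀ x, 0 ≤ v x) →
      0 ≤ distDeriv vol (Y : GroupLieAlgebra 𝓘(ℝ, F) G) E v := fun v hv hv0 => by
    rw [h Y v hv, hY, one_mul]
    exact integral_nonneg hv0
  -- The splitting `V 1 = ker l ⊕ ℝ Y`.
  have hdecomp : ∀ v : V 1, ∃ v₀ : V 1, l v₀ = 0 ∧
      (v : GroupLieAlgebra 𝓘(ℝ, F) G) = v₀ + l v • (Y : GroupLieAlgebra 𝓘(ℝ, F) G) := fun v =>
    ⟨v - l v • Y, by simp [hY], by simp⟩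
  let P := invSubmodule (F := F) vol hE
  have hker : ∀ v₀ : V 1, l v₀ = 0 →
      ⁅(v₀ : GroupLieAlgebra 𝓘(ℝ, F) G), (Y : GroupLieAlgebra 𝓘(ℝ, F) G)⁆ ∈ P :=
    fun v₀ hv₀ => lie_mem_Inv_of_nonneg hE ((hInv v₀).2 hv₀)
      (hV.lie_lie_eq_zero v₀.2 Y.2 v₀.2) hYpos
  have hbr : V 2 ≤ P := by
    rw [← hV.bracket 1 le_rfl one_le_two]
    refine Submodule.span_le.2 ?_
    rintro _ ⟨v, hv, w, hw, rfl⟩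
    obtain ⟨v₀, hv₀, hv'⟩ := hdecomp ⟨v, hv⟩
    obtain ⟨w₀, hw₀, hw'⟩ := hdecomp ⟨w, hw⟩
    change v = _ at hv'
    change w = _ at hw'
    -- The bracket expands into a term in `[ker l, ker l]`, invariant because `Inv(E)` is closed
    -- under brackets, two terms in `[ker l, Y]`, invariant by monotonicity along `Y`, and `[Y, Y] =
    -- 0`.
    rw [hv', hw', lie_add_smul_left, lie_add_smul_right, lie_add_smul_right, lie_self_eq_zero,
      smul_zero, add_zero]
    refine P.add_mem (P.add_mem (lie_mem_Inv hE ((hInv v₀).2 hv₀) ((hInv w₀).2 hw₀))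
      (P.smul_mem _ (hker v₀ hv₀))) (P.smul_mem _ ?_)
    rw [lie_swap]
    exact P.neg_mem (hker w₀ hw₀)
  refine ⟨hE, fun i hi hi' => ?_, ⟨(LinearMap.ker l).map (V 1).subtype, ?_, ?_⟩,
    Y, Y.2, hYpos, φ, hφ, ?_⟩
  · obtain rfl : i = 2 := le_antisymm hi' hi
    exact fun X hX => ⟨hbr hX, mem_iUnion₂.2 ⟨2, ⟨one_le_two, le_rfl⟩, hX⟩⟩
  · ext X
    constructor
    · rintro ⟨X, hX, rfl⟩
      exact ⟨X.2, (hInv X).2 hX, mem_iUnion₂.2 ⟨1, ⟨le_rfl, one_le_two⟩, X.2⟩⟩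
    · rintro ⟨hX1, hX, -⟩
      exact ⟨⟨X, hX1⟩, (hInv ⟨X, hX1⟩).1 hX, rfl⟩
  · rw [← (Submodule.equivMapOfInjective _ (V 1).injective_subtype (LinearMap.ker l)).finrank_eq]
    exact Module.Dual.finrank_ker_add_one_of_ne_zero hl
  · rw [h Y φ hφ, hY, one_mul]
    exact hφ0.ne'

end ConstantNormal

end Carnot

theorem mainTheorem7
    {F : Type*} [NormedAddCommGroup F] [NormedSpace ℝ F]
    {G : Type*} [TopologicalSpace G] [ChartedSpace F G] [Group G]
    [MeasurableSpace G] [BorelSpace G]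
    -- `G` is a Carnot group of step 2 with layers `V 1` and `V 2`
    (V : ℕ → Submodule ℝ (GroupLieAlgebra 𝓘(ℝ, F) G)) (hG : Carnot.IsCarnotGroup 2 V)
    -- a basis of `V 1`, orthonormal for the inner product fixed on `V 1`
    {m : ℕ} (b : Module.Basis (Fin m) ℝ (V 1))
    -- the right Haar measure
    (vol : Measure G) [vol.IsMulRightInvariant] [IsFiniteMeasureOnCompacts vol]
    [vol.IsOpenPosMeasure]
    -- a set of locally finite perimeter, and the vector measure `D = D 𝟙_E`, not zero
    (E : Set G) (hE : Carnot.LocallyFinitePerimeter vol (V 1) E)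
    (D : Fin m → Carnot.RadonMeasure G)
    (hD : Carnot.IsGradient vol (fun i => (b i : GroupLieAlgebra 𝓘(ℝ, F) G)) E D)
    (hD_ne : Carnot.totalVariation D ≠ 0)
    -- the horizontal normal is equal to a constant `|D 𝟙_E|`-almost everywhere
    (hν : ∃ ξ : EuclideanSpace ℝ (Fin m), ∀ᵐ x ∂(Carnot.totalVariation D),
      Carnot.IsHorizontalNormalAt (fun i => (b i : GroupLieAlgebra 𝓘(ℝ, F) G)) D x ξ) :
    Carnot.IsVerticalHalfspace vol 2 V E := by
  have := hG.lieGroup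
  have := hG.hausdorff
  have := hG.secondCountable
  have := hG.finiteDimensional
  have : CompleteSpace F := FiniteDimensional.complete ℝ F
  have : LocallyCompactSpace G := Manifold.locallyCompact_of_finiteDimensional 𝓘(ℝ, F)
  have : FiniteDimensional ℝ (V 1) := b.finiteDimensional_of_finite
  obtain ⟨ξ, hξ⟩ := hν
  -- As `|D|` is not zero, the almost everywhere condition holds at some point.
  have hξ1 : ‖ξ‖ = 1 := by
    have := ae_neBot.2 hD_ne
    obtain ⟨x, hx⟩ := hξ.exists
    exact hx.norm_eq_one
  have hdef := Carnot.defect_eq_zero_of_isHorizontalNormalAt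
    (fun i j k => hG.stratified.lie_lie_eq_zero (b i).2 (b j).2 (b k).2)
    (hG.stratified.span_eq_top b) D hξ
  -- The linear form takes the value `ξ i` at the `i`-th basis vector; it is nonzero because `|ξ| =
  -- 1`.
  refine Carnot.isVerticalHalfspace_of_distDeriv_eq hG.stratified hE.1 hD_ne
    (b.constr ℝ fun i => ξ i) (fun h0 => ?_) fun X v hv => ?_
  · have : ξ = 0 := by
      ext i
      simpa using congrArg (fun l : V 1 →ₗ[ℝ] ℝ => l (b i)) h0
    simp [this] at hξ1
  · have hX : (X : GroupLieAlgebra 𝓘(ℝ, F) G) =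
        ∑ i, b.repr X i • (b i : GroupLieAlgebra 𝓘(ℝ, F) G) := by
      have := congrArg (V 1).subtype (b.sum_repr X)
      rw [map_sum] at this
      exact this.symm
    rw [hX, Carnot.distDeriv_sum hE.1 _ _ _ hv, b.constr_apply_fintype ℝ, Finset.sum_mul]
    refine Finset.sum_congr rfl fun i _ => ?_
    rw [hD i v hv, Carnot.integral_eq_of_defect_eq_zero D hξ1 hdef hv.1.continuous hv.2,
      smul_eq_mul, mul_assoc]
    rfl

end
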